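/- **Setting.** A *diagram* is a directed graph $D$ with a distinguished edge $\mathrm{id}:f\to f$ at every vertex. Let $D$ be a *graded diagram with commutative product and unit*: every vertex $f$ has a degree $|f|\in\mathbb{Z}/2$ (an edge $\gamma:f\to f'$ has degree $|\gamma|=|f|-|f'|$); there is a product $f\times g$ of vertices with $|f\times g|=|f|+|g|$, with edges $\gamma\times\mathrm{id}_g:f\times g\to f'\times g$ and $\mathrm{id}_g\times\gamma:g\times f\to g\times f'$ for every edge $\gamma:f\to f'$ (and $\mathrm{id}_f\times\mathrm{id}_g=\mathrm{id}_{f\times g}$); there are chosen edges $\alpha_{f,g}:f\times g\to g\times f$ and $\beta_{f,g,h}:f\times(g\times h)\to(f\times g)\times h$; and there is a vertex $\mathbf 1$ of degree $0$ with chosen edges $u_f:f\to\mathbf 1\times f$. A *representation* $T$ of $D$ assigns to each vertex $p$ a finite-dimensional $\mathbb{Q}$-vector space $T(p)$ and to each edge $p\to q$ a linear map $T(p)\to T(q)$, identities going to identities. A *unital graded representation* is a representation $T$ with isomorphisms $\tau_{f,g}:T(f\times g)\to T(f)\otimes T(g)$ such that (1) $\tau_{g,f}\,T(\alpha_{f,g})\,\tau_{f,g}^{-1}$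 is $(-1)^{|f||g|}$ times the exchange of factors; (2) $\tau_{f',g}\,T(\gamma\times\mathrm{id})=(T(\gamma)\otimes\mathrm{id})\,\tau_{f,g}$; (3) $\tau_{g,f'}\,T(\mathrm{id}\times\gamma)=(-1)^{|g||\gamma|}(\mathrm{id}\otimes T(\gamma))\,\tau_{g,f}$; (4) $\beta_{f,g,h}$ induces via $\tau$ the standard associativity isomorphism; (5) all $T(u_f)$ are isomorphisms, and $T(\mathbf 1)\neq0$. For representations $T,T'$ and a finite full subdiagram $F$, let $\mathrm{Hom}(T|_F,T'|_F)$ be the space of families of linear maps $T(p)\to T'(p)$, $p\in F$, commuting with all edges of $F$. For unital graded $T,T'$, put $$A_{T,T'}=\varinjlim_F \mathrm{Hom}(T|_F,T'|_F)^\vee ,$$ a commutative $\mathbb{Q}$-algebra with multiplication induced by the product of $D$ and $\tau$. It is spanned by the matrix coefficients $\langle p,v,\gamma\rangle:\varphi\mapsto\gamma(\varphi_p(v))$, $v\in T(p)$, $\gamma\in T'(p)^\vee$. The diagram category $\mathcal C(T)$ is the colimit over $F$ of the categories of finite-dimensional $\mathrm{End}(T|_F)$-modules, with its forgetful functor to $\mathbb{Q}$-vector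 spaces, again denoted $T$, the canonical representation $\tilde T:D\to\mathcal C(T)$, and the symmetric tensor product induced by the product of $D$ and $\tau$. A *torsor* in schemes over $\mathbb{Q}$ is a scheme $X$ with a morphism $(\cdot,\cdot,\cdot):X\times X\times X\to X$ such that on $S$-valued points, for every $S$, $(x,y,y)=(y,y,x)=x$ and $((x,y,z),u,v)=(x,(u,z,y),v)=(x,y,(z,u,v))$. **Theorem.** Let $T_1,T_2$ be unital graded representations of $D$ that become isomorphic as representations of $D$ over some field extension $K/\mathbb{Q}$, and suppose that $\mathcal C(T_1)$ is a neutral Tannakian category over $\mathbb{Q}$. Then $T_2$ extends along $\tilde T_1$ to a fiber functor $T_2:\mathcal C(T_1)\to\mathbb{Q}\text{-mod}$ (a $\mathbb{Q}$-linear, exact, faithful, symmetric tensor functor, with identifications $T_2(p)\cong T_2(\tilde T_1 p)$ compatible with edges and with $\tau$) such that the following hold. 1. For $i,j\in\{1,2\}$, the affine scheme $X_{i,j}=\mathrm{Spec}\,A_{T_i,T_j}$ over $\mathbb{Q}$ is $\mathrm{Iso}^\otimes(T_i,T_j)$: for every $\mathbb{Q}$-algebra $S$, its $S$-points correspond, functorially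 in $S$, to the $S$-linear tensor isomorphisms $f:S\otimes T_i\to S\otimes T_j$ of functors on $\mathcal C(T_1)$, and the value of $\langle p,v,\gamma\rangle$ at the point of $f$ is $\gamma(f_p(v))$. 2. Composition of tensor isomorphisms ($fg$ means $f$ followed by $g$) makes $G_1=X_{1,1}$ and $G_2=X_{2,2}$ affine group schemes and is given by morphisms of schemes $X_{1,2}\times X_{2,1}\to G_1$, $X_{2,1}\times X_{1,2}\to G_2$, $G_1\times X_{1,2}\to X_{1,2}$, $X_{1,2}\times G_2\to X_{1,2}$, $G_2\times X_{2,1}\to X_{2,1}$, $X_{2,1}\times G_1\to X_{2,1}$. 3. There is an isomorphism of schemes $\iota:X_{1,2}\to X_{2,1}$ given on points by $f\mapsto f^{-1}$. 4. $X_{1,2}$ and $X_{2,1}$ are torsors, with structure maps given on points by $(f,g,h)=fg^{-1}h$. These maps are compatible with the actions of $G_1$ and $G_2$: the one of $X_{1,2}$ is equal to both composites $X_{1,2}^3\xrightarrow{\mathrm{id}\times\iota\times\mathrm{id}}X_{1,2}\times X_{2,1}\times X_{1,2}\to G_1\times X_{1,2}\to X_{1,2}$ and $X_{1,2}^3\xrightarrow{\mathrm{id}\times\iota\times\mathrm{id}}X_{1,2}\times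 X_{2,1}\times X_{1,2}\to X_{1,2}\times G_2\to X_{1,2}$, and the one of $X_{2,1}$ is equal to the analogous composites, with $\iota^{-1}$ for $\iota$, through $G_2\times X_{2,1}$ and through $X_{2,1}\times G_1$. -/

import Mathlib

open CategoryTheory MonoidalCategory TensorProduct

noncomputable section

namespace NoriDiagram

universe v u w

/-- A graded diagram with a commutative product structure and a unit. The underlying diagram is a
reflexive quiver (a directed graph with a distinguished edge `id : f ⟶ f` at every vertex). The
product is a map of graded diagrams `D × D → D`, where the edges of `D × D` are those of the form
`γ × id` and `id × γ`; `mapLeft γ g` and `mapRight g γ` are the images of these edges. -/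
class ProductDiagram (D : Type) extends ReflQuiver.{v} D where
  deg : D → ZMod 2
  mul : D → D → D
  deg_mul : ∀ f g, deg (mul f g) = deg f + deg g
  mapLeft : ∀ {f f' : D}, (f ⟶ f') → ∀ g, (mul f g ⟶ mul f' g)
  mapRight : ∀ (g : D) {f f' : D}, (f ⟶ f') → (mul g f ⟶ mul g f')
  mapLeft_id : ∀ f g, mapLeft (ReflQuiver.id f) g = ReflQuiver.id (mul f g)
  mapRight_id : ∀ g f, mapRight g (ReflQuiver.id f) = ReflQuiver.id (mul g f)
  /-- the chosen edges `f × g ⟶ g × f` -/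
  comm : ∀ f g, mul f g ⟶ mul g f
  /-- the chosen edges `f × (g × h) ⟶ (f × g) × h` -/
  assoc : ∀ f g h, mul f (mul g h) ⟶ mul (mul f g) h
  unit : D
  deg_unit : deg unit = 0
  /-- the chosen edges `f ⟶ 𝟙 × f` -/
  unitEdge : ∀ f, f ⟶ mul unit f

open ProductDiagram

/-- A representation of a diagram in finite-dimensional rational vector spaces. -/
structure Representation (D : Type) [ReflQuiver.{v} D] where
  obj : D → Type
  [addCommGroup : ∀ p, AddCommGroup (obj p)]
  [module : ∀ p, Module ℚ (obj p)]
  [finite : ∀ p, Module.Finite ℚ (obj p)]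
  map : ∀ {p q : D}, (p ⟶ q) → (obj p →ₗ[ℚ] obj q)
  map_id : ∀ p, map (ReflQuiver.id p) = LinearMap.id

attribute [instance] Representation.addCommGroup Representation.module Representation.finite

/-- The sign `(-1)^{ab}` of two degrees in `ℤ/2`. -/
def koszul (a b : ZMod 2) : ℚ := (-1) ^ (a.val * b.val)

/-- A unital graded representation of a graded diagram with commutative product and unit. -/
structure GradedRep (D : Type) [ProductDiagram.{v} D] extends Representation D where
  τ : ∀ f g, obj (mul f g) ≃ₗ[ℚ] obj f ⊗[ℚ] obj g
  τ_comm : ∀ f g, (τ g f).toLinearMap ∘ₗ map (comm f g) ∘ₗ (τ f g).symm.toLinearMap =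
    koszul (deg f) (deg g) • (TensorProduct.comm ℚ (obj f) (obj g)).toLinearMap
  τ_left : ∀ {f f' : D} (γ : f ⟶ f') (g : D),
    (τ f' g).toLinearMap ∘ₗ map (mapLeft γ g) = (map γ).rTensor (obj g) ∘ₗ (τ f g).toLinearMap
  τ_right : ∀ (g : D) {f f' : D} (γ : f ⟶ f'),
    (τ g f').toLinearMap ∘ₗ map (mapRight g γ) =
      koszul (deg g) (deg f - deg f') • ((map γ).lTensor (obj g) ∘ₗ (τ g f).toLinearMap)
  τ_assoc : ∀ f g h, (τ f g).toLinearMap.rTensor (obj h) ∘ₗ (τ (mul f g) h).toLinearMap ∘ₗ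
      map (assoc f g h) =
    (TensorProduct.assoc ℚ (obj f) (obj g) (obj h)).symm.toLinearMap ∘ₗ
      (τ g h).toLinearMap.lTensor (obj f) ∘ₗ (τ f (mul g h)).toLinearMap
  unit_bijective : ∀ f, Function.Bijective (map (unitEdge f))
  unit_nontrivial : Nontrivial (obj unit)

section Hom

variable {D : Type} [ReflQuiver.{v} D]

/-- `Hom(T|_F, T'|_F)` for the full subdiagram on a finite set `F` of vertices. -/
def HomOn (T T' : Representation D) (F : Finset D) :
    Submodule ℚ (∀ p : F, T.obj p →ₗ[ℚ] T'.obj p) where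
  carrier := {h | ∀ (p q : F) (m : p.1 ⟶ q.1), h q ∘ₗ T.map m = T'.map m ∘ₗ h p}
  add_mem' {a b} ha hb p q m := by
    simp [LinearMap.add_comp, LinearMap.comp_add, ha p q m, hb p q m]
  zero_mem' p q m := by simp
  smul_mem' c a ha p q m := by simp [LinearMap.smul_comp, LinearMap.comp_smul, ha p q m]

namespace HomOn

variable {T T' T'' : Representation D} {F G : Finset D}

/-- The component at a vertex. -/
def ev (p : D) (hp : p ∈ F) : HomOn T T' F →ₗ[ℚ] (T.obj p →ₗ[ℚ] T'.obj p) :=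
  LinearMap.proj (⟨p, hp⟩ : F) ∘ₗ (HomOn T T' F).subtype

lemma ext_ev {a b : HomOn T T' F} (h : ∀ p hp, ev p hp a = ev p hp b) : a = b :=
  Subtype.ext (funext fun p => h p.1 p.2)

lemma ev_naturality (a : HomOn T T' F) {p q : D} (hp : p ∈ F) (hq : q ∈ F) (m : p ⟶ q) :
    ev q hq a ∘ₗ T.map m = T'.map m ∘ₗ ev p hp a := a.2 ⟨p, hp⟩ ⟨q, hq⟩ m

/-- Restriction to a smaller finite subdiagram. -/
def res (h : F ⊆ G) : HomOn T T' G →ₗ[ℚ] HomOn T T' F :=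
  LinearMap.codRestrict _
    (LinearMap.pi fun p : F => ev p.1 (h p.2))
    (fun a p q m => ev_naturality a (h p.2) (h q.2) m)

end HomOn
end Hom

section

section LinearAlgebra

variable {M N P Q : Type} [AddCommGroup M] [Module ℚ M] [AddCommGroup N] [Module ℚ N]
  [AddCommGroup P] [Module ℚ P] [AddCommGroup Q] [Module ℚ Q]

lemma mem_range_rTensor_of_forall {κ : Type*} {R : κ → Type} [∀ i, AddCommGroup (R i)]
    [∀ i, Module ℚ (R i)] (φ : ∀ i, M →ₗ[ℚ] R i) (H : Submodule ℚ M)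
    (hH : ∀ x, (∀ i, φ i x = 0) → x ∈ H) (z : M ⊗[ℚ] N) (hz : ∀ i, (φ i).rTensor N z = 0) :
    ∃ z' : H ⊗[ℚ] N, H.subtype.rTensor N z' = z := by
  classical
  let b := Module.Basis.ofVectorSpace ℚ N
  let e := TensorProduct.equivFinsuppOfBasisRight (M := M) b
  have key : ∀ i (w : M ⊗[ℚ] N) j, TensorProduct.equivFinsuppOfBasisRight (M := R i) b
      ((φ i).rTensor N w) j = φ i (e w j) := by
    intro i w j
    induction w with
    | zero => simp
    | tmul m n => simp [e]
    | add x y hx hy => simp_all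
  have hmem : ∀ j, e z j ∈ H := fun j => hH _ fun i => by rw [← key, hz i]; simp
  refine ⟨(e z).sum fun j m => (⟨e z j, hmem j⟩ : H) ⊗ₜ[ℚ] b j, ?_⟩
  have hz' : z = e.symm (e z) := by simp
  conv_rhs => rw [hz', TensorProduct.equivFinsuppOfBasisRight_symm_apply]
  rw [Finsupp.sum, map_sum, Finsupp.sum]
  simp

lemma mem_range_lTensor_of_forall {κ : Type*} {R : κ → Type} [∀ i, AddCommGroup (R i)]
    [∀ i, Module ℚ (R i)] (φ : ∀ i, M →ₗ[ℚ] R i) (H : Submodule ℚ M)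
    (hH : ∀ x, (∀ i, φ i x = 0) → x ∈ H) (z : N ⊗[ℚ] M) (hz : ∀ i, (φ i).lTensor N z = 0) :
    ∃ z' : N ⊗[ℚ] H, H.subtype.lTensor N z' = z := by
  obtain ⟨w, hw⟩ := mem_range_rTensor_of_forall φ H hH (TensorProduct.comm ℚ N M z)
    (fun i => by rw [LinearMap.rTensor, TensorProduct.map_comm]; exact
      (congrArg _ (hz i)).trans (map_zero _))
  refine ⟨TensorProduct.comm ℚ _ _ w, ?_⟩
  rw [LinearMap.lTensor, TensorProduct.map_comm]
  rw [LinearMap.rTensor] at hw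
  rw [hw]
  simp

/-- Elements of `(∏ M_i) ⊗ N` are determined by their components. -/
lemma pi_rTensor_ext {ι : Type} [Finite ι] {M : ι → Type} [∀ i, AddCommGroup (M i)]
    [∀ i, Module ℚ (M i)] {z w : (∀ i, M i) ⊗[ℚ] N}
    (h : ∀ i, (LinearMap.proj i : (∀ i, M i) →ₗ[ℚ] M i).rTensor N z =
      (LinearMap.proj i : (∀ i, M i) →ₗ[ℚ] M i).rTensor N w) : z = w := by
  classical
  have := Fintype.ofFinite ι
  have hid : ∀ z : (∀ i, M i) ⊗[ℚ] N, z = ∑ i, (LinearMap.single ℚ M i).rTensor N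
      ((LinearMap.proj i : (∀ i, M i) →ₗ[ℚ] M i).rTensor N z) := by
    intro z
    induction z with
    | zero => simp
    | tmul m n =>
      simp only [LinearMap.rTensor_tmul, ← TensorProduct.sum_tmul]
      congr 1
      exact (LinearMap.sum_single_apply M m).symm
    | add x y hx hy => simp only [map_add, Finset.sum_add_distrib, ← hx, ← hy]
  rw [hid z, hid w]
  simp only [h]

lemma pi_lTensor_ext {ι : Type} [Finite ι] {M : ι → Type} [∀ i, AddCommGroup (M i)]
    [∀ i, Module ℚ (M i)] {z w : N ⊗[ℚ] (∀ i, M i)}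
    (h : ∀ i, (LinearMap.proj i : (∀ i, M i) →ₗ[ℚ] M i).lTensor N z =
      (LinearMap.proj i : (∀ i, M i) →ₗ[ℚ] M i).lTensor N w) : z = w := by
  apply (TensorProduct.comm ℚ _ _).injective
  apply pi_rTensor_ext
  intro i
  rw [LinearMap.rTensor, TensorProduct.map_comm, TensorProduct.map_comm]
  exact congrArg _ (h i)

end LinearAlgebra

end

section

section HomTensor

variable {M M' N N' P Q : Type} [AddCommGroup M] [Module ℚ M] [AddCommGroup N] [Module ℚ N]
  [AddCommGroup M'] [Module ℚ M'] [AddCommGroup N'] [Module ℚ N']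
  [AddCommGroup P] [Module ℚ P] [AddCommGroup Q] [Module ℚ Q]

lemma homTensor_rTensor_lcomp (m : P →ₗ[ℚ] M) (w : (M →ₗ[ℚ] M') ⊗[ℚ] (N →ₗ[ℚ] N')) :
    homTensorHomMap (.id ℚ) _ _ _ _ ((LinearMap.lcomp ℚ M' m).rTensor _ w) =
      homTensorHomMap (.id ℚ) _ _ _ _ w ∘ₗ m.rTensor N := by
  induction w with
  | zero => simp
  | tmul a b => ext; simp
  | add x y hx hy => simp only [map_add, hx, hy, LinearMap.add_comp]

lemma homTensor_lTensor_lcomp (m : P →ₗ[ℚ] N) (w : (M →ₗ[ℚ] M') ⊗[ℚ] (N →ₗ[ℚ] N')) :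
    homTensorHomMap (.id ℚ) _ _ _ _ ((LinearMap.lcomp ℚ N' m).lTensor _ w) =
      homTensorHomMap (.id ℚ) _ _ _ _ w ∘ₗ m.lTensor M := by
  induction w with
  | zero => simp
  | tmul a b => ext; simp
  | add x y hx hy => simp only [map_add, hx, hy, LinearMap.add_comp]

lemma homTensor_rTensor_compRight (m : M' →ₗ[ℚ] P) (w : (M →ₗ[ℚ] M') ⊗[ℚ] (N →ₗ[ℚ] N')) :
    homTensorHomMap (.id ℚ) _ _ _ _ ((LinearMap.compRight ℚ m).rTensor _ w) =
      m.rTensor N' ∘ₗ homTensorHomMap (.id ℚ) _ _ _ _ w := by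
  induction w with
  | zero => simp
  | tmul a b => ext; simp
  | add x y hx hy => simp only [map_add, hx, hy, LinearMap.comp_add]

lemma homTensor_lTensor_compRight (m : N' →ₗ[ℚ] P) (w : (M →ₗ[ℚ] M') ⊗[ℚ] (N →ₗ[ℚ] N')) :
    homTensorHomMap (.id ℚ) _ _ _ _ ((LinearMap.compRight ℚ m).lTensor _ w) =
      m.lTensor M' ∘ₗ homTensorHomMap (.id ℚ) _ _ _ _ w := by
  induction w with
  | zero => simp
  | tmul a b => ext; simp
  | add x y hx hy => simp only [map_add, hx, hy, LinearMap.comp_add]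

end HomTensor

section ReflQuiver

variable {D : Type} [ReflQuiver.{v} D] {T T' : Representation D} {F G : Finset D}

lemma homTensor_injective (p q : D) : Function.Injective
    (homTensorHomMap (.id ℚ) (T.obj p) (T.obj q) (T'.obj p) (T'.obj q)) := by
  rw [← homTensorHomEquiv_toLinearMap]
  exact (homTensorHomEquiv ℚ _ _ _ _).injective

namespace HomOn

/-- The relations that cut out `HomOn T T' F`. -/
def rel (T T' : Representation D) (F : Finset D) (i : Σ p q : F, (p.1 ⟶ q.1)) :
    (∀ p : F, T.obj p →ₗ[ℚ] T'.obj p) →ₗ[ℚ] (T.obj i.1 →ₗ[ℚ] T'.obj i.2.1) :=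
  LinearMap.lcomp ℚ _ (T.map i.2.2) ∘ₗ LinearMap.proj i.2.1 -
    LinearMap.compRight ℚ (T'.map i.2.2) ∘ₗ LinearMap.proj i.1

lemma mem_of_rel (x : ∀ p : F, T.obj p →ₗ[ℚ] T'.obj p) (hx : ∀ i, rel T T' F i x = 0) :
    x ∈ HomOn T T' F := fun p q m => sub_eq_zero.mp (hx ⟨p, q, m⟩)

/-- The `(f, g)`-component of an element of `Hom(T|_F, T'|_F) ⊗ Hom(T|_G, T'|_G)`, as a map
`T f ⊗ T g → T' f ⊗ T' g`. -/
def ev₂ (f g : D) (hf : f ∈ F) (hg : g ∈ G) : HomOn T T' F ⊗[ℚ] HomOn T T' G →ₗ[ℚ]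
    (T.obj f ⊗[ℚ] T.obj g →ₗ[ℚ] T'.obj f ⊗[ℚ] T'.obj g) :=
  homTensorHomMap (.id ℚ) _ _ _ _ ∘ₗ TensorProduct.map (ev f hf) (ev g hg)

@[simp] lemma ev₂_tmul (f g : D) (hf : f ∈ F) (hg : g ∈ G) (a : HomOn T T' F)
    (b : HomOn T T' G) : ev₂ f g hf hg (a ⊗ₜ b) = TensorProduct.map (ev f hf a) (ev g hg b) := rfl

lemma ext_ev₂ {z w : HomOn T T' F ⊗[ℚ] HomOn T T' G}
    (h : ∀ f g hf hg, ev₂ f g hf hg z = ev₂ f g hf hg w) : z = w := by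
  have hinj : Function.Injective
      (TensorProduct.map (HomOn T T' F).subtype (HomOn T T' G).subtype) :=
    TensorProduct.map_injective_of_flat_flat _ _
      (HomOn T T' F).subtype_injective (HomOn T T' G).subtype_injective
  apply hinj
  apply pi_rTensor_ext
  intro f
  apply pi_lTensor_ext
  intro g
  apply homTensor_injective
  have key : ∀ z : HomOn T T' F ⊗[ℚ] HomOn T T' G,
      (LinearMap.proj g : (∀ p : G, T.obj p →ₗ[ℚ] T'.obj p) →ₗ[ℚ] _).lTensor _
        ((LinearMap.proj f : (∀ p : F, T.obj p →ₗ[ℚ] T'.obj p) →ₗ[ℚ] _).rTensor _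
          (TensorProduct.map (HomOn T T' F).subtype (HomOn T T' G).subtype z)) =
      TensorProduct.map (ev f.1 f.2) (ev g.1 g.2) z := by
    intro z
    induction z with
    | zero => simp
    | tmul a b => rfl
    | add x y hx hy => simp only [map_add, hx, hy]
  rw [key, key]
  exact h f g f.2 g.2

end HomOn
end ReflQuiver

variable {D : Type} [ProductDiagram.{v} D]

open scoped Classical in
/-- The set of products `f × g` with `f ∈ F`, `g ∈ G`. -/
def mulF (F G : Finset D) : Finset D := Finset.image₂ mul F G

lemma mul_mem_mulF {F G : Finset D} {f g : D} (hf : f ∈ F) (hg : g ∈ G) : mul f g ∈ mulF F G := by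
  classical exact Finset.mem_image₂_of_mem hf hg

lemma mulF_subset {F F' G G' : Finset D} (h : F ⊆ F') (h' : G ⊆ G') : mulF F G ⊆ mulF F' G' := by
  classical exact Finset.image₂_subset h h'

variable (T T' : GradedRep D)

/-- Transport along `τ`: a map `T (f × g) → T' (f × g)` as a map `T f ⊗ T g → T' f ⊗ T' g`. -/
def conjτ (f g : D) : (T.obj (mul f g) →ₗ[ℚ] T'.obj (mul f g)) →ₗ[ℚ]
    (T.obj f ⊗[ℚ] T.obj g →ₗ[ℚ] T'.obj f ⊗[ℚ] T'.obj g) :=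
  (LinearEquiv.arrowCongr (T.τ f g) (T'.τ f g)).toLinearMap

lemma conjτ_apply (f g : D) (a : T.obj (mul f g) →ₗ[ℚ] T'.obj (mul f g)) :
    conjτ T T' f g a = (T'.τ f g).toLinearMap ∘ₗ a ∘ₗ (T.τ f g).symm.toLinearMap := rfl

variable {T T'} {F G : Finset D}

lemma τ_symm_rTensor (T : GradedRep D) {f f' : D} (m : f ⟶ f') (g : D) :
    (T.τ f' g).symm.toLinearMap ∘ₗ (T.map m).rTensor (T.obj g) =
      T.map (mapLeft m g) ∘ₗ (T.τ f g).symm.toLinearMap := by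
  apply LinearMap.ext
  intro x
  apply (T.τ f' g).injective
  have := LinearMap.congr_fun (T.τ_left m g) ((T.τ f g).symm x)
  simpa using this.symm

lemma koszul_ne_zero (a b : ZMod 2) : koszul a b ≠ 0 := by
  unfold koszul; exact pow_ne_zero _ (by norm_num)

lemma koszul_mul_self (a b : ZMod 2) : koszul a b * koszul a b = 1 := by
  unfold koszul; rw [← mul_pow]; norm_num

lemma τ_symm_lTensor (T : GradedRep D) (g : D) {f f' : D} (m : f ⟶ f') :
    (T.τ g f').symm.toLinearMap ∘ₗ (T.map m).lTensor (T.obj g) =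
      koszul (deg g) (deg f - deg f') •
        (T.map (mapRight g m) ∘ₗ (T.τ g f).symm.toLinearMap) := by
  apply LinearMap.ext
  intro x
  apply (T.τ g f').injective
  have := LinearMap.congr_fun (T.τ_right g m) ((T.τ g f).symm x)
  simp only [LinearMap.comp_apply, LinearEquiv.coe_coe, LinearMap.smul_apply,
    LinearEquiv.apply_symm_apply, map_smul] at this ⊢
  rw [this, smul_smul, koszul_mul_self, one_smul]

lemma conjτ_nat_left {f f' g : D} (m : f ⟶ f') (a : T.obj (mul f g) →ₗ[ℚ] T'.obj (mul f g))
    (a' : T.obj (mul f' g) →ₗ[ℚ] T'.obj (mul f' g))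
    (h : a' ∘ₗ T.map (mapLeft m g) = T'.map (mapLeft m g) ∘ₗ a) :
    conjτ T T' f' g a' ∘ₗ (T.map m).rTensor _ = (T'.map m).rTensor _ ∘ₗ conjτ T T' f g a := by
  rw [conjτ_apply, conjτ_apply, LinearMap.comp_assoc, LinearMap.comp_assoc, τ_symm_rTensor,
    ← LinearMap.comp_assoc _ _ a', h, ← LinearMap.comp_assoc, ← LinearMap.comp_assoc,
    ← LinearMap.comp_assoc, T'.τ_left]
  rfl

lemma conjτ_nat_right {f f' g : D} (m : f ⟶ f') (a : T.obj (mul g f) →ₗ[ℚ] T'.obj (mul g f))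
    (a' : T.obj (mul g f') →ₗ[ℚ] T'.obj (mul g f'))
    (h : a' ∘ₗ T.map (mapRight g m) = T'.map (mapRight g m) ∘ₗ a) :
    conjτ T T' g f' a' ∘ₗ (T.map m).lTensor _ = (T'.map m).lTensor _ ∘ₗ conjτ T T' g f a := by
  have h' := T'.τ_right g m
  have hs := τ_symm_lTensor T g m
  apply LinearMap.ext
  intro x
  have h1 := LinearMap.congr_fun hs x
  have h2 := LinearMap.congr_fun h ((T.τ g f).symm x)
  have h3 := LinearMap.congr_fun h' (a ((T.τ g f).symm x))
  simp only [LinearMap.comp_apply, LinearEquiv.coe_coe, LinearMap.smul_apply,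
    conjτ_apply] at h1 h2 h3 ⊢
  rw [h1, map_smul, map_smul, h2, h3, smul_smul, koszul_mul_self, one_smul]

namespace HomOn

lemma exists_comul (a : HomOn T.toRepresentation T'.toRepresentation (mulF F G)) :
    ∃ z : HomOn T.toRepresentation T'.toRepresentation F ⊗[ℚ]
        HomOn T.toRepresentation T'.toRepresentation G,
      ∀ f g hf hg, ev₂ f g hf hg z = conjτ T T' f g (ev (mul f g) (mul_mem_mulF hf hg) a) := by
  classical
  let S := T.toRepresentation
  let S' := T'.toRepresentation
  let t : ∀ (f : F) (g : G), (T.obj f →ₗ[ℚ] T'.obj f) ⊗[ℚ] (T.obj g →ₗ[ℚ] T'.obj g) :=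
    fun f g => (homTensorHomEquiv ℚ _ _ _ _).symm
      (conjτ T T' f g (ev (mul f.1 g.1) (mul_mem_mulF f.2 g.2) a))
  have ht : ∀ f g, homTensorHomMap (.id ℚ) _ _ _ _ (t f g) =
      conjτ T T' f g (ev (mul f.1 g.1) (mul_mem_mulF f.2 g.2) a) := fun f g => by
    rw [← homTensorHomEquiv_apply]; exact LinearEquiv.apply_symm_apply _ _
  let z0 : (∀ p : F, S.obj p →ₗ[ℚ] S'.obj p) ⊗[ℚ] (∀ p : G, S.obj p →ₗ[ℚ] S'.obj p) :=
    ∑ f : F, ∑ g : G, TensorProduct.map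
      (LinearMap.single ℚ (fun p : F => S.obj p →ₗ[ℚ] S'.obj p) f)
      (LinearMap.single ℚ (fun p : G => S.obj p →ₗ[ℚ] S'.obj p) g) (t f g)
  have hz0 : ∀ f g, TensorProduct.map (LinearMap.proj f) (LinearMap.proj g) z0 = t f g := by
    intro f g
    simp only [z0, map_sum]
    rw [Finset.sum_eq_single f, Finset.sum_eq_single g]
    · rw [← LinearMap.comp_apply, ← TensorProduct.map_comp]
      simp [LinearMap.proj_comp_single_same]
    · intro b _ hb
      rw [← LinearMap.comp_apply, ← TensorProduct.map_comp,
        LinearMap.proj_comp_single_ne ℚ _ _ _ hb.symm]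
      simp
    · simp
    · intro b _ hb
      refine Finset.sum_eq_zero fun c _ => ?_
      rw [← LinearMap.comp_apply, ← TensorProduct.map_comp,
        LinearMap.proj_comp_single_ne ℚ _ _ _ hb.symm]
      simp
    · simp
  obtain ⟨z1, hz1⟩ := mem_range_rTensor_of_forall (rel S S' F) (HomOn S S' F) mem_of_rel z0 <| by
    intro i
    apply pi_lTensor_ext
    intro g
    apply (homTensorHomEquiv ℚ _ _ _ _).injective
    rw [map_zero, map_zero, homTensorHomEquiv_apply]
    have e1 : (LinearMap.proj g : (∀ p : G, S.obj p →ₗ[ℚ] S'.obj p) →ₗ[ℚ] _).lTensor _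
        ((rel S S' F i).rTensor _ z0) =
        (LinearMap.lcomp ℚ _ (S.map i.2.2)).rTensor _ (t i.2.1 g) -
        (LinearMap.compRight ℚ (S'.map i.2.2)).rTensor _ (t i.1 g) := by
      rw [← hz0, ← hz0, rel, LinearMap.rTensor_sub, LinearMap.sub_apply, map_sub]
      simp only [LinearMap.rTensor, LinearMap.lTensor, ← LinearMap.comp_apply,
        ← TensorProduct.map_comp]
      rfl
    rw [e1, map_sub, homTensor_rTensor_lcomp, homTensor_rTensor_compRight, ht, ht, sub_eq_zero]
    exact conjτ_nat_left i.2.2 _ _ (ev_naturality a _ _ _)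
  obtain ⟨z2, hz2⟩ := mem_range_lTensor_of_forall (rel S S' G) (HomOn S S' G) mem_of_rel z1 <| by
    intro i
    have hinj : Function.Injective ((HomOn S S' F).subtype.rTensor
        (S.obj i.1 →ₗ[ℚ] S'.obj i.2.1)) :=
      Module.Flat.rTensor_preserves_injective_linearMap _ (HomOn S S' F).subtype_injective
    apply hinj
    apply pi_rTensor_ext
    intro f
    apply (homTensorHomEquiv ℚ _ _ _ _).injective
    rw [map_zero, map_zero, map_zero, homTensorHomEquiv_apply]
    have e1 : (LinearMap.proj f : (∀ p : F, S.obj p →ₗ[ℚ] S'.obj p) →ₗ[ℚ] _).rTensor _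
        ((HomOn S S' F).subtype.rTensor _ ((rel S S' G i).lTensor _ z1)) =
        (LinearMap.lcomp ℚ _ (S.map i.2.2)).lTensor _ (t f i.2.1) -
        (LinearMap.compRight ℚ (S'.map i.2.2)).lTensor _ (t f i.1) := by
      rw [← hz0, ← hz0, ← hz1]
      clear hz1
      induction z1 with
      | zero => simp
      | tmul x y => exact TensorProduct.tmul_sub _ _ _
      | add x y hx hy => simp only [map_add, hx, hy]; abel
    rw [e1, map_sub, homTensor_lTensor_lcomp, homTensor_lTensor_compRight, ht, ht, sub_eq_zero]
    exact conjτ_nat_right i.2.2 _ _ (ev_naturality a _ _ _)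
  refine ⟨z2, fun f g hf hg => ?_⟩
  rw [← ht ⟨f, hf⟩ ⟨g, hg⟩, ← hz0, ← hz1, ← hz2]
  simp only [LinearMap.rTensor, LinearMap.lTensor, ← LinearMap.comp_apply,
        ← TensorProduct.map_comp, ev₂]
  rfl

/-- The map `μ* : Hom(T|_{F'}, T'|_{F'}) → Hom(T|_F, T'|_F) ⊗ Hom(T|_G, T'|_G)`, for `F'` the set
of products `f × g`: the `(f, g)`-component of `μ* a` is `τ' ∘ a_{f × g} ∘ τ⁻¹`. -/
def comul (T T' : GradedRep D) (F G : Finset D) :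
    HomOn T.toRepresentation T'.toRepresentation (mulF F G) →ₗ[ℚ]
      HomOn T.toRepresentation T'.toRepresentation F ⊗[ℚ]
        HomOn T.toRepresentation T'.toRepresentation G where
  toFun a := (exists_comul a).choose
  map_add' a b := ext_ev₂ fun f g hf hg => by
    rw [(exists_comul (a + b)).choose_spec, map_add, map_add, map_add,
      (exists_comul a).choose_spec, (exists_comul b).choose_spec]
  map_smul' c a := ext_ev₂ fun f g hf hg => by
    rw [(exists_comul (c • a)).choose_spec, map_smul, map_smul, RingHom.id_apply, map_smul,
      (exists_comul a).choose_spec]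

lemma ev₂_comul (a : HomOn T.toRepresentation T'.toRepresentation (mulF F G)) (f g : D)
    (hf : f ∈ F) (hg : g ∈ G) : ev₂ f g hf hg (comul T T' F G a) =
      conjτ T T' f g (ev (mul f g) (mul_mem_mulF hf hg) a) :=
  (exists_comul a).choose_spec f g hf hg

end HomOn

end

section

section LinearAlgebra

variable {M N : Type} [AddCommGroup M] [Module ℚ M] [AddCommGroup N] [Module ℚ N]

lemma rTensor_joint_ext {κ : Type*} {R : κ → Type} [∀ i, AddCommGroup (R i)]
    [∀ i, Module ℚ (R i)] (φ : ∀ i, M →ₗ[ℚ] R i) (hφ : ∀ x, (∀ i, φ i x = 0) → x = 0)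
    {z w : M ⊗[ℚ] N} (h : ∀ i, (φ i).rTensor N z = (φ i).rTensor N w) : z = w := by
  obtain ⟨y, hy⟩ := mem_range_rTensor_of_forall φ ⊥ (fun x hx => by simpa using hφ x hx) (z - w)
    (fun i => by rw [map_sub, h i, sub_self])
  have h0 : (⊥ : Submodule ℚ M).subtype = 0 := by
    ext x; exact (Submodule.mem_bot ℚ).mp x.2
  rw [h0] at hy
  exact sub_eq_zero.mp (by simpa using hy.symm)

lemma lTensor_joint_ext {κ : Type*} {R : κ → Type} [∀ i, AddCommGroup (R i)]
    [∀ i, Module ℚ (R i)] (φ : ∀ i, M →ₗ[ℚ] R i) (hφ : ∀ x, (∀ i, φ i x = 0) → x = 0)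
    {z w : N ⊗[ℚ] M} (h : ∀ i, (φ i).lTensor N z = (φ i).lTensor N w) : z = w := by
  apply (TensorProduct.comm ℚ _ _).injective
  apply rTensor_joint_ext φ hφ
  intro i
  rw [LinearMap.rTensor, TensorProduct.map_comm, TensorProduct.map_comm]
  exact congrArg _ (h i)

end LinearAlgebra

namespace HomOn

section ReflQuiver

variable {D : Type} [ReflQuiver.{v} D] {T T' : Representation D} {F F' G G' H : Finset D}

@[simp] lemma ev_res (h : F ⊆ G) (a : HomOn T T' G) (p : D) (hp : p ∈ F) :
    ev p hp (res h a) = ev p (h hp) a := rfl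

lemma res_res (h : F ⊆ G) (h' : G ⊆ H) (a : HomOn T T' H) :
    res h (res h' a) = res (h.trans h') a := rfl

@[simp] lemma res_self (a : HomOn T T' F) : res (Finset.Subset.refl F) a = a := rfl

lemma ev₂_map_res (h : F ⊆ F') (h' : G ⊆ G') (f g : D) (hf : f ∈ F) (hg : g ∈ G)
    (z : HomOn T T' F' ⊗[ℚ] HomOn T T' G') :
    ev₂ f g hf hg (TensorProduct.map (res h) (res h') z) = ev₂ f g (h hf) (h' hg) z := by
  induction z with
  | zero => simp
  | tmul a b => rfl
  | add x y hx hy => simp only [map_add, hx, hy]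

lemma ev₂_comm (f g : D) (hf : f ∈ F) (hg : g ∈ G) (z : HomOn T T' F ⊗[ℚ] HomOn T T' G) :
    ev₂ g f hg hf (TensorProduct.comm ℚ _ _ z) ∘ₗ (TensorProduct.comm ℚ _ _).toLinearMap =
      (TensorProduct.comm ℚ _ _).toLinearMap ∘ₗ ev₂ f g hf hg z := by
  induction z with
  | zero => simp
  | tmul a b => ext; simp
  | add x y hx hy => simp only [map_add, LinearMap.add_comp, LinearMap.comp_add, hx, hy]

/-- The `(f, g, h)`-component of an element of a triple tensor product. -/
def ev₃ (f g h : D) (hf : f ∈ F) (hg : g ∈ G) (hh : h ∈ H) :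
    HomOn T T' F ⊗[ℚ] (HomOn T T' G ⊗[ℚ] HomOn T T' H) →ₗ[ℚ]
    (T.obj f ⊗[ℚ] (T.obj g ⊗[ℚ] T.obj h) →ₗ[ℚ] T'.obj f ⊗[ℚ] (T'.obj g ⊗[ℚ] T'.obj h)) :=
  homTensorHomMap (.id ℚ) _ _ _ _ ∘ₗ TensorProduct.map (ev f hf) (ev₂ g h hg hh)

lemma ext_ev₃ {z w : HomOn T T' F ⊗[ℚ] (HomOn T T' G ⊗[ℚ] HomOn T T' H)}
    (hzw : ∀ f g h hf hg hh, ev₃ f g h hf hg hh z = ev₃ f g h hf hg hh w) : z = w := by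
  refine rTensor_joint_ext (M := HomOn T T' F) (N := HomOn T T' G ⊗[ℚ] HomOn T T' H)
    (fun f : F => ev (T := T) (T' := T') f.1 f.2)
    (fun x hx => ext_ev fun p hp => by simpa using hx ⟨p, hp⟩) ?_
  intro f
  refine lTensor_joint_ext (M := HomOn T T' G ⊗[ℚ] HomOn T T' H)
    (fun i : G × H => ev₂ (T := T) (T' := T') i.1.1 i.2.1 i.1.2 i.2.2)
    (fun x hx => ext_ev₂ fun g h hg hh => by simpa using hx ⟨⟨g, hg⟩, ⟨h, hh⟩⟩) ?_
  rintro ⟨g, h⟩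
  apply (homTensorHomEquiv ℚ _ _ _ _).injective
  rw [homTensorHomEquiv_apply, homTensorHomEquiv_apply]
  have := hzw f g h f.2 g.2 h.2
  rw [ev₃, LinearMap.comp_apply, LinearMap.comp_apply] at this
  rwa [← LinearMap.lTensor_comp_rTensor] at this

lemma ev₃_assoc (f g h : D) (hf : f ∈ F) (hg : g ∈ G) (hh : h ∈ H)
    (z : HomOn T T' F ⊗[ℚ] HomOn T T' G) (y : HomOn T T' H) :
    ev₃ f g h hf hg hh (TensorProduct.assoc ℚ _ _ _ (z ⊗ₜ y)) ∘ₗ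
      (TensorProduct.assoc ℚ _ _ _).toLinearMap =
    (TensorProduct.assoc ℚ _ _ _).toLinearMap ∘ₗ
      TensorProduct.map (ev₂ f g hf hg z) (ev h hh y) := by
  induction z with
  | zero => simp
  | tmul a b => ext; simp [ev₃]
  | add x y hx hy =>
    simp only [map_add, LinearMap.add_comp, LinearMap.comp_add, hx, hy, TensorProduct.add_tmul,
      TensorProduct.map_add_left]

end ReflQuiver

variable {D : Type} [ProductDiagram.{v} D] {T T' : GradedRep D} {F F' G G' H K : Finset D}

lemma comul_res (h : F ⊆ F') (h' : G ⊆ G')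
    (a : HomOn T.toRepresentation T'.toRepresentation (mulF F' G')) :
    comul T T' F G (res (mulF_subset h h') a) =
      TensorProduct.map (res h) (res h') (comul T T' F' G' a) :=
  ext_ev₂ fun f g hf hg => by rw [ev₂_comul, ev₂_map_res, ev₂_comul, ev_res]

lemma comul_comm (h : mulF F G ⊆ K) (h' : mulF G F ⊆ K)
    (a : HomOn T.toRepresentation T'.toRepresentation K) :
    TensorProduct.comm ℚ _ _ (comul T T' F G (res h a)) = comul T T' G F (res h' a) := by
  refine ext_ev₂ fun g f hg hf => ?_
  have e1 := ev₂_comm f g hf hg (comul T T' F G (res h a))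
  rw [ev₂_comul] at e1
  rw [ev₂_comul, ev_res, conjτ_apply]
  rw [ev_res, conjτ_apply] at e1
  have nat := ev_naturality a (h (mul_mem_mulF hf hg)) (h' (mul_mem_mulF hg hf)) (comm f g)
  have c := T.τ_comm f g
  have c' := T'.τ_comm f g
  apply LinearMap.ext
  intro y
  obtain ⟨x, rfl⟩ := (TensorProduct.comm ℚ (T.obj f) (T.obj g)).surjective y
  have e1x := LinearMap.congr_fun e1 x
  simp only [LinearMap.comp_apply, LinearEquiv.coe_coe] at e1x ⊢
  rw [e1x]
  have cx := LinearMap.congr_fun c x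
  have c'x := LinearMap.congr_fun c' ((T'.τ f g)
    (ev (mul f g) (h (mul_mem_mulF hf hg)) a ((T.τ f g).symm x)))
  have nx := LinearMap.congr_fun nat ((T.τ f g).symm x)
  simp only [LinearMap.comp_apply, LinearEquiv.coe_coe, LinearMap.smul_apply,
    LinearEquiv.symm_apply_apply] at cx c'x nx
  apply smul_right_injective _ (koszul_ne_zero (deg f) (deg g))
  simp only
  rw [← c'x, ← map_smul, ← map_smul, ← map_smul, ← cx, LinearEquiv.symm_apply_apply, nx]

lemma ev₃_comul_right (f g h : D) (hf : f ∈ F) (hg : g ∈ G) (hh : h ∈ H)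
    (z : HomOn T.toRepresentation T'.toRepresentation F ⊗[ℚ]
      HomOn T.toRepresentation T'.toRepresentation (mulF G H)) :
    ev₃ f g h hf hg hh ((comul T T' G H).lTensor _ z) ∘ₗ (T.τ g h).toLinearMap.lTensor _ =
      (T'.τ g h).toLinearMap.lTensor _ ∘ₗ ev₂ f (mul g h) hf (mul_mem_mulF hg hh) z := by
  induction z with
  | zero => simp
  | tmul a b => ext; simp [ev₃, ev₂_comul, conjτ_apply]
  | add x y hx hy => simp only [map_add, LinearMap.add_comp, LinearMap.comp_add, hx, hy]

lemma ev₃_comul_left (f g h : D) (hf : f ∈ F) (hg : g ∈ G) (hh : h ∈ H)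
    (z : HomOn T.toRepresentation T'.toRepresentation (mulF F G) ⊗[ℚ]
      HomOn T.toRepresentation T'.toRepresentation H) :
    ev₃ f g h hf hg hh (TensorProduct.assoc ℚ _ _ _ ((comul T T' F G).rTensor _ z)) ∘ₗ
        (TensorProduct.assoc ℚ _ _ _).toLinearMap ∘ₗ (T.τ f g).toLinearMap.rTensor _ =
      (TensorProduct.assoc ℚ _ _ _).toLinearMap ∘ₗ (T'.τ f g).toLinearMap.rTensor _ ∘ₗ
        ev₂ (mul f g) h (mul_mem_mulF hf hg) hh z := by
  induction z with
  | zero => simp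
  | tmul a b =>
    rw [LinearMap.rTensor_tmul, ← LinearMap.comp_assoc, ev₃_assoc, ev₂_comul]
    ext; simp [conjτ_apply]
  | add x y hx hy => simp only [map_add, LinearMap.add_comp, LinearMap.comp_add, hx, hy]

set_option maxHeartbeats 1600000 in
lemma comul_assoc (h₁ : mulF (mulF F G) H ⊆ K) (h₂ : mulF F (mulF G H) ⊆ K)
    (a : HomOn T.toRepresentation T'.toRepresentation K) :
    TensorProduct.assoc ℚ _ _ _
        ((comul T T' F G).rTensor _ (comul T T' (mulF F G) H (res h₁ a))) =
      (comul T T' G H).lTensor _ (comul T T' F (mulF G H) (res h₂ a)) := by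
  refine ext_ev₃ fun f g h hf hg hh => ?_
  have hL := mul_mem_mulF (mul_mem_mulF hf hg) hh
  have hR := mul_mem_mulF hf (mul_mem_mulF hg hh)
  have e1 := ev₃_comul_left f g h hf hg hh (comul T T' (mulF F G) H (res h₁ a))
  have e2 := ev₃_comul_right f g h hf hg hh (comul T T' F (mulF G H) (res h₂ a))
  rw [ev₂_comul, ev_res, conjτ_apply] at e1 e2
  have nat := ev_naturality a (h₂ hR) (h₁ hL) (assoc f g h)
  have c := T.τ_assoc f g h
  have c' := T'.τ_assoc f g h
  apply LinearMap.ext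
  intro y
  obtain ⟨y, rfl⟩ := ((T.τ g h).lTensor (T.obj f)).surjective y
  obtain ⟨x, rfl⟩ := (T.τ f (mul g h)).surjective y
  have cx := LinearMap.congr_fun c x
  have e2x := LinearMap.congr_fun e2 (T.τ f (mul g h) x)
  have e1x := LinearMap.congr_fun e1 (T.τ (mul f g) h (T.map (assoc f g h) x))
  have nx := LinearMap.congr_fun nat x
  have c'x := LinearMap.congr_fun c' (ev _ (h₂ hR) a x)
  simp only [LinearMap.comp_apply, LinearEquiv.coe_coe, LinearEquiv.symm_apply_apply] at cx e2x e1x nx c'x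
  rw [cx, LinearEquiv.apply_symm_apply, nx, c'x, LinearEquiv.apply_symm_apply] at e1x
  exact e1x.trans e2x.symm

end HomOn

section Unit

variable {D : Type} [ProductDiagram.{v} D] (T : GradedRep D)

lemma finrank_unit : Module.finrank ℚ (T.obj unit) = 1 := by
  have := T.unit_nontrivial
  have e := LinearEquiv.finrank_eq
    ((LinearEquiv.ofBijective _ (T.unit_bijective unit)).trans (T.τ unit unit))
  rw [Module.finrank_tensorProduct] at e
  have hpos : 0 < Module.finrank ℚ (T.obj unit) := Module.finrank_pos
  nlinarith

lemma exists_unitVec : ∃ e : T.obj unit, e ≠ 0 ∧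
    T.τ unit unit (T.map (unitEdge unit) e) = e ⊗ₜ e := by
  obtain ⟨g, hg, hg'⟩ := finrank_eq_one_iff'.mp (finrank_unit T)
  have hfr : ∀ x : T.obj unit ⊗[ℚ] T.obj unit, ∃ c : ℚ, x = c • (g ⊗ₜ[ℚ] g) := by
    intro x
    induction x with
    | zero => exact ⟨0, by simp⟩
    | tmul a b =>
      obtain ⟨c, rfl⟩ := hg' a
      obtain ⟨d, rfl⟩ := hg' b
      exact ⟨c * d, by rw [TensorProduct.smul_tmul_smul]⟩
    | add x y hx hy =>
      obtain ⟨c, rfl⟩ := hx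
      obtain ⟨d, rfl⟩ := hy
      exact ⟨c + d, by rw [add_smul]⟩
  obtain ⟨c, hc⟩ := hfr (T.τ unit unit (T.map (unitEdge unit) g))
  have hc0 : c ≠ 0 := by
    rintro rfl
    rw [zero_smul] at hc
    exact hg ((T.unit_bijective unit).1 ((T.τ unit unit).injective (by rw [hc]; simp)))
  refine ⟨c • g, smul_ne_zero hc0 hg, ?_⟩
  rw [map_smul, map_smul, hc, TensorProduct.smul_tmul_smul, smul_smul]

/-- The generator `e` of the line `T(𝟙)` that corresponds to `e ⊗ e` under
`T(𝟙) ≅ T(𝟙 × 𝟙) ≅ T(𝟙) ⊗ T(𝟙)`. -/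
def unitVec : T.obj unit := (exists_unitVec T).choose

lemma unitVec_ne_zero : unitVec T ≠ 0 := (exists_unitVec T).choose_spec.1

lemma τ_unitVec : T.τ unit unit (T.map (unitEdge unit) (unitVec T)) = unitVec T ⊗ₜ unitVec T :=
  (exists_unitVec T).choose_spec.2

lemma exists_unitCo : ∃ c : Module.Dual ℚ (T.obj unit), c (unitVec T) = 1 :=
  Module.Projective.exists_dual_eq_one ℚ (unitVec_ne_zero T)
end Unit

end

section

section Unit

variable {D : Type} [ProductDiagram.{v} D] (T T' : GradedRep D)

/-- The linear form on the line `T(𝟙)` with value `1` at `unitVec T`. -/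
def unitCo : Module.Dual ℚ (T.obj unit) := (exists_unitCo T).choose

@[simp] lemma unitCo_unitVec : unitCo T (unitVec T) = 1 := (exists_unitCo T).choose_spec

lemma unitCo_smul (x : T.obj unit) : unitCo T x • unitVec T = x := by
  obtain ⟨c, rfl⟩ := (finrank_eq_one_iff_of_nonzero' _ (unitVec_ne_zero T)).mp (finrank_unit T) x
  simp

/-- `T(𝟙) ⊗ V ≅ V`, sending `unitVec T ⊗ v` to `v`. -/
def unitContr (V : Type) [AddCommGroup V] [Module ℚ V] : T.obj unit ⊗[ℚ] V →ₗ[ℚ] V :=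
  (TensorProduct.lid ℚ V).toLinearMap ∘ₗ (unitCo T).rTensor V

lemma unitVec_tmul_unitContr {V : Type} [AddCommGroup V] [Module ℚ V] (z : T.obj unit ⊗[ℚ] V) :
    unitVec T ⊗ₜ unitContr T V z = z := by
  induction z with
  | zero => simp
  | tmul x y =>
    simp only [unitContr, LinearMap.comp_apply, LinearMap.rTensor_tmul, LinearEquiv.coe_coe,
      TensorProduct.lid_tmul]
    rw [← TensorProduct.smul_tmul, unitCo_smul]
  | add x y hx hy => rw [map_add, TensorProduct.tmul_add, hx, hy]

@[simp] lemma unitContr_tmul {V : Type} [AddCommGroup V] [Module ℚ V] (v : V) :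
    unitContr T V (unitVec T ⊗ₜ v) = v := by
  simp [unitContr]

/-- The automorphism of `T f` induced by the chosen edge `f ⟶ 𝟙 × f`. -/
def unitTwist (f : D) : T.obj f →ₗ[ℚ] T.obj f :=
  unitContr T _ ∘ₗ (T.τ unit f).toLinearMap ∘ₗ T.map (unitEdge f)

lemma unitTwist_injective (f : D) : Function.Injective (unitTwist T f) := by
  intro x y h
  have h2 := congrArg (fun z => unitVec T ⊗ₜ[ℚ] z) h
  simp only [unitTwist, LinearMap.comp_apply, unitVec_tmul_unitContr] at h2
  exact (T.unit_bijective f).1 ((T.τ unit f).injective h2)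

lemma τ_unitEdge (f : D) (x : T.obj f) :
    T.τ unit f (T.map (unitEdge f) x) = unitVec T ⊗ₜ unitTwist T f x := by
  simp [unitTwist, unitVec_tmul_unitContr]

/-- `T f → T (𝟙 × f)`, `v ↦ τ⁻¹ (e ⊗ v)`. -/
def unitIn (f : D) : T.obj f →ₗ[ℚ] T.obj (mul unit f) :=
  (T.τ unit f).symm.toLinearMap ∘ₗ TensorProduct.mk ℚ _ _ (unitVec T)

lemma unitIn_assoc (f : D) (x : T.obj f) :
    T.map (assoc unit unit f) (T.map (mapRight unit (unitEdge f)) (unitIn T f x)) =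
      T.map (mapLeft (unitEdge unit) f) (unitIn T f (unitTwist T f x)) := by
  apply (T.τ (mul unit unit) f).injective
  apply ((T.τ unit unit).rTensor (T.obj f)).injective
  have h1 := LinearMap.congr_fun (T.τ_assoc unit unit f)
    (T.map (mapRight unit (unitEdge f)) (unitIn T f x))
  have h2 := LinearMap.congr_fun (T.τ_right unit (unitEdge f)) (unitIn T f x)
  have h3 := LinearMap.congr_fun (T.τ_left (unitEdge unit) f) (unitIn T f (unitTwist T f x))
  have hk : ∀ c, koszul (deg (unit : D)) c = 1 := fun c => by simp [koszul, deg_unit]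
  simp only [LinearMap.comp_apply, LinearEquiv.coe_coe, hk, one_smul]
    at h1 h2 h3
  have e1 : ∀ y, ((T.τ unit unit).rTensor (T.obj f)) y =
    (T.τ unit unit).toLinearMap.rTensor (T.obj f) y := fun _ => rfl
  rw [e1, e1, h1, h2, h3]
  have e2 : unitTwist T unit (unitVec T) = unitVec T := by simp [unitTwist, τ_unitVec]
  simp [unitIn, τ_unitEdge, e2]

lemma unitIn_left_injective (f : D) :
    Function.Injective (T.map (mapLeft (unitEdge unit) f) ∘ₗ unitIn T f) := by
  intro x y hxy
  have h3 : ∀ x, _ := fun x => LinearMap.congr_fun (T.τ_left (unitEdge unit) f) (unitIn T f x)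
  have h4 := congrArg (fun z => (T.τ unit unit).toLinearMap.rTensor _ (T.τ _ f z)) hxy
  simp only [LinearMap.comp_apply, LinearEquiv.coe_coe] at h3 h4
  rw [h3, h3] at h4
  simp only [unitIn, LinearMap.comp_apply, LinearEquiv.coe_coe, TensorProduct.mk_apply,
    LinearEquiv.apply_symm_apply, LinearMap.rTensor_tmul, τ_unitVec] at h4
  have h5 := congrArg (fun z => unitContr T _ (unitContr T _ (TensorProduct.assoc ℚ _ _ _ z))) h4
  simpa using h5

variable {T T'} {F K : Finset D}

namespace HomOn

/-- The scalar by which an element of `Hom(T|_{𝟙}, T'|_{𝟙})` maps `unitVec T` to a multiple of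
`unitVec T'`. -/
def scal (T T' : GradedRep D) :
    HomOn T.toRepresentation T'.toRepresentation {unit} →ₗ[ℚ] ℚ :=
  unitCo T' ∘ₗ LinearMap.applyₗ (unitVec T) ∘ₗ ev unit (Finset.mem_singleton_self _)

lemma scal_apply (a : HomOn T.toRepresentation T'.toRepresentation {unit}) :
    scal T T' a = unitCo T' (ev unit (Finset.mem_singleton_self _) a (unitVec T)) := rfl

lemma ev_scal (f : D) (hf : f ∈ F)
    (z : HomOn T.toRepresentation T'.toRepresentation {unit} ⊗[ℚ]
      HomOn T.toRepresentation T'.toRepresentation F) (x : T.obj f) :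
    ev f hf (TensorProduct.lid ℚ _ ((scal T T').rTensor _ z)) x =
      unitContr T' _ (ev₂ unit f (Finset.mem_singleton_self _) hf z (unitVec T ⊗ₜ x)) := by
  induction z with
  | zero => simp
  | tmul a b => simp [scal_apply, unitContr]
  | add y z hy hz => simp only [map_add, LinearMap.add_apply, hy, hz]

lemma comul_unit (h₀ : F ⊆ K) (h₁ : mulF {unit} F ⊆ K)
    (h₂ : mulF (mulF {unit} {unit}) F ⊆ K) (h₃ : mulF {unit} (mulF {unit} F) ⊆ K)
    (a : HomOn T.toRepresentation T'.toRepresentation K) :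
    TensorProduct.lid ℚ _ ((scal T T').rTensor _ (comul T T' {unit} F (res h₁ a))) =
      res h₀ a := by
  refine ext_ev fun f hf => LinearMap.ext fun x => ?_
  have hu : (unit : D) ∈ ({unit} : Finset D) := Finset.mem_singleton_self _
  have m1 := h₁ (mul_mem_mulF hu hf)
  have m2 := h₂ (mul_mem_mulF (mul_mem_mulF hu hu) hf)
  have m3 := h₃ (mul_mem_mulF hu (mul_mem_mulF hu hf))
  let b : T.obj f →ₗ[ℚ] T'.obj f := unitContr T' _ ∘ₗ
    conjτ T T' unit f (ev (mul unit f) m1 a) ∘ₗ TensorProduct.mk ℚ _ _ (unitVec T)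
  have hb : ∀ x, ev (mul unit f) m1 a (unitIn T f x) = unitIn T' f (b x) := by
    intro x
    apply (T'.τ unit f).injective
    simp [unitIn, b, unitVec_tmul_unitContr, conjτ_apply]
  have hb1 : ∀ x, b (unitTwist T f x) = unitTwist T' f (ev f (h₀ hf) a x) := by
    intro x
    have n := LinearMap.congr_fun (ev_naturality a (h₀ hf) m1 (unitEdge f)) x
    simp only [LinearMap.comp_apply] at n
    simp only [b, LinearMap.comp_apply, TensorProduct.mk_apply, conjτ_apply, LinearEquiv.coe_coe]
    rw [← τ_unitEdge, LinearEquiv.symm_apply_apply, n]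
    rfl
  have hb2 : ∀ x, b (unitTwist T f x) = unitTwist T' f (b x) := by
    intro x
    apply unitIn_left_injective T' f
    have n1 := LinearMap.congr_fun (ev_naturality a m3 m2 (assoc unit unit f))
      (T.map (mapRight unit (unitEdge f)) (unitIn T f x))
    have n2 := LinearMap.congr_fun (ev_naturality a m1 m3 (mapRight unit (unitEdge f)))
      (unitIn T f x)
    have n3 := LinearMap.congr_fun (ev_naturality a m1 m2 (mapLeft (unitEdge unit) f))
      (unitIn T f (unitTwist T f x))
    simp only [LinearMap.comp_apply] at n1 n2 n3 ⊢
    rw [← hb, ← n3, ← unitIn_assoc, ← unitIn_assoc, n1, n2, hb]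
  rw [ev_scal, ev₂_comul]
  exact unitTwist_injective T' f ((hb2 x).symm.trans (hb1 x))

/-- The identity of `T|_F`. -/
def one (T : Representation D) (F : Finset D) : HomOn T T F :=
  ⟨fun _ => LinearMap.id, fun _ _ _ => rfl⟩

/-- The composition in `End(T|_F)`. -/
def comp {T : Representation D} {F : Finset D} :
    HomOn T T F →ₗ[ℚ] HomOn T T F →ₗ[ℚ] HomOn T T F :=
  LinearMap.mk₂ ℚ (fun a b => ⟨fun p => a.1 p ∘ₗ b.1 p, fun p q m => by
      rw [LinearMap.comp_assoc, b.2 p q m, ← LinearMap.comp_assoc, a.2 p q m,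
        LinearMap.comp_assoc]⟩)
    (fun _ _ _ => rfl) (fun _ _ _ => rfl)
    (fun a b c => Subtype.ext <| funext fun p => LinearMap.comp_add _ _ _)
    (fun r a b => Subtype.ext <| funext fun p => LinearMap.comp_smul _ _ _)

lemma ev_comp {T : Representation D} (a b : HomOn T T F) (p : D) (hp : p ∈ F) :
    ev p hp (comp a b) = ev p hp a ∘ₗ ev p hp b := rfl

lemma ev_one {T : Representation D} (p : D) (hp : p ∈ F) :
    ev p hp (one T F) = LinearMap.id := rfl

lemma res_one {T : Representation D} {G : Finset D} (h : F ⊆ G) :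
    res h (one T G) = one T F := rfl

lemma res_comp {T : Representation D} {G : Finset D} (h : F ⊆ G) (a b : HomOn T T G) :
    res h (comp a b) = comp (res h a) (res h b) := rfl

variable {G : Finset D}

lemma comul_one : comul T T F G (one T.toRepresentation _) =
    one T.toRepresentation F ⊗ₜ one T.toRepresentation G :=
  ext_ev₂ fun f g hf hg => by
    rw [ev₂_comul, ev₂_tmul, ev_one, ev_one, ev_one, conjτ_apply]
    ext; simp

lemma ev₂_comp {T : Representation D} (f g : D) (hf : f ∈ F) (hg : g ∈ G)
    (z w : HomOn T T F ⊗[ℚ] HomOn T T G) :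
    ev₂ f g hf hg (TensorProduct.map₂ comp comp z w) = ev₂ f g hf hg z ∘ₗ ev₂ f g hf hg w := by
  induction z with
  | zero => simp
  | add x y hx hy => simp only [map_add, LinearMap.add_apply, hx, hy, LinearMap.add_comp]
  | tmul a b =>
    induction w with
    | zero => simp
    | add x y hx hy => simp only [map_add, hx, hy, LinearMap.comp_add]
    | tmul c d =>
      rw [TensorProduct.map₂_apply_tmul]
      ext; simp [ev_comp]

lemma comul_comp (a b : HomOn T.toRepresentation T.toRepresentation (mulF F G)) :
    comul T T F G (comp a b) =
      TensorProduct.map₂ comp comp (comul T T F G a) (comul T T F G b) :=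
  ext_ev₂ fun f g hf hg => by
    rw [ev₂_comp, ev₂_comul, ev₂_comul, ev₂_comul, ev_comp, conjτ_apply, conjτ_apply, conjτ_apply]
    ext; simp

end HomOn
end Unit

end

section

section LinearAlgebra

variable {A B C M : Type} [AddCommGroup A] [Module ℚ A] [AddCommGroup B] [Module ℚ B]
  [AddCommGroup C] [Module ℚ C] [AddCommGroup M] [Module ℚ M]

lemma dualDistrib_assoc_left (ξ : Module.Dual ℚ A) (η : Module.Dual ℚ B) (ζ : Module.Dual ℚ C)
    (m : M →ₗ[ℚ] A ⊗[ℚ] B) (z : M ⊗[ℚ] C) :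
    TensorProduct.dualDistrib ℚ _ _ ((TensorProduct.dualDistrib ℚ _ _ (ξ ⊗ₜ η) ∘ₗ m) ⊗ₜ ζ) z =
      TensorProduct.dualDistrib ℚ _ _ (ξ ⊗ₜ TensorProduct.dualDistrib ℚ _ _ (η ⊗ₜ ζ))
        (TensorProduct.assoc ℚ _ _ _ (m.rTensor _ z)) := by
  induction z with
  | zero => simp
  | add x y hx hy => simp only [map_add, hx, hy]
  | tmul x y =>
    rw [TensorProduct.dualDistrib_apply, LinearMap.rTensor_tmul, LinearMap.comp_apply]
    generalize m x = w
    induction w with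
    | zero => simp
    | add x y hx hy => simp only [map_add, add_mul, TensorProduct.add_tmul, hx, hy]
    | tmul x y => simp [mul_assoc]

lemma dualDistrib_assoc_right (ξ : Module.Dual ℚ A) (η : Module.Dual ℚ B) (ζ : Module.Dual ℚ C)
    (m : M →ₗ[ℚ] B ⊗[ℚ] C) (z : A ⊗[ℚ] M) :
    TensorProduct.dualDistrib ℚ _ _ (ξ ⊗ₜ (TensorProduct.dualDistrib ℚ _ _ (η ⊗ₜ ζ) ∘ₗ m)) z =
      TensorProduct.dualDistrib ℚ _ _ (ξ ⊗ₜ TensorProduct.dualDistrib ℚ _ _ (η ⊗ₜ ζ))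
        (m.lTensor _ z) := by
  induction z with
  | zero => simp
  | add x y hx hy => simp only [map_add, hx, hy]
  | tmul x y => simp

end LinearAlgebra

section Colimit

variable {D : Type} [ReflQuiver.{v} D]

open scoped Classical in
/-- `A_{1,2} = colim_F Hom(T₁|_F, T₂|_F)^∨`, the colimit over all finite full subdiagrams of the
dual spaces, along the transposes of the restriction maps. -/
def CompAlg (T T' : Representation D) : Type :=
  Module.DirectLimit (fun F : Finset D => Module.Dual ℚ (HomOn T T' F))
    (fun _ _ h => (HomOn.res h).dualMap)

namespace CompAlg

variable (T T' : Representation D)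

open scoped Classical in
instance : AddCommGroup (CompAlg T T') := inferInstanceAs (AddCommGroup (Module.DirectLimit _ _))

open scoped Classical in
instance : Module ℚ (CompAlg T T') := inferInstanceAs (Module ℚ (Module.DirectLimit _ _))

variable {T T'} {F G : Finset D}

open scoped Classical in
/-- The structure maps of the colimit. -/
def of (T T' : Representation D) (F : Finset D) :
    Module.Dual ℚ (HomOn T T' F) →ₗ[ℚ] CompAlg T T' :=
  Module.DirectLimit.of ℚ (Finset D) (fun F : Finset D => Module.Dual ℚ (HomOn T T' F))
    (fun _ _ h => (HomOn.res h).dualMap) F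

lemma of_res (h : F ⊆ G) (ξ : Module.Dual ℚ (HomOn T T' F)) :
    of T T' G (ξ ∘ₗ HomOn.res h) = of T T' F ξ := by
  classical
  exact Module.DirectLimit.of_f (R := ℚ) (G := fun F : Finset D => Module.Dual ℚ (HomOn T T' F))
    (f := fun _ _ h => (HomOn.res h).dualMap) (hij := h)

lemma exists_of (x : CompAlg T T') : ∃ F ξ, of T T' F ξ = x := by
  classical
  exact Module.DirectLimit.exists_of x

lemma of_eq_of {K : Finset D} (hF : F ⊆ K) (hG : G ⊆ K) {ξ : Module.Dual ℚ (HomOn T T' F)}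
    {η : Module.Dual ℚ (HomOn T T' G)} (h : ∀ a, ξ (HomOn.res hF a) = η (HomOn.res hG a)) :
    of T T' F ξ = of T T' G η := by
  rw [← of_res hF, ← of_res hG]
  congr 1
  exact LinearMap.ext h

open scoped Classical in
/-- The universal property of the colimit. -/
def lift {P : Type} [AddCommGroup P] [Module ℚ P]
    (g : ∀ F, Module.Dual ℚ (HomOn T T' F) →ₗ[ℚ] P)
    (hg : ∀ F G (h : F ⊆ G) ξ, g G (ξ ∘ₗ HomOn.res h) = g F ξ) : CompAlg T T' →ₗ[ℚ] P :=
  Module.DirectLimit.lift ℚ (Finset D) _ (fun _ _ h => (HomOn.res h).dualMap) g hg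

@[simp] lemma lift_of {P : Type} [AddCommGroup P] [Module ℚ P]
    (g : ∀ F, Module.Dual ℚ (HomOn T T' F) →ₗ[ℚ] P)
    (hg : ∀ F G (h : F ⊆ G) ξ, g G (ξ ∘ₗ HomOn.res h) = g F ξ) (F : Finset D)
    (ξ : Module.Dual ℚ (HomOn T T' F)) : lift g hg (of T T' F ξ) = g F ξ := by
  classical
  exact Module.DirectLimit.lift_of _ _ _

/-- The matrix coefficient `φ ↦ γ (φ_p v)`, an element of `A_{1,2}`. -/
def coeff (T T' : Representation D) (p : D) (v : T.obj p) (γ : Module.Dual ℚ (T'.obj p)) :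
    CompAlg T T' :=
  of T T' {p} (γ ∘ₗ LinearMap.applyₗ v ∘ₗ HomOn.ev p (Finset.mem_singleton_self p))

end CompAlg
end Colimit

namespace CompAlg

variable {D : Type} [ProductDiagram.{v} D] (T T' : GradedRep D)

/-- The product of two functionals, dual to `μ*`. -/
def mulFun (F G : Finset D) :
    Module.Dual ℚ (HomOn T.toRepresentation T'.toRepresentation F) →ₗ[ℚ]
    Module.Dual ℚ (HomOn T.toRepresentation T'.toRepresentation G) →ₗ[ℚ]
    Module.Dual ℚ (HomOn T.toRepresentation T'.toRepresentation (mulF F G)) :=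
  TensorProduct.curry ((HomOn.comul T T' F G).dualMap ∘ₗ TensorProduct.dualDistrib ℚ _ _)

variable {T T'} {F G H : Finset D}

lemma mulFun_apply (ξ : Module.Dual ℚ (HomOn T.toRepresentation T'.toRepresentation F))
    (η : Module.Dual ℚ (HomOn T.toRepresentation T'.toRepresentation G)) (a) :
    mulFun T T' F G ξ η a =
      TensorProduct.dualDistrib ℚ _ _ (ξ ⊗ₜ η) (HomOn.comul T T' F G a) := rfl

lemma mulFun_res {F' G' : Finset D} (h : F ⊆ F') (h' : G ⊆ G')
    (ξ : Module.Dual ℚ (HomOn T.toRepresentation T'.toRepresentation F))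
    (η : Module.Dual ℚ (HomOn T.toRepresentation T'.toRepresentation G)) :
    mulFun T T' F' G' (ξ ∘ₗ HomOn.res h) (η ∘ₗ HomOn.res h') =
      mulFun T T' F G ξ η ∘ₗ HomOn.res (mulF_subset h h') := by
  ext a
  rw [LinearMap.comp_apply, mulFun_apply, mulFun_apply, HomOn.comul_res h h']
  generalize HomOn.comul T T' F' G' a = z
  induction z with
  | zero => simp
  | tmul x y => simp
  | add x y hx hy => simp only [map_add, hx, hy]

variable (T T') in
/-- The multiplication of `A_{1,2}` as a bilinear map. -/
def mulBilin : CompAlg T.toRepresentation T'.toRepresentation →ₗ[ℚ]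
    CompAlg T.toRepresentation T'.toRepresentation →ₗ[ℚ]
    CompAlg T.toRepresentation T'.toRepresentation :=
  lift (fun F => (lift (fun G => ((mulFun T T' F G).compr₂ (of _ _ (mulF F G))).flip)
      (fun G G' h η => LinearMap.ext fun ξ => by
        have := mulFun_res (Finset.Subset.refl F) h ξ η
        simp only [LinearMap.flip_apply, LinearMap.compr₂_apply]
        exact (congrArg _ this).trans (of_res _ _))).flip)
    (fun F F' h ξ => LinearMap.ext fun y => by
      obtain ⟨G, η, rfl⟩ := exists_of y
      have := mulFun_res h (Finset.Subset.refl G) ξ η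
      simp only [LinearMap.flip_apply, lift_of, LinearMap.compr₂_apply]
      exact (congrArg _ this).trans (of_res _ _))

variable (ξ : Module.Dual ℚ (HomOn T.toRepresentation T'.toRepresentation F))
  (η : Module.Dual ℚ (HomOn T.toRepresentation T'.toRepresentation G))
  (ζ : Module.Dual ℚ (HomOn T.toRepresentation T'.toRepresentation H))

instance : Mul (CompAlg T.toRepresentation T'.toRepresentation) := ⟨fun x y => mulBilin T T' x y⟩

instance : One (CompAlg T.toRepresentation T'.toRepresentation) :=
  ⟨of _ _ {unit} (HomOn.scal T T')⟩

lemma mul_def (x y : CompAlg T.toRepresentation T'.toRepresentation) :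
    x * y = mulBilin T T' x y := rfl

lemma one_def : (1 : CompAlg T.toRepresentation T'.toRepresentation) =
    of _ _ {unit} (HomOn.scal T T') := rfl

lemma of_mul_of : of _ _ F ξ * of _ _ G η = of _ _ (mulF F G) (mulFun T T' F G ξ η) := by
  simp [mul_def, mulBilin]

protected lemma mul_comm (x y : CompAlg T.toRepresentation T'.toRepresentation) :
    x * y = y * x := by
  classical
  obtain ⟨F, ξ, rfl⟩ := exists_of x
  obtain ⟨G, η, rfl⟩ := exists_of y
  rw [of_mul_of, of_mul_of]
  refine of_eq_of (K := mulF F G ∪ mulF G F) Finset.subset_union_left Finset.subset_union_right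
    fun a => ?_
  rw [mulFun_apply, mulFun_apply, ← HomOn.comul_comm Finset.subset_union_left]
  generalize HomOn.comul T T' F G _ = z
  induction z with
  | zero => simp
  | tmul x y => simp [mul_comm]
  | add x y hx hy => simp only [map_add, hx, hy]

protected lemma mul_assoc (x y z : CompAlg T.toRepresentation T'.toRepresentation) :
    x * y * z = x * (y * z) := by
  classical
  obtain ⟨F, ξ, rfl⟩ := exists_of x
  obtain ⟨G, η, rfl⟩ := exists_of y
  obtain ⟨H, ζ, rfl⟩ := exists_of z
  rw [of_mul_of, of_mul_of, of_mul_of, of_mul_of]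
  refine of_eq_of (K := mulF (mulF F G) H ∪ mulF F (mulF G H)) Finset.subset_union_left
    Finset.subset_union_right fun a => ?_
  rw [mulFun_apply, mulFun_apply]
  have e1 := dualDistrib_assoc_left ξ η ζ (HomOn.comul T T' F G)
  have e2 := dualDistrib_assoc_right ξ η ζ (HomOn.comul T T' G H)
  refine (e1 _).trans (Eq.trans ?_ (e2 _).symm)
  rw [HomOn.comul_assoc Finset.subset_union_left Finset.subset_union_right]

protected lemma one_mul (x : CompAlg T.toRepresentation T'.toRepresentation) : 1 * x = x := by
  classical
  obtain ⟨F, ξ, rfl⟩ := exists_of x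
  rw [one_def, of_mul_of]
  let K : Finset D := mulF {unit} F ∪ (F ∪
    (mulF (mulF {unit} {unit}) F ∪ mulF {unit} (mulF {unit} F)))
  have h1 : mulF {unit} F ⊆ K := Finset.subset_union_left
  have h0 : F ⊆ K := Finset.subset_union_left.trans Finset.subset_union_right
  have h2 : mulF (mulF {unit} {unit}) F ⊆ K := (Finset.subset_union_left.trans
    Finset.subset_union_right).trans Finset.subset_union_right
  have h3 : mulF {unit} (mulF {unit} F) ⊆ K := (Finset.subset_union_right.trans
    Finset.subset_union_right).trans Finset.subset_union_right
  refine of_eq_of h1 h0 fun a => ?_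
  rw [mulFun_apply, ← HomOn.comul_unit h0 h1 h2 h3 a]
  generalize HomOn.comul T T' {unit} F _ = z
  induction z with
  | zero => simp
  | tmul x y => simp
  | add x y hx hy => simp only [map_add, hx, hy]

/-- `A_{1,2}` is a commutative ring. -/
instance : CommRing (CompAlg T.toRepresentation T'.toRepresentation) where
  __ := (inferInstance : AddCommGroup (CompAlg T.toRepresentation T'.toRepresentation))
  mul_assoc := CompAlg.mul_assoc
  mul_comm := CompAlg.mul_comm
  one_mul := CompAlg.one_mul
  mul_one x := by rw [CompAlg.mul_comm, CompAlg.one_mul]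
  left_distrib x y z := by simp only [mul_def, map_add]
  right_distrib x y z := by simp only [mul_def, map_add, LinearMap.add_apply]
  zero_mul x := by simp only [mul_def, map_zero, LinearMap.zero_apply]
  mul_zero x := by simp only [mul_def, map_zero]

/-- `A_{1,2}` is a commutative `ℚ`-algebra. -/
instance : Algebra ℚ (CompAlg T.toRepresentation T'.toRepresentation) :=
  Algebra.ofModule (fun r x y => by simp only [mul_def, map_smul, LinearMap.smul_apply])
    (fun r x y => by simp only [mul_def, map_smul])

end CompAlg

end

section

variable {D : Type} [ProductDiagram.{v} D]

/-- An object of the diagram category `C(T) = colim_F C(T|_F)`: a finite-dimensional rational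
vector space with an action of the algebra `End(T|_F)` for some finite full subdiagram `F`. -/
structure DiagCat (T : GradedRep D) where
  supp : Finset D
  carrier : Type
  [addCommGroup : AddCommGroup carrier]
  [module : Module ℚ carrier]
  [finite : Module.Finite ℚ carrier]
  act : HomOn T.toRepresentation T.toRepresentation supp →ₗ[ℚ] (carrier →ₗ[ℚ] carrier)
  act_one : act (HomOn.one T.toRepresentation supp) = LinearMap.id
  act_comp : ∀ a b, act (HomOn.comp a b) = act a ∘ₗ act b

attribute [instance] DiagCat.addCommGroup DiagCat.module DiagCat.finite

namespace DiagCat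

variable {T : GradedRep D}

/-- The morphisms `X ⟶ Y` in `colim_F C(T|_F)`: the linear maps that are `End(T|_F)`-linear for
some finite `F` containing the supports of `X` and `Y`. -/
def homs (X Y : DiagCat T) : Submodule ℚ (X.carrier →ₗ[ℚ] Y.carrier) where
  carrier := {f | ∃ (F : Finset D) (hX : X.supp ⊆ F) (hY : Y.supp ⊆ F),
    ∀ a, f ∘ₗ X.act (HomOn.res hX a) = Y.act (HomOn.res hY a) ∘ₗ f}
  add_mem' := by
    classical
    rintro f g ⟨F, hX, hY, hf⟩ ⟨F', hX', hY', hg⟩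
    refine ⟨F ∪ F', hX.trans Finset.subset_union_left, hY.trans Finset.subset_union_left,
      fun a => ?_⟩
    have h1 := hf (HomOn.res Finset.subset_union_left a)
    have h2 := hg (HomOn.res Finset.subset_union_right a)
    simp only [HomOn.res_res] at h1 h2
    rw [LinearMap.add_comp, LinearMap.comp_add, h1, h2]
  zero_mem' := by
    classical
    exact ⟨X.supp ∪ Y.supp, Finset.subset_union_left, Finset.subset_union_right,
      fun a => by simp⟩
  smul_mem' := by
    rintro c f ⟨F, hX, hY, hf⟩
    exact ⟨F, hX, hY, fun a => by rw [LinearMap.smul_comp, LinearMap.comp_smul, hf a]⟩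

lemma id_mem_homs (X : DiagCat T) : LinearMap.id ∈ homs X X :=
  ⟨X.supp, Finset.Subset.refl _, Finset.Subset.refl _, fun _ => rfl⟩

lemma comp_mem_homs {X Y Z : DiagCat T} {f : X.carrier →ₗ[ℚ] Y.carrier}
    {g : Y.carrier →ₗ[ℚ] Z.carrier} (hf : f ∈ homs X Y) (hg : g ∈ homs Y Z) :
    g ∘ₗ f ∈ homs X Z := by
  classical
  obtain ⟨F, hX, hY, hf⟩ := hf
  obtain ⟨F', hY', hZ', hg⟩ := hg
  refine ⟨F ∪ F', hX.trans Finset.subset_union_left, hZ'.trans Finset.subset_union_right,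
    fun a => ?_⟩
  have h1 := hf (HomOn.res Finset.subset_union_left a)
  have h2 := hg (HomOn.res Finset.subset_union_right a)
  simp only [HomOn.res_res] at h1 h2
  rw [LinearMap.comp_assoc, h1, ← LinearMap.comp_assoc, h2, LinearMap.comp_assoc]

lemma symm_mem_homs {X Y : DiagCat T} (e : X.carrier ≃ₗ[ℚ] Y.carrier)
    (he : e.toLinearMap ∈ homs X Y) : e.symm.toLinearMap ∈ homs Y X := by
  obtain ⟨F, hX, hY, hf⟩ := he
  refine ⟨F, hY, hX, fun a => ?_⟩
  apply LinearMap.ext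
  intro y
  obtain ⟨x, rfl⟩ := e.surjective y
  apply e.injective
  simpa using (LinearMap.congr_fun (hf a) x).symm

instance : Category (DiagCat T) where
  Hom X Y := homs X Y
  id X := ⟨LinearMap.id, id_mem_homs X⟩
  comp f g := ⟨g.1 ∘ₗ f.1, comp_mem_homs f.2 g.2⟩

/-- The linear map underlying a morphism. -/
def lin {X Y : DiagCat T} (f : X ⟶ Y) : X.carrier →ₗ[ℚ] Y.carrier := f.1

/-- A morphism from an equivariant linear map. -/
def homMk {X Y : DiagCat T} (f : X.carrier →ₗ[ℚ] Y.carrier) (hf : f ∈ homs X Y) : X ⟶ Y := ⟨f, hf⟩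

/-- An isomorphism from an equivariant linear equivalence. -/
def isoMk {X Y : DiagCat T} (e : X.carrier ≃ₗ[ℚ] Y.carrier) (he : e.toLinearMap ∈ homs X Y) :
    X ≅ Y where
  hom := homMk e.toLinearMap he
  inv := homMk e.symm.toLinearMap (symm_mem_homs e he)
  hom_inv_id := Subtype.ext (by ext x; exact e.symm_apply_apply x)
  inv_hom_id := Subtype.ext (by ext x; exact e.apply_symm_apply x)

instance (X Y : DiagCat T) : AddCommGroup (X ⟶ Y) := inferInstanceAs (AddCommGroup (homs X Y))

instance (X Y : DiagCat T) : Module ℚ (X ⟶ Y) := inferInstanceAs (Module ℚ (homs X Y))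

instance : Preadditive (DiagCat T) where
  add_comp _ _ _ f f' g := Subtype.ext (LinearMap.comp_add _ _ _)
  comp_add _ _ _ f g g' := Subtype.ext (LinearMap.add_comp _ _ _)

instance : Linear ℚ (DiagCat T) where
  smul_comp _ _ _ r f g := Subtype.ext (LinearMap.comp_smul _ _ _)
  comp_smul _ _ _ f r g := Subtype.ext (LinearMap.smul_comp _ _ _)

variable (T) in
/-- The forgetful functor `f_T : C(T) ⥤ ℚ-mod`, again denoted `T` in the literature. -/
def fiber : DiagCat T ⥤ FGModuleCat ℚ where
  obj X := FGModuleCat.of ℚ X.carrier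
  map f := FGModuleCat.ofHom (lin f)

instance : (fiber T).Faithful where
  map_injective h := Subtype.ext (congrArg (fun k => k.hom.hom) h)

instance : (fiber T).Additive where

instance : (fiber T).Linear ℚ where

/-- The object `T̃ p` of `C(T)`: the space `T p` with the tautological action of `End(T|_{p})`. -/
def tilde (T : GradedRep D) (p : D) : DiagCat T where
  supp := {p}
  carrier := T.obj p
  act := HomOn.ev p (Finset.mem_singleton_self p)
  act_one := rfl
  act_comp _ _ := rfl

/-- The representation `T̃` of `D` in `C(T)` on edges. -/
def tildeMap {p q : D} (m : p ⟶ q) : tilde T p ⟶ tilde T q :=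
  homMk (T.map m) (by
    classical
    exact ⟨{p} ∪ {q}, Finset.subset_union_left, Finset.subset_union_right,
      fun a => (HomOn.ev_naturality a _ _ m).symm⟩)

section Tensor

section Abstract

variable {A B C E V V' W W' U : Type} [AddCommGroup A] [Module ℚ A] [AddCommGroup B] [Module ℚ B]
  [AddCommGroup C] [Module ℚ C] [AddCommGroup E] [Module ℚ E] [AddCommGroup V] [Module ℚ V]
  [AddCommGroup V'] [Module ℚ V'] [AddCommGroup W] [Module ℚ W] [AddCommGroup W'] [Module ℚ W']
  [AddCommGroup U] [Module ℚ U]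

/-- If `A` acts on `V` and `B` on `W`, then `A ⊗ B` acts on `V ⊗ W`. -/
def actT (α : A →ₗ[ℚ] (V →ₗ[ℚ] V)) (β : B →ₗ[ℚ] (W →ₗ[ℚ] W)) :
    A ⊗[ℚ] B →ₗ[ℚ] (V ⊗[ℚ] W →ₗ[ℚ] V ⊗[ℚ] W) :=
  homTensorHomMap (.id ℚ) _ _ _ _ ∘ₗ TensorProduct.map α β

variable (α : A →ₗ[ℚ] (V →ₗ[ℚ] V)) (β : B →ₗ[ℚ] (W →ₗ[ℚ] W)) (γ : E →ₗ[ℚ] (U →ₗ[ℚ] U))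

lemma actT_tmul (a : A) (b : B) : actT α β (a ⊗ₜ b) = TensorProduct.map (α a) (β b) := rfl

lemma actT_comp (c : A →ₗ[ℚ] A →ₗ[ℚ] A) (c' : B →ₗ[ℚ] B →ₗ[ℚ] B)
    (hα : ∀ a b, α (c a b) = α a ∘ₗ α b) (hβ : ∀ a b, β (c' a b) = β a ∘ₗ β b)
    (z w : A ⊗[ℚ] B) :
    actT α β (TensorProduct.map₂ c c' z w) = actT α β z ∘ₗ actT α β w := by
  induction z with
  | zero => simp
  | add x y hx hy => simp only [map_add, LinearMap.add_apply, hx, hy, LinearMap.add_comp]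
  | tmul a b =>
    induction w with
    | zero => simp
    | add x y hx hy => simp only [map_add, hx, hy, LinearMap.comp_add]
    | tmul x y =>
      rw [TensorProduct.map₂_apply_tmul, TensorProduct.map_tmul, actT_tmul, actT_tmul, actT_tmul,
        hα, hβ, TensorProduct.map_comp]

lemma actT_map {A' B' : Type} [AddCommGroup A'] [Module ℚ A'] [AddCommGroup B'] [Module ℚ B']
    (α' : A' →ₗ[ℚ] (V' →ₗ[ℚ] V')) (β' : B' →ₗ[ℚ] (W' →ₗ[ℚ] W')) (r : C →ₗ[ℚ] A) (r' : C →ₗ[ℚ] A')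
    (s : E →ₗ[ℚ] B) (s' : E →ₗ[ℚ] B') (f : V →ₗ[ℚ] V') (g : W →ₗ[ℚ] W')
    (hf : ∀ a, f ∘ₗ α (r a) = α' (r' a) ∘ₗ f) (hg : ∀ a, g ∘ₗ β (s a) = β' (s' a) ∘ₗ g)
    (z : C ⊗[ℚ] E) :
    TensorProduct.map f g ∘ₗ actT α β (TensorProduct.map r s z) =
      actT α' β' (TensorProduct.map r' s' z) ∘ₗ TensorProduct.map f g := by
  induction z with
  | zero => simp
  | add x y hx hy => simp only [map_add, LinearMap.comp_add, LinearMap.add_comp, hx, hy]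
  | tmul a b =>
    rw [TensorProduct.map_tmul, TensorProduct.map_tmul, actT_tmul, actT_tmul,
      ← TensorProduct.map_comp, ← TensorProduct.map_comp, hf, hg]

lemma actT_comm (z : A ⊗[ℚ] B) : (TensorProduct.comm ℚ V W).toLinearMap ∘ₗ actT α β z =
    actT β α (TensorProduct.comm ℚ A B z) ∘ₗ (TensorProduct.comm ℚ V W).toLinearMap := by
  induction z with
  | zero => simp
  | add x y hx hy => simp only [map_add, LinearMap.comp_add, LinearMap.add_comp, hx, hy]
  | tmul a b =>
    rw [TensorProduct.comm_tmul, actT_tmul, actT_tmul]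
    ext; simp

lemma actT_lid (s : A →ₗ[ℚ] ℚ) (z : A ⊗[ℚ] B) :
    (TensorProduct.lid ℚ W).toLinearMap ∘ₗ
        actT (s.smulRight (LinearMap.id : ℚ →ₗ[ℚ] ℚ)) β z =
      β (TensorProduct.lid ℚ B (s.rTensor B z)) ∘ₗ (TensorProduct.lid ℚ W).toLinearMap := by
  induction z with
  | zero => simp
  | add x y hx hy => simp only [map_add, LinearMap.comp_add, LinearMap.add_comp, hx, hy]
  | tmul a b =>
    rw [actT_tmul]
    ext; simp

lemma actT_assoc_left (m : C →ₗ[ℚ] A ⊗[ℚ] B) (z : C ⊗[ℚ] E) :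
    (TensorProduct.assoc ℚ V W U).toLinearMap ∘ₗ actT (actT α β ∘ₗ m) γ z =
      actT α (actT β γ) (TensorProduct.assoc ℚ A B E (m.rTensor E z)) ∘ₗ
        (TensorProduct.assoc ℚ V W U).toLinearMap := by
  induction z with
  | zero => simp
  | add x y hx hy => simp only [map_add, LinearMap.comp_add, LinearMap.add_comp, hx, hy]
  | tmul a b =>
    rw [actT_tmul, LinearMap.rTensor_tmul, LinearMap.comp_apply]
    generalize m a = w
    induction w with
    | zero => simp
    | add x y hx hy =>
      simp only [map_add, LinearMap.comp_add, LinearMap.add_comp, TensorProduct.map_add_left,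
        TensorProduct.add_tmul, hx, hy]
    | tmul x y =>
      rw [TensorProduct.assoc_tmul, actT_tmul, actT_tmul, actT_tmul]
      ext; simp

lemma actT_assoc_right (m : C →ₗ[ℚ] B ⊗[ℚ] E) (z : A ⊗[ℚ] C) :
    actT α (actT β γ ∘ₗ m) z = actT α (actT β γ) (m.lTensor A z) := by
  induction z with
  | zero => simp
  | add x y hx hy => simp only [map_add, hx, hy]
  | tmul a b => rfl

end Abstract

/-- The tensor product in `C(T)`: `End(T|_{F'})` acts on `X ⊗ Y` through
`μ* : End(T|_{F'}) → End(T|_F) ⊗ End(T|_G)`. -/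
def tensor (X Y : DiagCat T) : DiagCat T where
  supp := mulF X.supp Y.supp
  carrier := X.carrier ⊗[ℚ] Y.carrier
  act := actT X.act Y.act ∘ₗ HomOn.comul T T X.supp Y.supp
  act_one := by
    rw [LinearMap.comp_apply, HomOn.comul_one, actT_tmul, act_one, act_one, TensorProduct.map_id]
  act_comp a b := by
    simp only [LinearMap.comp_apply]
    rw [HomOn.comul_comp, actT_comp _ _ _ _ X.act_comp Y.act_comp]

variable (T) in
/-- The unit object of `C(T)`: the line `ℚ` on which `End(T|_{𝟙})` acts through `End(T(𝟙)) = ℚ`. -/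
def tensorOne : DiagCat T where
  supp := {unit}
  carrier := ℚ
  act := (HomOn.scal T T).smulRight LinearMap.id
  act_one := by ext; simp [HomOn.scal_apply, HomOn.ev_one]
  act_comp a b := by
    ext
    have := unitCo_smul T (HomOn.ev unit (Finset.mem_singleton_self _) b (unitVec T))
    simp only [LinearMap.smulRight_apply, LinearMap.comp_apply, LinearMap.smul_apply,
      LinearMap.id_apply, HomOn.scal_apply, HomOn.ev_comp, smul_eq_mul, mul_one]
    conv_lhs => rw [← this]
    rw [map_smul, map_smul, smul_eq_mul, mul_comm]

lemma map_mem_homs {X X' Y Y' : DiagCat T} {f : X.carrier →ₗ[ℚ] X'.carrier}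
    {g : Y.carrier →ₗ[ℚ] Y'.carrier} (hf : f ∈ homs X X') (hg : g ∈ homs Y Y') :
    TensorProduct.map f g ∈ homs (tensor X Y) (tensor X' Y') := by
  obtain ⟨F, hX, hX', hf⟩ := hf
  obtain ⟨G, hY, hY', hg⟩ := hg
  refine ⟨mulF F G, mulF_subset hX hY, mulF_subset hX' hY', fun a => ?_⟩
  have key := actT_map X.act Y.act X'.act Y'.act _ _ _ _ f g hf hg (HomOn.comul T T F G a)
  rw [← HomOn.comul_res hX hY, ← HomOn.comul_res hX' hY'] at key
  exact key

lemma comm_mem_homs (X Y : DiagCat T) :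
    (TensorProduct.comm ℚ X.carrier Y.carrier).toLinearMap ∈ homs (tensor X Y) (tensor Y X) := by
  classical
  refine ⟨mulF X.supp Y.supp ∪ mulF Y.supp X.supp, Finset.subset_union_left,
    Finset.subset_union_right, fun a => ?_⟩
  have key := actT_comm X.act Y.act
    (HomOn.comul T T X.supp Y.supp (HomOn.res Finset.subset_union_left a))
  rw [HomOn.comul_comm Finset.subset_union_left Finset.subset_union_right a] at key
  exact key

lemma lid_mem_homs (X : DiagCat T) :
    (TensorProduct.lid ℚ X.carrier).toLinearMap ∈ homs (tensor (tensorOne T) X) X := by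
  classical
  let F := X.supp
  let K : Finset D := mulF {unit} F ∪ (F ∪
    (mulF (mulF {unit} {unit}) F ∪ mulF {unit} (mulF {unit} F)))
  have h1 : mulF {unit} F ⊆ K := Finset.subset_union_left
  have h0 : F ⊆ K := Finset.subset_union_left.trans Finset.subset_union_right
  have h2 : mulF (mulF {unit} {unit}) F ⊆ K := (Finset.subset_union_left.trans
    Finset.subset_union_right).trans Finset.subset_union_right
  have h3 : mulF {unit} (mulF {unit} F) ⊆ K := (Finset.subset_union_right.trans
    Finset.subset_union_right).trans Finset.subset_union_right
  refine ⟨K, h1, h0, fun a => ?_⟩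
  have key := actT_lid X.act (HomOn.scal T T) (HomOn.comul T T {unit} F (HomOn.res h1 a))
  rw [HomOn.comul_unit h0 h1 h2 h3 a] at key
  exact key

lemma assoc_mem_homs (X Y Z : DiagCat T) :
    (TensorProduct.assoc ℚ X.carrier Y.carrier Z.carrier).toLinearMap ∈
      homs (tensor (tensor X Y) Z) (tensor X (tensor Y Z)) := by
  classical
  let K : Finset D := mulF (mulF X.supp Y.supp) Z.supp ∪ mulF X.supp (mulF Y.supp Z.supp)
  have h1 : mulF (mulF X.supp Y.supp) Z.supp ⊆ K := Finset.subset_union_left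
  have h2 : mulF X.supp (mulF Y.supp Z.supp) ⊆ K := Finset.subset_union_right
  refine ⟨K, h1, h2, fun a => ?_⟩
  have e1 := actT_assoc_left X.act Y.act Z.act (HomOn.comul T T X.supp Y.supp)
    (HomOn.comul T T (mulF X.supp Y.supp) Z.supp (HomOn.res h1 a))
  have e2 := actT_assoc_right X.act Y.act Z.act (HomOn.comul T T Y.supp Z.supp)
    (HomOn.comul T T X.supp (mulF Y.supp Z.supp) (HomOn.res h2 a))
  rw [HomOn.comul_assoc h1 h2 a, ← e2] at e1
  exact e1

lemma rid_mem_homs (X : DiagCat T) :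
    (TensorProduct.rid ℚ X.carrier).toLinearMap ∈ homs (tensor X (tensorOne T)) X := by
  have := comp_mem_homs (comm_mem_homs X (tensorOne T)) (lid_mem_homs X)
  have e : (TensorProduct.rid ℚ X.carrier).toLinearMap =
      (TensorProduct.lid ℚ X.carrier).toLinearMap ∘ₗ
        (TensorProduct.comm ℚ X.carrier ℚ).toLinearMap := by
    ext; simp
  rw [e]
  exact this

lemma τ_mem_homs (f g : D) :
    (T.τ f g).toLinearMap ∈ homs (tilde T (mul f g)) (tensor (tilde T f) (tilde T g)) := by
  have hf := Finset.mem_singleton_self f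
  have hg := Finset.mem_singleton_self g
  refine ⟨mulF {f} {g}, Finset.singleton_subset_iff.mpr (mul_mem_mulF hf hg),
    Finset.Subset.refl _, fun a => ?_⟩
  have h := HomOn.ev₂_comul (T := T) (T' := T) a f g hf hg
  have e : (T.τ f g).toLinearMap ∘ₗ HomOn.ev (mul f g) (mul_mem_mulF hf hg) a =
      HomOn.ev₂ f g hf hg (HomOn.comul T T {f} {g} a) ∘ₗ (T.τ f g).toLinearMap := by
    rw [h, conjτ_apply]
    ext x
    simp
  exact e

instance : MonoidalCategoryStruct (DiagCat T) where
  tensorObj := tensor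
  tensorUnit := tensorOne T
  tensorHom f g := homMk (TensorProduct.map (lin f) (lin g)) (map_mem_homs f.2 g.2)
  whiskerLeft X _ _ g :=
    homMk (TensorProduct.map LinearMap.id (lin g)) (map_mem_homs (id_mem_homs X) g.2)
  whiskerRight f Y :=
    homMk (TensorProduct.map (lin f) LinearMap.id) (map_mem_homs f.2 (id_mem_homs Y))
  associator X Y Z := isoMk (X := tensor (tensor X Y) Z) (Y := tensor X (tensor Y Z))
    (TensorProduct.assoc ℚ X.carrier Y.carrier Z.carrier) (assoc_mem_homs X Y Z)
  leftUnitor X := isoMk (X := tensor (tensorOne T) X) (TensorProduct.lid ℚ X.carrier)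
    (lid_mem_homs X)
  rightUnitor X := isoMk (X := tensor X (tensorOne T)) (TensorProduct.rid ℚ X.carrier)
    (rid_mem_homs X)

variable (T) in
/-- The forgetful functor is strictly compatible with the tensor structures. -/
def inducingData : Monoidal.InducingFunctorData (fiber T) where
  μIso X Y := LinearEquiv.toFGModuleCatIso (LinearEquiv.refl ℚ (X.carrier ⊗[ℚ] Y.carrier))
  εIso := LinearEquiv.toFGModuleCatIso (LinearEquiv.refl ℚ ℚ)
  whiskerLeft_eq X _ _ f := by
    apply FGModuleCat.hom_ext
    apply TensorProduct.ext'
    intro x y; rfl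
  whiskerRight_eq f Y := by
    apply FGModuleCat.hom_ext
    apply TensorProduct.ext'
    intro x y; rfl
  tensorHom_eq f g := by
    apply FGModuleCat.hom_ext
    apply TensorProduct.ext'
    intro x y; rfl
  associator_eq X Y Z := by
    apply FGModuleCat.hom_ext
    apply TensorProduct.ext_threefold
    intro x y z; rfl
  leftUnitor_eq X := by
    apply FGModuleCat.hom_ext
    apply TensorProduct.ext'
    intro x y; rfl
  rightUnitor_eq X := by
    apply FGModuleCat.hom_ext
    apply TensorProduct.ext'
    intro x y; rfl

instance : MonoidalCategory (DiagCat T) := Monoidal.induced (fiber T) (inducingData T)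

instance : (fiber T).Monoidal := Monoidal.fromInducedMonoidal (fiber T) (inducingData T)

instance : BraidedCategory (DiagCat T) :=
  BraidedCategory.ofFaithful (fiber T)
    (fun X Y => isoMk (X := tensor X Y) (Y := tensor Y X)
      (TensorProduct.comm ℚ X.carrier Y.carrier) (comm_mem_homs X Y))
    (fun X Y => by
      apply FGModuleCat.hom_ext
      apply TensorProduct.ext'
      intro x y; rfl)

instance : (fiber T).Braided where
  braided X Y := by
    apply FGModuleCat.hom_ext
    apply TensorProduct.ext'
    intro x y; rfl

instance : SymmetricCategory (DiagCat T) := SymmetricCategory.ofFaithful (fiber T)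

/-- `τ` as an isomorphism `T̃ (f × g) ≅ T̃ f ⊗ T̃ g` in `C(T)`. -/
def tildeτ (T : GradedRep D) (f g : D) : tilde T (mul f g) ≅ tilde T f ⊗ tilde T g :=
  isoMk (Y := tensor (tilde T f) (tilde T g)) (T.τ f g) (τ_mem_homs f g)

end Tensor
end DiagCat

end

section

section Tannakian

variable {C : Type u} [Category.{w} C] [Preadditive C] [Linear ℚ C]

/-- A functor to finite-dimensional vector spaces is `ℚ`-linear, exact and faithful. -/
structure IsLinearExactFaithful (ω : C ⥤ FGModuleCat ℚ) : Prop where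
  additive : ω.Additive
  linear : ∀ {X Y : C} (c : ℚ) (f : X ⟶ Y), ω.map (c • f) = c • ω.map f
  faithful : ω.Faithful
  leftExact : Limits.PreservesFiniteLimits ω
  rightExact : Limits.PreservesFiniteColimits ω

/-- A symmetric monoidal `ℚ`-linear category is a neutral Tannakian category over `ℚ`: it is
abelian and rigid with `ℚ`-bilinear tensor product, `End(𝟙) = ℚ`, and there is a fiber functor
over `ℚ`. -/
structure IsNeutralTannakian (C : Type u) [Category.{w} C] [P : Preadditive C] [Linear ℚ C]
    [MonoidalCategory C] [SymmetricCategory C] : Prop where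
  abelian : ∃ A : Abelian C, A.toPreadditive = P
  tensor_bilinear : ∃ _ : MonoidalPreadditive C, MonoidalLinear ℚ C
  end_unit : Function.Bijective (fun c : ℚ => c • 𝟙 (𝟙_ C))
  rigid : Nonempty (RigidCategory C)
  fiberFunctor : ∃ ω : C ⥤ FGModuleCat ℚ, Nonempty ω.Braided ∧ IsLinearExactFaithful ω

end Tannakian

section TensorIso

variable {C : Type u} [Category.{w} C]

/-- The linear map underlying `ω(f)`. -/
def mapLin (ω : C ⥤ FGModuleCat ℚ) {X Y : C} (f : X ⟶ Y) : ω.obj X →ₗ[ℚ] ω.obj Y :=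
  (ω.map f).hom.hom

variable [MonoidalCategory C]

/-- The structure map `ℚ → ω(𝟙)` of a tensor functor. -/
def unitLin (ω : C ⥤ FGModuleCat ℚ) [ω.Monoidal] : ℚ →ₗ[ℚ] ω.obj (𝟙_ C) :=
  (Functor.LaxMonoidal.ε ω).hom.hom

/-- The structure map `ω(X) ⊗ ω(Y) → ω(X ⊗ Y)` of a tensor functor. -/
def tensorLin (ω : C ⥤ FGModuleCat ℚ) [ω.Monoidal] (X Y : C) :
    ω.obj X ⊗[ℚ] ω.obj Y →ₗ[ℚ] ω.obj (X ⊗ Y) :=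
  (Functor.LaxMonoidal.μ ω X Y).hom.hom

/-- An `S`-valued point of `Iso^⊗(ω, η)`: a natural `S`-linear tensor isomorphism
`S ⊗ ω ≅ S ⊗ η`. -/
@[ext]
structure TensorIso (ω η : C ⥤ FGModuleCat ℚ) [ω.Monoidal] [η.Monoidal]
    (S : Type) [CommRing S] [Algebra ℚ S] where
  app : ∀ X : C, (S ⊗[ℚ] ω.obj X) ≃ₗ[S] (S ⊗[ℚ] η.obj X)
  naturality : ∀ {X Y : C} (f : X ⟶ Y),
    (app Y).toLinearMap ∘ₗ (mapLin ω f).baseChange S =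
      (mapLin η f).baseChange S ∘ₗ (app X).toLinearMap
  unit : (app (𝟙_ C)).toLinearMap ∘ₗ (unitLin ω).baseChange S = (unitLin η).baseChange S
  tensor : ∀ X Y : C, (app (X ⊗ Y)).toLinearMap ∘ₗ (tensorLin ω X Y).baseChange S ∘ₗ
      (AlgebraTensorModule.distribBaseChange ℚ S (ω.obj X) (ω.obj Y)).symm.toLinearMap =
    (tensorLin η X Y).baseChange S ∘ₗ
      (AlgebraTensorModule.distribBaseChange ℚ S (η.obj X) (η.obj Y)).symm.toLinearMap ∘ₗ
      TensorProduct.map (app X).toLinearMap (app Y).toLinearMap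

namespace TensorIso

variable {ω η θ : C ⥤ FGModuleCat ℚ} [ω.Monoidal] [η.Monoidal] [θ.Monoidal]
  {S : Type} [CommRing S] [Algebra ℚ S]

/-- The inverse `f⁻¹`. -/
def symm (f : TensorIso ω η S) : TensorIso η ω S where
  app X := (f.app X).symm
  naturality {X Y} m := by
    have h := f.naturality m
    ext x
    apply (f.app Y).injective
    have := LinearMap.congr_fun h ((f.app X).symm (1 ⊗ₜ x))
    simpa using this.symm
  unit := by
    have h := f.unit
    rw [← h, ← LinearMap.comp_assoc]
    simp
  tensor X Y := by
    have h := f.tensor X Y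
    apply LinearMap.ext
    intro z
    apply (f.app (X ⊗ Y)).injective
    have := LinearMap.congr_fun h
      (TensorProduct.map (f.app X).symm.toLinearMap (f.app Y).symm.toLinearMap z)
    simp only [LinearMap.comp_apply] at this ⊢
    have e : TensorProduct.map (f.app X).toLinearMap (f.app Y).toLinearMap
        (TensorProduct.map (f.app X).symm.toLinearMap (f.app Y).symm.toLinearMap z) = z := by
      rw [← LinearMap.comp_apply, ← TensorProduct.map_comp]
      simp
    rw [e] at this
    simpa using this.symm

/-- The composite of `f : S ⊗ ω ≅ S ⊗ η` followed by `g : S ⊗ η ≅ S ⊗ θ`. -/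
def trans (f : TensorIso ω η S) (g : TensorIso η θ S) : TensorIso ω θ S where
  app X := (f.app X).trans (g.app X)
  naturality {X Y} m := by
    have h := f.naturality m
    have h' := g.naturality m
    rw [LinearEquiv.coe_trans, LinearEquiv.coe_trans, LinearMap.comp_assoc, h,
      ← LinearMap.comp_assoc, h', LinearMap.comp_assoc]
  unit := by rw [LinearEquiv.coe_trans, LinearMap.comp_assoc, f.unit, g.unit]
  tensor X Y := by
    rw [LinearEquiv.coe_trans, LinearMap.comp_assoc, f.tensor X Y]
    have h' := g.tensor X Y
    rw [LinearEquiv.coe_trans, LinearEquiv.coe_trans, TensorProduct.map_comp]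
    simp only [← LinearMap.comp_assoc] at h' ⊢
    rw [h']

end TensorIso
end TensorIso

section Extension

variable {D : Type} [ProductDiagram.{v} D]

/-- An isomorphism `K ⊗ T₁ ≅ K ⊗ T₂` of representations of the diagram. -/
structure BaseChangeIso (T₁ T₂ : Representation D) (K : Type*) [Field K] [Algebra ℚ K] where
  app : ∀ p : D, (K ⊗[ℚ] T₁.obj p) ≃ₗ[K] (K ⊗[ℚ] T₂.obj p)
  naturality : ∀ {p q : D} (m : p ⟶ q),
    (app q).toLinearMap ∘ₗ (T₁.map m).baseChange K =
      (T₂.map m).baseChange K ∘ₗ (app p).toLinearMap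

/-- An extension of the graded representation `T` of `D` along `T̃₁ : D → C(T₁)` to a symmetric
tensor functor `C(T₁) ⥤ ℚ-mod`: the identifications `T p ≅ functor (T̃₁ p)` are compatible with the
edges of `D` and with `τ`. -/
structure TensorExtension (T₁ T : GradedRep D) where
  functor : DiagCat T₁ ⥤ FGModuleCat ℚ
  [braided : functor.Braided]
  iso : ∀ p, T.obj p ≃ₗ[ℚ] functor.obj (DiagCat.tilde T₁ p)
  iso_map : ∀ {p q : D} (m : p ⟶ q),
    (iso q).toLinearMap ∘ₗ T.map m =
      mapLin functor (DiagCat.tildeMap m) ∘ₗ (iso p).toLinearMap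
  iso_τ : ∀ f g : D,
    mapLin functor (DiagCat.tildeτ T₁ f g).hom ∘ₗ (iso (mul f g)).toLinearMap =
      tensorLin functor (DiagCat.tilde T₁ f) (DiagCat.tilde T₁ g) ∘ₗ
        TensorProduct.map (iso f).toLinearMap (iso g).toLinearMap ∘ₗ (T.τ f g).toLinearMap

attribute [instance] TensorExtension.braided

/-- The forgetful functor `C(T₁) ⥤ ℚ-mod` as the extension of `T₁` itself. -/
def TensorExtension.self (T₁ : GradedRep D) : TensorExtension T₁ T₁ where
  functor := DiagCat.fiber T₁
  iso p := LinearEquiv.refl ℚ (T₁.obj p)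
  iso_map _ := rfl
  iso_τ f g := by
    apply LinearMap.ext
    intro x
    change T₁.τ f g x = TensorProduct.map LinearMap.id LinearMap.id (T₁.τ f g x)
    simp

end Extension

section Schemes

/-- `Spec S` as a scheme over `ℚ`, for a commutative `ℚ`-algebra `S`. -/
def specQ (S : Type) [CommRing S] [Algebra ℚ S] : Over (AlgebraicGeometry.Spec (.of ℚ)) :=
  (AlgebraicGeometry.algSpec (.of ℚ)).obj (.op (CommAlgCat.of ℚ S))

/-- The morphism `Spec S' ⟶ Spec S` of a homomorphism `S → S'` of `ℚ`-algebras. -/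
def specQMap {S S' : Type} [CommRing S] [Algebra ℚ S] [CommRing S'] [Algebra ℚ S']
    (a : S →ₐ[ℚ] S') : specQ S' ⟶ specQ S :=
  (AlgebraicGeometry.algSpec (.of ℚ)).map (CommAlgCat.ofHom a).op

variable {D : Type} [ProductDiagram.{v} D]

/-- The affine scheme `Spec A_{1,2}` over `ℚ`; for `T = T'` this is `Spec A(T)`. -/
def compScheme (T T' : GradedRep D) : Over (AlgebraicGeometry.Spec (.of ℚ)) :=
  specQ (CompAlg T.toRepresentation T'.toRepresentation)

variable {T₁ T T' T'' : GradedRep D}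

/-- The identification `Spec A_{T,T'} = Iso^⊗(T, T')` of schemes over `ℚ`, where `T`, `T'` stand for
their extensions to `C(T₁)`: for every `ℚ`-algebra `S` a bijection, functorial in `S`, of the
`S`-valued points with the tensor isomorphisms over `S`, under which the matrix coefficient
`φ ↦ γ(φ_p v)` in `A_{T,T'}` takes the value `γ(f_p v)` at the point of `f`. -/
structure RepresentsIso (E : TensorExtension T₁ T) (E' : TensorExtension T₁ T') where
  pt : ∀ (S : Type) [CommRing S] [Algebra ℚ S],
    (specQ S ⟶ compScheme T T') ≃ TensorIso E.functor E'.functor S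
  natural : ∀ {S S' : Type} [CommRing S] [Algebra ℚ S] [CommRing S'] [Algebra ℚ S']
    (a : S →ₐ[ℚ] S') (x : specQ S ⟶ compScheme T T') (X : DiagCat T₁)
    (z : S ⊗[ℚ] E.functor.obj X),
    (pt S' (specQMap a ≫ x)).app X (a.toLinearMap.rTensor (E.functor.obj X) z) =
      a.toLinearMap.rTensor (E'.functor.obj X) ((pt S x).app X z)
  coeff : ∀ {S : Type} [CommRing S] [Algebra ℚ S]
    (x : CompAlg T.toRepresentation T'.toRepresentation →ₐ[ℚ] S) (p : D) (v : T.obj p)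
    (γ : Module.Dual ℚ (T'.obj p)),
    x (CompAlg.coeff T.toRepresentation T'.toRepresentation p v γ) =
      TensorProduct.rid ℚ S ((γ ∘ₗ (E'.iso p).symm.toLinearMap).lTensor S
        ((pt S (specQMap x)).app (DiagCat.tilde T₁ p) (1 ⊗ₜ E.iso p v)))

/-- The morphism `m : Iso^⊗(T, T') × Iso^⊗(T', T'') ⟶ Iso^⊗(T, T'')` is the composition
`(f, g) ↦ f` followed by `g`. -/
def IsComposition {E : TensorExtension T₁ T} {E' : TensorExtension T₁ T'}
    {E'' : TensorExtension T₁ T''} (r : RepresentsIso E E') (r' : RepresentsIso E' E'')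
    (r'' : RepresentsIso E E'')
    (m : compScheme T T' ⊗ compScheme T' T'' ⟶ compScheme T T'') : Prop :=
  ∀ (S : Type) [CommRing S] [Algebra ℚ S] (x : specQ S ⟶ compScheme T T')
    (y : specQ S ⟶ compScheme T' T''),
    r''.pt S (CartesianMonoidalCategory.lift x y ≫ m) = (r.pt S x).trans (r'.pt S y)

end Schemes

section Torsor

variable {C : Type u} [Category.{w} C] [CartesianMonoidalCategory C] {X : C}

/-- The value `(x, y, z)` on `Y`-valued points of a morphism `X × X × X ⟶ X`. -/
def ternary (t : X ⊗ X ⊗ X ⟶ X) {Y : C} (x y z : Y ⟶ X) : Y ⟶ X :=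
  CartesianMonoidalCategory.lift x (CartesianMonoidalCategory.lift y z) ≫ t

/-- A torsor in a category with finite products: a morphism `X × X × X ⟶ X` which satisfies the
torsor axioms on `Y`-valued points for all `Y`. -/
structure IsTorsor (t : X ⊗ X ⊗ X ⟶ X) : Prop where
  right_cancel : ∀ {Y : C} (x y : Y ⟶ X), ternary t x y y = x
  left_cancel : ∀ {Y : C} (x y : Y ⟶ X), ternary t y y x = x
  assoc_middle : ∀ {Y : C} (x y z u v : Y ⟶ X),
    ternary t (ternary t x y z) u v = ternary t x (ternary t u z y) v
  assoc_right : ∀ {Y : C} (x y z u v : Y ⟶ X),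
    ternary t x (ternary t u z y) v = ternary t x y (ternary t z u v)

end Torsor

end

end NoriDiagram
end

open NoriDiagram CategoryTheory MonoidalCategory

universe v w

open CategoryTheory MonoidalCategory TensorProduct
noncomputable section
namespace NoriDiagram
universe u
-- The proof has three stages.
--
-- (a) An isomorphism over $K$ gives rational isomorphisms on finite subdiagrams (Noether–Deuring).
-- In a basis of $K$ over $\mathbb{Q}$ the isomorphism is a sum $\sum_j B_j\otimes f_j$, where every
-- $f_j$ commutes with the edges. For finitely many vertices, $\det(\sum_j x_jf_j)$ are nonzero
-- polynomials, because they do not vanish at $x_j=B_j$. Since $\mathbb{Q}$ is infinite, some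
-- rational $x$ avoids all their zeros. This is `BaseChangeIso.locIso`. The local isomorphisms
-- respect neither $\tau$ nor restriction to smaller subdiagrams, and nothing below needs that.
--
-- (b) For $F$ finite, $\mathrm{Hom}(T_2|_F,T_1|_F)$ is a left $\mathrm{End}(T_1|_F)$-module, free
-- of rank one on any local isomorphism. The extension sends $X$ with support $F$ to the space `Fib`
-- of equivariant maps $\mathrm{Hom}(T_2|_F,T_1|_F)\to X$, which has the dimension of $X$. The
-- tensor structure is composition with $\mu^*$. It is invertible because $\mu^*$ is multiplicative
-- for composition (`HomOn.comul_compH`) and so preserves inverse pairs. A choice of local generator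
-- identifies the new functor with the forgetful functor on any finite collection of objects and
-- morphisms; hence it is exact and faithful.
--
-- (c) A $\mathbb{Q}$-algebra homomorphism $A_{T,T'}\to S$ assigns values to the matrix
-- coefficients. These extend from vertices of $D$ to all objects of $\mathcal C(T_1)$ and define an
-- $S$-linear tensor transformation. Conversely, a tensor transformation is determined by its
-- components at the $\tilde T_1p$: each object receives maps from the regular objects
-- $\mathrm{End}(T_1|_F)$ that together reach all of its fibre, and the regular objects are
-- separated by maps to the $\tilde T_1p$. Its coefficients are multiplicative by compatibility with
-- $\tau$. This is `FibreData.pointEquiv`. Rigidity and equality of dimensions make every tensor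
-- transformation an isomorphism (`TensorTrans.bijective`). Hence the spectra represent
-- $\mathrm{Iso}^\otimes$.
--
-- `FibreData` collects the properties common to the forgetful functor and to the constructed
-- extension, so that one argument covers all four pairs $(i,j)$. Composition and inversion become
-- morphisms by applying a functorial construction to the universal point of an affine scheme
-- (`RepresentsIso.exists_hom`). The remaining identities are identities between composites of
-- isomorphisms, checked on points.
open ProductDiagram

/-! ### Coordinates over a field extension and the generic determinant. -/

section NoetherDeuring

variable {V W : Type} [AddCommGroup V] [Module ℚ V] [AddCommGroup W] [Module ℚ W]
  {K : Type w} [Field K] [Algebra ℚ K] {J : Type*} (B : Module.Basis J ℚ K)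

/-- The `j`-th component, with respect to a basis of `K` over `ℚ`, of a `K`-linear map
`K ⊗ V → K ⊗ W`. -/
def basisComponent (f : K ⊗[ℚ] V →ₗ[K] K ⊗[ℚ] W) (j : J) : V →ₗ[ℚ] W :=
  (TensorProduct.lid ℚ W).toLinearMap ∘ₗ (B.coord j).rTensor W ∘ₗ f.restrictScalars ℚ ∘ₗ
    TensorProduct.mk ℚ K V 1

/-- Since $a$ and $b$ are defined over $\mathbb{Q}$, their base changes act on the second tensor
factor alone and commute with taking coordinates in $K$. Thus each coordinate of a natural
isomorphism over $K$ is itself natural. -/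
lemma basisComponent_comp {V' W' : Type} [AddCommGroup V'] [Module ℚ V'] [AddCommGroup W']
    [Module ℚ W'] {f : K ⊗[ℚ] V →ₗ[K] K ⊗[ℚ] W} {f' : K ⊗[ℚ] V' →ₗ[K] K ⊗[ℚ] W'}
    {a : V →ₗ[ℚ] V'} {b : W →ₗ[ℚ] W'}
    (h : f' ∘ₗ a.baseChange K = b.baseChange K ∘ₗ f) (j : J) :
    basisComponent B f' j ∘ₗ a = b ∘ₗ basisComponent B f j := by
  ext v
  have h1 := LinearMap.congr_fun h (1 ⊗ₜ v)
  simp only [LinearMap.comp_apply, LinearMap.baseChange_tmul] at h1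
  simp only [basisComponent, LinearMap.comp_apply, LinearMap.coe_restrictScalars,
    TensorProduct.mk_apply, LinearEquiv.coe_coe, h1]
  generalize f (1 ⊗ₜ v) = z
  induction z with
  | zero => simp
  | tmul x y => simp
  | add x y hx hy => simp only [map_add, hx, hy]

variable [DecidableEq J]

lemma basisComponent_apply (f : K ⊗[ℚ] V →ₗ[K] K ⊗[ℚ] W) (j : J) (v : V) :
    basisComponent B f j v = TensorProduct.equivFinsuppOfBasisLeft (N := W) B (f (1 ⊗ₜ v)) j := by
  rw [TensorProduct.equivFinsuppOfBasisLeft_apply]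
  rfl

/-- The basis of $K$ may be infinite, but the images of the finitely many basis vectors of $V$
involve only finitely many of its elements. -/
lemma exists_finset_basisComponent [Module.Finite ℚ V] (f : K ⊗[ℚ] V →ₗ[K] K ⊗[ℚ] W) :
    ∃ s : Finset J, ∀ j ∉ s, basisComponent B f j = 0 := by
  let b := Module.finBasis ℚ V
  refine ⟨Finset.univ.biUnion fun i =>
    (TensorProduct.equivFinsuppOfBasisLeft (N := W) B (f (1 ⊗ₜ b i))).support, fun j hj => ?_⟩
  refine b.ext fun i => ?_
  rw [basisComponent_apply]
  simp only [Finset.mem_biUnion, Finset.mem_univ, true_and, not_exists,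
    Finsupp.notMem_support_iff] at hj
  simpa using hj i

lemma sum_basisComponent (f : K ⊗[ℚ] V →ₗ[K] K ⊗[ℚ] W) (s : Finset J)
    (hs : ∀ j ∉ s, basisComponent B f j = 0) :
    f = ∑ j ∈ s, B j • (basisComponent B f j).baseChange K := by
  apply TensorProduct.AlgebraTensorModule.curry_injective
  apply LinearMap.ext_ring
  ext v
  have h : f (1 ⊗ₜ v) = ∑ j ∈ s, B j ⊗ₜ basisComponent B f j v := by
    conv_lhs => rw [← (TensorProduct.equivFinsuppOfBasisLeft (N := W) B).symm_apply_apply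
      (f (1 ⊗ₜ v)), TensorProduct.equivFinsuppOfBasisLeft_symm_apply]
    rw [Finsupp.sum]
    simp only [← basisComponent_apply]
    refine Finset.sum_subset ?_ ?_
    · intro j hj
      by_contra hjs
      rw [Finsupp.mem_support_iff, ← basisComponent_apply, hs j hjs] at hj
      exact hj rfl
    · intro j _ hj
      rw [Finsupp.notMem_support_iff, ← basisComponent_apply] at hj
      rw [hj, TensorProduct.tmul_zero]
  simp only [AlgebraTensorModule.curry_apply, TensorProduct.curry_apply,
    LinearMap.coe_restrictScalars, h, LinearMap.sum_apply,
    LinearMap.smul_apply, LinearMap.baseChange_tmul, TensorProduct.smul_tmul', smul_eq_mul, mul_one]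

/-- The generic determinant of a finite family of linear maps does not vanish if one of its values
over an extension field is the determinant of an isomorphism. -/
lemma exists_det_polynomial [Module.Finite ℚ V] [Module.Finite ℚ W]
    (f : K ⊗[ℚ] V ≃ₗ[K] K ⊗[ℚ] W) (s : Finset J)
    (hs : ∀ j ∉ s, basisComponent B f.toLinearMap j = 0) :
    ∃ P : MvPolynomial J ℚ, P ≠ 0 ∧ ∀ x : J → ℚ, MvPolynomial.eval x P ≠ 0 →
      Function.Bijective
        (∑ j ∈ s, x j • basisComponent B f.toLinearMap j : V →ₗ[ℚ] W) := by
  have hfr : Module.finrank ℚ W = Module.finrank ℚ V := by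
    have := f.finrank_eq
    rw [Module.finrank_baseChange, Module.finrank_baseChange] at this
    exact this.symm
  -- An arbitrary identification of the two spaces turns the maps into square matrices; only the
  -- vanishing of the determinant matters, and this does not depend on `e`.
  let e : W ≃ₗ[ℚ] V := LinearEquiv.ofFinrankEq W V hfr
  let b := Module.finBasis ℚ V
  let M : J → Matrix _ _ ℚ := fun j =>
    LinearMap.toMatrix b b (e.toLinearMap ∘ₗ basisComponent B f.toLinearMap j)
  let P : MvPolynomial J ℚ :=
    (∑ j ∈ s, (MvPolynomial.X j : MvPolynomial J ℚ) • (M j).map MvPolynomial.C).det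
  refine ⟨P, ?_, fun x hx => ?_⟩
  -- At $x_j=B_j$ the polynomial takes the determinant of $(K\otimes e)\circ f$ as its value, which
  -- is a unit.
  · intro hP
    have h1 : MvPolynomial.aeval (fun j => B j) P = 0 := by rw [hP, map_zero]
    have h2 : MvPolynomial.aeval (fun j => B j) P =
        (∑ j ∈ s, B j • (M j).map (algebraMap ℚ K)).det := by
      simp only [P]
      rw [AlgHom.map_det]
      congr 1
      ext i k
      simp [Matrix.sum_apply]
    let g : K ⊗[ℚ] V ≃ₗ[K] K ⊗[ℚ] V := f.trans (e.baseChange ℚ K W V)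
    have h3 : LinearMap.toMatrix (Algebra.TensorProduct.basis K b)
        (Algebra.TensorProduct.basis K b) g.toLinearMap =
        ∑ j ∈ s, B j • (M j).map (algebraMap ℚ K) := by
      have hg : g.toLinearMap = ∑ j ∈ s, B j •
          (e.toLinearMap ∘ₗ basisComponent B f.toLinearMap j).baseChange K := by
        have : g.toLinearMap = e.toLinearMap.baseChange K ∘ₗ f.toLinearMap := rfl
        rw [this]
        conv_lhs => rw [sum_basisComponent B f.toLinearMap s hs]
        ext v
        simp
      rw [hg, map_sum]
      simp only [map_smul]
      refine Finset.sum_congr rfl fun j _ => ?_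
      rw [LinearMap.toMatrix_baseChange]
    rw [h1, ← h3, LinearMap.det_toMatrix] at h2
    exact (LinearEquiv.isUnit_det' g).ne_zero h2.symm
  · have h2 : MvPolynomial.eval x P = (∑ j ∈ s, x j • M j).det := by
      simp only [P]
      rw [RingHom.map_det]
      congr 1
      ext i k
      simp [Matrix.sum_apply]
    have h3 : (∑ j ∈ s, x j • M j) = LinearMap.toMatrix b b
        (e.toLinearMap ∘ₗ ∑ j ∈ s, x j • basisComponent B f.toLinearMap j) := by
      have : e.toLinearMap ∘ₗ ∑ j ∈ s, x j • basisComponent B f.toLinearMap j =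
          ∑ j ∈ s, x j • (e.toLinearMap ∘ₗ basisComponent B f.toLinearMap j) := by
        ext v; simp
      rw [this, map_sum]
      simp only [map_smul, M]
    rw [h2, h3, LinearMap.det_toMatrix] at hx
    have h4 := (LinearMap.equivOfDetNeZero _ hx).bijective
    have h5 : ⇑(LinearMap.equivOfDetNeZero _ hx) =
      e ∘ (∑ j ∈ s, x j • basisComponent B f.toLinearMap j : V →ₗ[ℚ] W) := rfl
    rw [h5] at h4
    exact (e.bijective.of_comp_iff' _).mp h4

end NoetherDeuring

/-! ### Composition of local morphisms and local isomorphisms. -/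

section Comp

variable {D : Type} [ReflQuiver.{v} D] {T T' T'' T''' : Representation D} {F G : Finset D}

namespace HomOn

/-- Composition of morphisms of representations of a finite subdiagram. -/
def compH : HomOn T' T'' F →ₗ[ℚ] HomOn T T' F →ₗ[ℚ] HomOn T T'' F :=
  LinearMap.mk₂ ℚ (fun a b => ⟨fun p => a.1 p ∘ₗ b.1 p, fun p q m => by
      rw [LinearMap.comp_assoc, b.2 p q m, ← LinearMap.comp_assoc, a.2 p q m,
        LinearMap.comp_assoc]⟩)
    (fun _ _ _ => rfl) (fun _ _ _ => rfl)
    (fun _ _ _ => Subtype.ext <| funext fun _ => LinearMap.comp_add _ _ _)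
    (fun _ _ _ => Subtype.ext <| funext fun _ => LinearMap.comp_smul _ _ _)

lemma ev_compH (a : HomOn T' T'' F) (b : HomOn T T' F) (p : D) (hp : p ∈ F) :
    ev p hp (compH a b) = ev p hp a ∘ₗ ev p hp b := rfl

lemma res_compH (h : F ⊆ G) (a : HomOn T' T'' G) (b : HomOn T T' G) :
    res h (compH a b) = compH (res h a) (res h b) := rfl

lemma compH_assoc (a : HomOn T'' T''' F) (b : HomOn T' T'' F) (c : HomOn T T' F) :
    compH (compH a b) c = compH a (compH b c) := rfl

/-- The identity of `T|_F`. -/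
def idH (T : Representation D) (F : Finset D) : HomOn T T F :=
  ⟨fun _ => LinearMap.id, fun _ _ _ => rfl⟩

lemma ev_idH (p : D) (hp : p ∈ F) : ev p hp (idH T F) = LinearMap.id := rfl

@[simp] lemma compH_idH (a : HomOn T T' F) : compH a (idH T F) = a := rfl

@[simp] lemma idH_compH (a : HomOn T T' F) : compH (idH T' F) a = a := rfl

lemma res_idH (h : F ⊆ G) : res h (idH T G) = idH T F := rfl

end HomOn

/-- The representations are isomorphic on every finite subdiagram. -/
def LocIso (T T' : Representation D) : Prop :=
  ∀ F, ∃ (b : HomOn T T' F) (c : HomOn T' T F),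
    HomOn.compH c b = HomOn.idH T F ∧ HomOn.compH b c = HomOn.idH T' F

lemma LocIso.refl (T : Representation D) : LocIso T T :=
  fun F => ⟨HomOn.idH T F, HomOn.idH T F, rfl, rfl⟩

lemma HomOn.exists_inverse (b : HomOn T T' F)
    (hb : ∀ p hp, Function.Bijective (HomOn.ev p hp b)) :
    ∃ c : HomOn T' T F, HomOn.compH c b = HomOn.idH T F ∧ HomOn.compH b c = HomOn.idH T' F := by
  let e : ∀ p : F, T.obj p ≃ₗ[ℚ] T'.obj p :=
    fun p => LinearEquiv.ofBijective (HomOn.ev p.1 p.2 b) (hb p.1 p.2)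
  have he : ∀ p : F, (e p).toLinearMap = b.1 p := fun p => rfl
  refine ⟨⟨fun p => (e p).symm.toLinearMap, fun p q m => ?_⟩, ?_, ?_⟩
  · ext x
    obtain ⟨y, rfl⟩ := (e p).surjective x
    apply (e q).injective
    have := LinearMap.congr_fun (b.2 p q m) y
    rw [← he, ← he] at this
    simpa using this.symm
  · exact Subtype.ext <| funext fun p => LinearMap.ext fun x => (e p).symm_apply_apply x
  · exact Subtype.ext <| funext fun p => LinearMap.ext fun x => (e p).apply_symm_apply x

end Comp

/-- Noether–Deuring: representations that become isomorphic over an extension field are isomorphic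
on every finite subdiagram. -/
theorem BaseChangeIso.locIso {D : Type} [ProductDiagram.{v} D] {T T' : Representation D}
    {K : Type w} [Field K] [Algebra ℚ K] (φ : BaseChangeIso T T' K) : LocIso T T' := by
  classical
  intro F
  let B := Module.Basis.ofVectorSpace ℚ K
  -- A single finite index set serves all vertices of $F$. Naturality of the linear combination
  -- requires the same coefficients at every vertex.
  choose s hs using fun p : F => exists_finset_basisComponent B (φ.app p).toLinearMap
  let t := Finset.univ.biUnion s
  have ht : ∀ p : F, ∀ j ∉ t, basisComponent B (φ.app p).toLinearMap j = 0 := fun p j hj =>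
    hs p j fun hj' => hj (Finset.mem_biUnion.mpr ⟨p, Finset.mem_univ p, hj'⟩)
  choose P hP hPx using fun p : F => exists_det_polynomial B (φ.app p) t (ht p)
  -- The product of the generic determinants is a nonzero polynomial over an infinite field, so one
  -- rational point makes all of them nonzero at once.
  have hne : ∏ p, P p ≠ 0 := Finset.prod_ne_zero_iff.mpr fun p _ => hP p
  obtain ⟨x, hx⟩ : ∃ x, MvPolynomial.eval x (∏ p, P p) ≠ 0 := by
    by_contra! h
    exact hne (MvPolynomial.funext fun x => by rw [h x, map_zero])
  rw [map_prod, Finset.prod_ne_zero_iff] at hx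
  let b : HomOn T T' F := ⟨fun p => ∑ j ∈ t, x j • basisComponent B (φ.app p).toLinearMap j,
    fun p q m => by
      have h := fun j => basisComponent_comp B (φ.naturality m) j
      ext v
      have h' := fun j => LinearMap.congr_fun (h j) v
      simp only [LinearMap.comp_apply] at h'
      simp [h']⟩
  obtain ⟨c, hc⟩ := HomOn.exists_inverse b
    (fun p hp => hPx ⟨p, hp⟩ x (hx ⟨p, hp⟩ (Finset.mem_univ _)))
  exact ⟨b, c, hc⟩

/-! ### Multiplicativity of the comultiplication for composition. -/

section HomT

variable {A A' A'' B B' B'' V V' V'' W W' W'' : Type}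
  [AddCommGroup A] [Module ℚ A] [AddCommGroup A'] [Module ℚ A'] [AddCommGroup A''] [Module ℚ A'']
  [AddCommGroup B] [Module ℚ B] [AddCommGroup B'] [Module ℚ B'] [AddCommGroup B''] [Module ℚ B'']
  [AddCommGroup V] [Module ℚ V] [AddCommGroup V'] [Module ℚ V'] [AddCommGroup V''] [Module ℚ V'']
  [AddCommGroup W''] [Module ℚ W''] [AddCommGroup W'] [Module ℚ W'] [AddCommGroup W] [Module ℚ W]

/-- If `A` maps `V` to `V'` and `B` maps `W` to `W'`, then `A ⊗ B` maps `V ⊗ W` to `V' ⊗ W'`. -/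
def homT (α : A →ₗ[ℚ] (V →ₗ[ℚ] V')) (β : B →ₗ[ℚ] (W →ₗ[ℚ] W')) :
    A ⊗[ℚ] B →ₗ[ℚ] (V ⊗[ℚ] W →ₗ[ℚ] V' ⊗[ℚ] W') :=
  homTensorHomMap (.id ℚ) _ _ _ _ ∘ₗ TensorProduct.map α β

@[simp] lemma homT_tmul (α : A →ₗ[ℚ] (V →ₗ[ℚ] V')) (β : B →ₗ[ℚ] (W →ₗ[ℚ] W')) (a : A) (b : B) :
    homT α β (a ⊗ₜ b) = TensorProduct.map (α a) (β b) := rfl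

lemma homT_map₂ (α : A →ₗ[ℚ] (V' →ₗ[ℚ] V'')) (β : B →ₗ[ℚ] (W' →ₗ[ℚ] W''))
    (α' : A' →ₗ[ℚ] (V →ₗ[ℚ] V')) (β' : B' →ₗ[ℚ] (W →ₗ[ℚ] W'))
    (α'' : A'' →ₗ[ℚ] (V →ₗ[ℚ] V'')) (β'' : B'' →ₗ[ℚ] (W →ₗ[ℚ] W''))
    (c : A →ₗ[ℚ] A' →ₗ[ℚ] A'') (c' : B →ₗ[ℚ] B' →ₗ[ℚ] B'')
    (hα : ∀ a b, α'' (c a b) = α a ∘ₗ α' b) (hβ : ∀ a b, β'' (c' a b) = β a ∘ₗ β' b)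
    (z : A ⊗[ℚ] B) (w : A' ⊗[ℚ] B') :
    homT α'' β'' (TensorProduct.map₂ c c' z w) = homT α β z ∘ₗ homT α' β' w := by
  induction z with
  | zero => simp
  | add x y hx hy => simp only [map_add, LinearMap.add_apply, hx, hy, LinearMap.add_comp]
  | tmul a b =>
    induction w with
    | zero => simp
    | add x y hx hy => simp only [map_add, hx, hy, LinearMap.comp_add]
    | tmul x y =>
      rw [TensorProduct.map₂_apply_tmul, TensorProduct.map_tmul, homT_tmul, homT_tmul, homT_tmul,
        hα, hβ, TensorProduct.map_comp]

lemma map_map₂_eq_homT (α : A →ₗ[ℚ] (V →ₗ[ℚ] V')) (β : B →ₗ[ℚ] (W →ₗ[ℚ] W'))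
    (c : A →ₗ[ℚ] A' →ₗ[ℚ] A'') (c' : B →ₗ[ℚ] B' →ₗ[ℚ] B'')
    (z : A' →ₗ[ℚ] V) (z' : A'' →ₗ[ℚ] V') (w : B' →ₗ[ℚ] W) (w' : B'' →ₗ[ℚ] W')
    (hz : ∀ a b, z' (c a b) = α a (z b)) (hw : ∀ a b, w' (c' a b) = β a (w b))
    (s : A ⊗[ℚ] B) (t : A' ⊗[ℚ] B') :
    TensorProduct.map z' w' (TensorProduct.map₂ c c' s t) =
      homT α β s (TensorProduct.map z w t) := by
  induction s with
  | zero => simp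
  | add x y hx hy => simp only [map_add, LinearMap.add_apply, hx, hy]
  | tmul a b =>
    induction t with
    | zero => simp
    | add x y hx hy => simp only [map_add, hx, hy]
    | tmul x y =>
      rw [TensorProduct.map₂_apply_tmul, TensorProduct.map_tmul, TensorProduct.map_tmul,
        TensorProduct.map_tmul, homT_tmul, TensorProduct.map_tmul, hz, hw]

end HomT

variable {D : Type} [ProductDiagram.{v} D]

/-- `Hom(T|_F, T'|_F)` for graded representations. -/
abbrev GHom (T T' : GradedRep D) (F : Finset D) :=
  HomOn T.toRepresentation T'.toRepresentation F

namespace HomOn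

variable {T T' T'' : GradedRep D} {F G : Finset D}

lemma ev₂_compH (f g : D) (hf : f ∈ F) (hg : g ∈ G)
    (z : GHom T' T'' F ⊗[ℚ] GHom T' T'' G) (w : GHom T T' F ⊗[ℚ] GHom T T' G) :
    ev₂ f g hf hg (TensorProduct.map₂ compH compH z w) = ev₂ f g hf hg z ∘ₗ ev₂ f g hf hg w :=
  homT_map₂ _ _ _ _ _ _ compH compH (fun _ _ => rfl) (fun _ _ => rfl) z w

/-- On the $(f,g)$-component the two copies of $\tau$ for the middle representation cancel. As a
consequence $\mu^*$ takes a pair of mutually inverse local isomorphisms to a pair that acts by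
mutually inverse maps on tensor products, even though the isomorphisms ignore $\tau$. -/
lemma comul_compH (a : GHom T' T'' (mulF F G)) (b : GHom T T' (mulF F G)) :
    comul T T'' F G (compH a b) =
      TensorProduct.map₂ compH compH (comul T' T'' F G a) (comul T T' F G b) :=
  ext_ev₂ fun f g hf hg => by
    rw [ev₂_compH, ev₂_comul, ev₂_comul, ev₂_comul, ev_compH, conjτ_apply, conjτ_apply, conjτ_apply]
    ext; simp

lemma comul_idH : comul T T F G (idH T.toRepresentation _) =
    idH T.toRepresentation F ⊗ₜ idH T.toRepresentation G := comul_one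

lemma ev_unitVec (a : GHom T T' {unit}) :
    ev unit (Finset.mem_singleton_self _) a (unitVec T) = scal T T' a • unitVec T' := by
  rw [scal_apply, unitCo_smul]

/-- The spaces $T(\mathbf 1)$ are lines with preferred generators, so composition there is
multiplication of scalars. -/
lemma scal_compH (a : GHom T' T'' {unit}) (b : GHom T T' {unit}) :
    scal T T'' (compH a b) = scal T' T'' a * scal T T' b := by
  rw [scal_apply, ev_compH, LinearMap.comp_apply, ev_unitVec, map_smul, ev_unitVec, map_smul,
    map_smul, unitCo_unitVec]
  simp [mul_comm]

end HomOn

/-! ### The extension as a space of equivariant maps. -/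

section EquivariantMaps

variable {T T₁ : GradedRep D} {F F' F'' G G' G'' H K : Finset D} {V V' W W' U : Type}
  [AddCommGroup V] [Module ℚ V] [AddCommGroup V'] [Module ℚ V'] [AddCommGroup W] [Module ℚ W]
  [AddCommGroup W'] [Module ℚ W'] [AddCommGroup U] [Module ℚ U]

/-- The `End(T₁|_F)`-linear maps `Hom(T|_F, T₁|_F) → V`. -/
def EquivMaps (T : GradedRep D) {T₁ : GradedRep D} {F : Finset D}
    (α : GHom T₁ T₁ F →ₗ[ℚ] (V →ₗ[ℚ] V)) : Submodule ℚ (GHom T T₁ F →ₗ[ℚ] V) where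
  carrier := {z | ∀ a h, z (HomOn.compH a h) = α a (z h)}
  add_mem' {z w} hz hw a h := by simp [hz a h, hw a h]
  zero_mem' a h := by simp
  smul_mem' c z hz a h := by simp [hz a h]

namespace EquivMaps

variable (α : GHom T₁ T₁ F →ₗ[ℚ] (V →ₗ[ℚ] V)) (β : GHom T₁ T₁ G →ₗ[ℚ] (W →ₗ[ℚ] W))

/-- The evaluation `Hom(T|_F, T₁|_F) → Hom(EquivMaps T α, V)`. -/
def out : GHom T T₁ F →ₗ[ℚ] (EquivMaps T α →ₗ[ℚ] V) := LinearMap.flip (EquivMaps T α).subtype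

@[simp] lemma out_apply (h : GHom T T₁ F) (z : EquivMaps T α) : out α h z = z.1 h := rfl

/-- The product of equivariant maps. -/
def mul : EquivMaps T α ⊗[ℚ] EquivMaps T β →ₗ[ℚ]
    EquivMaps T (DiagCat.actT α β ∘ₗ HomOn.comul T₁ T₁ F G) :=
  TensorProduct.lift <| LinearMap.mk₂ ℚ
    (fun z w => ⟨TensorProduct.map z.1 w.1 ∘ₗ HomOn.comul T T₁ F G, fun a h => by
      rw [LinearMap.comp_apply, LinearMap.comp_apply, HomOn.comul_compH]
      exact map_map₂_eq_homT α β _ _ _ _ _ _ z.2 w.2 _ _⟩)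
    (fun _ _ _ => Subtype.ext (LinearMap.ext fun h => by simp [TensorProduct.map_add_left]))
    (fun _ _ _ => Subtype.ext (LinearMap.ext fun h => by simp [TensorProduct.map_smul_left]))
    (fun _ _ _ => Subtype.ext (LinearMap.ext fun h => by simp [TensorProduct.map_add_right]))
    (fun _ _ _ => Subtype.ext (LinearMap.ext fun h => by simp [TensorProduct.map_smul_right]))

lemma out_mul (h : GHom T T₁ (mulF F G)) (t : EquivMaps T α ⊗[ℚ] EquivMaps T β) :
    out _ h (mul α β t) = homT (out α) (out β) (HomOn.comul T T₁ F G h) t := by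
  induction t with
  | zero => simp
  | add x y hx hy => simp only [map_add, hx, hy]
  | tmul z w =>
    change TensorProduct.map z.1 w.1 (HomOn.comul T T₁ F G h) = _
    generalize HomOn.comul T T₁ F G h = s
    induction s with
    | zero => simp
    | add x y hx hy => simp only [map_add, hx, hy, LinearMap.add_apply]
    | tmul a b => simp

variable (x : GHom T T₁ F →ₗ[ℚ] V) (y : GHom T T₁ G →ₗ[ℚ] W) (z : GHom T T₁ H →ₗ[ℚ] U)

/-- Both sides are computed from the restriction of $b$ to $F''\times G''$, where $x,x'$ and $y,y'$
become comparable; `HomOn.comul_res` moves the restrictions through $\mu^*$. -/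
lemma map_natural (x' : GHom T T₁ F' →ₗ[ℚ] V') (y' : GHom T T₁ G' →ₗ[ℚ] W')
    (f : V →ₗ[ℚ] V') (g : W →ₗ[ℚ] W') (hF : F ⊆ F'') (hF' : F' ⊆ F'') (hG : G ⊆ G'')
    (hG' : G' ⊆ G'') (hK : mulF F'' G'' ⊆ K)
    (hf : ∀ b, x' (HomOn.res hF' b) = f (x (HomOn.res hF b)))
    (hg : ∀ b, y' (HomOn.res hG' b) = g (y (HomOn.res hG b))) (b : GHom T T₁ K) :
    TensorProduct.map f g (TensorProduct.map x y
        (HomOn.comul T T₁ F G (HomOn.res ((mulF_subset hF hG).trans hK) b))) =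
      TensorProduct.map x' y'
        (HomOn.comul T T₁ F' G' (HomOn.res ((mulF_subset hF' hG').trans hK) b)) := by
  have e1 := HomOn.comul_res hF hG (HomOn.res hK b)
  have e2 := HomOn.comul_res hF' hG' (HomOn.res hK b)
  rw [HomOn.res_res] at e1 e2
  rw [e1, e2]
  generalize HomOn.comul T T₁ F'' G'' (HomOn.res hK b) = s
  induction s with
  | zero => simp
  | add x y hx hy => simp only [map_add, hx, hy]
  | tmul a b => simp only [TensorProduct.map_tmul, hf, hg]

lemma map_assoc (h₁ : mulF (mulF F G) H ⊆ K) (h₂ : mulF F (mulF G H) ⊆ K) (b : GHom T T₁ K) :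
    TensorProduct.assoc ℚ _ _ _ (TensorProduct.map (TensorProduct.map x y ∘ₗ HomOn.comul T T₁ F G) z
        (HomOn.comul T T₁ (mulF F G) H (HomOn.res h₁ b))) =
      TensorProduct.map x (TensorProduct.map y z ∘ₗ HomOn.comul T T₁ G H)
        (HomOn.comul T T₁ F (mulF G H) (HomOn.res h₂ b)) := by
  have e2 : ∀ s, TensorProduct.map x (TensorProduct.map y z ∘ₗ HomOn.comul T T₁ G H) s =
      TensorProduct.map x (TensorProduct.map y z) ((HomOn.comul T T₁ G H).lTensor _ s) :=
    fun s => by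
      rw [LinearMap.lTensor, ← LinearMap.comp_apply, ← TensorProduct.map_comp, LinearMap.comp_id]
  have e3 : ∀ s, TensorProduct.map (TensorProduct.map x y ∘ₗ HomOn.comul T T₁ F G) z s =
      TensorProduct.map (TensorProduct.map x y) z ((HomOn.comul T T₁ F G).rTensor _ s) :=
    fun s => by
      rw [LinearMap.rTensor, ← LinearMap.comp_apply, ← TensorProduct.map_comp, LinearMap.comp_id]
  rw [e2, e3, ← TensorProduct.map_map_assoc, HomOn.comul_assoc h₁ h₂]

lemma map_comm (h₁ : mulF F G ⊆ K) (h₂ : mulF G F ⊆ K) (b : GHom T T₁ K) :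
    TensorProduct.comm ℚ _ _ (TensorProduct.map x y (HomOn.comul T T₁ F G (HomOn.res h₁ b))) =
      TensorProduct.map y x (HomOn.comul T T₁ G F (HomOn.res h₂ b)) := by
  rw [← HomOn.comul_comm h₁ h₂, TensorProduct.map_comm]

/-- This is the counit law `HomOn.comul_unit`. It needs $b$ on a set $K$ containing also the double
products with $\mathbf 1$, since the law rests on associativity there. -/
lemma map_lid (h₀ : F ⊆ K) (h₁ : mulF {unit} F ⊆ K) (h₂ : mulF (mulF {unit} {unit}) F ⊆ K)
    (h₃ : mulF {unit} (mulF {unit} F) ⊆ K) (b : GHom T T₁ K) :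
    TensorProduct.lid ℚ _ (TensorProduct.map (HomOn.scal T T₁) x
      (HomOn.comul T T₁ {unit} F (HomOn.res h₁ b))) = x (HomOn.res h₀ b) := by
  rw [← HomOn.comul_unit h₀ h₁ h₂ h₃ b]
  generalize HomOn.comul T T₁ {unit} F _ = s
  induction s with
  | zero => simp
  | add x y hx hy => simp only [map_add, hx, hy]
  | tmul a b => simp

end EquivMaps
end EquivariantMaps

/-- The value at `X` of the extension of `T` to `C(T₁)`: the space of `End(T₁|_F)`-linear maps
`Hom(T|_F, T₁|_F) → X`, where `F` is the support of `X`. -/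
def Fib (T : GradedRep D) {T₁ : GradedRep D} (X : DiagCat T₁) :
    Submodule ℚ (GHom T T₁ X.supp →ₗ[ℚ] X.carrier) := EquivMaps T X.act

namespace Fib

variable {T T₁ : GradedRep D} {X Y Z X' Y' : DiagCat T₁}

lemma apply_compH (z : Fib T X) (a : GHom T₁ T₁ X.supp) (h : GHom T T₁ X.supp) :
    z.1 (HomOn.compH a h) = X.act a (z.1 h) := z.2 a h

/-- The evaluation `Hom(T|_F, T₁|_F) → Hom(T X, X)`. -/
def out (X : DiagCat T₁) : GHom T T₁ X.supp →ₗ[ℚ] (Fib T X →ₗ[ℚ] X.carrier) :=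
  LinearMap.flip (Fib T X).subtype

/-- The map `Hom(T₁|_F, T|_F) → Hom(X, T X)`. -/
def into (X : DiagCat T₁) : GHom T₁ T X.supp →ₗ[ℚ] (X.carrier →ₗ[ℚ] Fib T X) :=
  LinearMap.mk₂ ℚ (fun k x => ⟨X.act.flip x ∘ₗ HomOn.compH.flip k, fun a h => by
      change X.act (HomOn.comp a (HomOn.compH h k)) x = X.act a (X.act (HomOn.compH h k) x)
      rw [X.act_comp, LinearMap.comp_apply]⟩)
    (fun _ _ _ => Subtype.ext (LinearMap.ext fun h => by simp))
    (fun _ _ _ => Subtype.ext (LinearMap.ext fun h => by simp))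
    (fun _ _ _ => Subtype.ext (LinearMap.ext fun h => by simp))
    (fun _ _ _ => Subtype.ext (LinearMap.ext fun h => by simp))

variable (hL : LocIso T₁.toRepresentation T.toRepresentation)

include hL in
/-- Elements of `T X` are determined by their values on restrictions from a larger subdiagram. -/
lemma ext_res {G : Finset D} (h : X.supp ⊆ G) {z w : Fib T X}
    (hzw : ∀ b : GHom T T₁ G, z.1 (HomOn.res h b) = w.1 (HomOn.res h b)) : z = w := by
  obtain ⟨c, b, hbc, hcb⟩ := hL G
  refine Subtype.ext (LinearMap.ext fun k => ?_)
  -- The restriction of the local isomorphism $b$ generates the left module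
  -- $\mathrm{Hom}(T|_F,T_1|_F)$: $k=(kc)b$. Equivariance then reduces equality at $k$ to equality
  -- at $b$.
  have hk : k = HomOn.compH (HomOn.compH k (HomOn.res h c)) (HomOn.res h b) := by
    rw [HomOn.compH_assoc, ← HomOn.res_compH, hcb, HomOn.res_idH, HomOn.compH_idH]
  rw [hk, apply_compH, apply_compH, hzw]

-- Composition with $f$ makes sense only on a subdiagram $G$ over which $f$ is equivariant, and not
-- every morphism on the support extends to $G$. The generator $b$ does come from $G$, so the image
-- of $z$ can be prescribed by $h\mapsto hc\cdot f(z(b))$, and equivariance of $f$ gives the formula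
-- on all of $G$. Stating it for every $G'\supseteq G$ allows comparison of several morphisms on a
-- common level.
include hL in
lemma exists_map (f : X ⟶ Y) : ∃ g : Fib T X →ₗ[ℚ] Fib T Y,
    ∃ G, X.supp ⊆ G ∧ Y.supp ⊆ G ∧ ∀ G' (_ : G ⊆ G') (hX : X.supp ⊆ G') (hY : Y.supp ⊆ G') z
      (b : GHom T T₁ G'), (g z).1 (HomOn.res hY b) = DiagCat.lin f (z.1 (HomOn.res hX b)) := by
  obtain ⟨G, hX, hY, hf⟩ := f.2
  obtain ⟨c, b, hbc, hcb⟩ := hL G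
  refine ⟨into Y (HomOn.res hY c) ∘ₗ DiagCat.lin f ∘ₗ out X (HomOn.res hX b), G, hX, hY, ?_⟩
  intro G' hG hX' hY' z k
  let k' : GHom T T₁ G := HomOn.res hG k
  change Y.act (HomOn.compH (HomOn.res hY k') (HomOn.res hY c))
    (DiagCat.lin f (z.1 (HomOn.res hX b))) = DiagCat.lin f (z.1 (HomOn.res hX k'))
  have h1 := LinearMap.congr_fun (hf (HomOn.compH k' c)) (z.1 (HomOn.res hX b))
  simp only [LinearMap.comp_apply, HomOn.res_compH] at h1
  refine h1.symm.trans (congrArg (DiagCat.lin f) ?_)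
  rw [← apply_compH, HomOn.compH_assoc, ← HomOn.res_compH, hcb]
  rfl

/-- The extension of `T` to `C(T₁)` on morphisms. -/
def map (f : X ⟶ Y) : Fib T X →ₗ[ℚ] Fib T Y := (exists_map hL f).choose

/-- A finite set of vertices such that `T f` is the composition with `f` on restrictions from
subdiagrams that contain it. -/
def level (f : X ⟶ Y) : Finset D := (exists_map hL f).choose_spec.choose

lemma source_level (f : X ⟶ Y) : X.supp ⊆ level hL f :=
  (exists_map hL f).choose_spec.choose_spec.1

lemma target_level (f : X ⟶ Y) : Y.supp ⊆ level hL f :=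
  (exists_map hL f).choose_spec.choose_spec.2.1

lemma map_res (f : X ⟶ Y) {G : Finset D} (hG : level hL f ⊆ G) (hX : X.supp ⊆ G)
    (hY : Y.supp ⊆ G) (z : Fib T X) (b : GHom T T₁ G) :
    (map hL f z).1 (HomOn.res hY b) = DiagCat.lin f (z.1 (HomOn.res hX b)) :=
  (exists_map hL f).choose_spec.choose_spec.2.2 G hG hX hY z b

lemma map_id (X : DiagCat T₁) : map hL (𝟙 X) = LinearMap.id :=
  LinearMap.ext fun z => ext_res hL (source_level hL (𝟙 X)) fun b =>
    map_res hL (𝟙 X) subset_rfl (source_level hL (𝟙 X)) (source_level hL (𝟙 X)) z b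

open scoped Classical in
lemma map_comp (f : X ⟶ Y) (g : Y ⟶ Z) : map hL (f ≫ g) = map hL g ∘ₗ map hL f := by
  let G := level hL f ∪ (level hL g ∪ level hL (f ≫ g))
  have g1 : level hL f ⊆ G := Finset.subset_union_left
  have g2 : level hL g ⊆ G := Finset.subset_union_left.trans Finset.subset_union_right
  have g3 : level hL (f ≫ g) ⊆ G := Finset.subset_union_right.trans Finset.subset_union_right
  have hX := (source_level hL f).trans g1
  have hY := (target_level hL f).trans g1
  have hZ := (target_level hL g).trans g2
  refine LinearMap.ext fun z => ext_res hL hZ fun b => ?_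
  refine (map_res hL (f ≫ g) g3 hX hZ z b).trans ?_
  refine Eq.trans ?_ (map_res hL g g2 hY hZ (map hL f z) b).symm
  exact congrArg (DiagCat.lin g) (map_res hL f g1 hX hY z b).symm

/-- The extension of `T` to `C(T₁)`. -/
def functor : DiagCat T₁ ⥤ FGModuleCat ℚ where
  obj X := FGModuleCat.of ℚ (Fib T X)
  map f := FGModuleCat.ofHom (map hL f)
  map_id X := by
    apply FGModuleCat.hom_ext
    exact map_id hL X
  map_comp f g := by
    apply FGModuleCat.hom_ext
    exact map_comp hL f g

variable (X Y) in
/-- The tensor structure `T X ⊗ T Y → T (X ⊗ Y)`. -/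
def mulMap : Fib T X ⊗[ℚ] Fib T Y →ₗ[ℚ] Fib T (DiagCat.tensor X Y) := EquivMaps.mul X.act Y.act

lemma out_mulMap (h : GHom T T₁ (mulF X.supp Y.supp)) (t : Fib T X ⊗[ℚ] Fib T Y) :
    out (DiagCat.tensor X Y) h (mulMap X Y t) =
      homT (out X) (out Y) (HomOn.comul T T₁ X.supp Y.supp h) t :=
  EquivMaps.out_mul X.act Y.act h t

variable (T T₁) in
/-- The generator of `T 𝟙`. -/
def oneVec : Fib T (DiagCat.tensorOne T₁) := ⟨HomOn.scal T T₁, fun a h => HomOn.scal_compH a h⟩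

variable (T T₁) in
/-- The unit structure `ℚ → T 𝟙`. -/
def oneMap : ℚ →ₗ[ℚ] Fib T (DiagCat.tensorOne T₁) :=
  LinearMap.toSpanSingleton ℚ _ (oneVec T T₁)

end Fib

variable {D : Type} [ProductDiagram.{v} D]

/-! ### The symmetric tensor structure of the extension and its values on the diagram. -/

namespace Fib

variable {T T₁ : GradedRep D} {X Y Z X' Y' : DiagCat T₁}
variable (hL : LocIso T₁.toRepresentation T.toRepresentation)

-- Only the linear map under `k` matters, so the same statement covers both whiskerings in the
-- monoidal structure of $\mathcal C(T_1)$.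
open scoped Classical in
lemma map_mulMap (f : X ⟶ X') (g : Y ⟶ Y') (k : DiagCat.tensor X Y ⟶ DiagCat.tensor X' Y')
    (hk : DiagCat.lin k = TensorProduct.map (DiagCat.lin f) (DiagCat.lin g))
    (z : Fib T X) (w : Fib T Y) :
    map hL k (mulMap X Y (z ⊗ₜ w)) = mulMap X' Y' (map hL f z ⊗ₜ map hL g w) := by
  let G := mulF (level hL f) (level hL g) ∪ level hL k
  have g1 : mulF (level hL f) (level hL g) ⊆ G := Finset.subset_union_left
  have g3 : level hL k ⊆ G := Finset.subset_union_right
  have h1 := (source_level hL k).trans g3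
  have h2 := (target_level hL k).trans g3
  exact ext_res hL h2 fun b => (map_res hL k g3 h1 h2 _ b).trans <|
    (LinearMap.congr_fun hk _).trans <|
      EquivMaps.map_natural z.1 w.1 (map hL f z).1 (map hL g w).1 _ _ (source_level hL f)
        (target_level hL f) (source_level hL g) (target_level hL g) g1
        (map_res hL f subset_rfl _ _ z) (map_res hL g subset_rfl _ _ w) b

lemma map_assoc (k : DiagCat.tensor (DiagCat.tensor X Y) Z ⟶
      DiagCat.tensor X (DiagCat.tensor Y Z))
    (hk : DiagCat.lin k = (TensorProduct.assoc ℚ X.carrier Y.carrier Z.carrier).toLinearMap)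
    (x : Fib T X) (y : Fib T Y) (z : Fib T Z) :
    map hL k (mulMap _ Z (mulMap X Y (x ⊗ₜ y) ⊗ₜ z)) =
      mulMap X _ (x ⊗ₜ mulMap Y Z (y ⊗ₜ z)) :=
  ext_res hL (target_level hL k) fun b =>
    (map_res hL k subset_rfl (source_level hL k) (target_level hL k) _ b).trans <|
      (LinearMap.congr_fun hk _).trans (EquivMaps.map_assoc x.1 y.1 z.1 _ _ b)

lemma map_comm (k : DiagCat.tensor X Y ⟶ DiagCat.tensor Y X)
    (hk : DiagCat.lin k = (TensorProduct.comm ℚ X.carrier Y.carrier).toLinearMap)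
    (x : Fib T X) (y : Fib T Y) :
    map hL k (mulMap X Y (x ⊗ₜ y)) = mulMap Y X (y ⊗ₜ x) :=
  ext_res hL (target_level hL k) fun b =>
    (map_res hL k subset_rfl (source_level hL k) (target_level hL k) _ b).trans <|
      (LinearMap.congr_fun hk _).trans (EquivMaps.map_comm x.1 y.1 _ _ b)

open scoped Classical in
lemma map_lid (k : DiagCat.tensor (DiagCat.tensorOne T₁) X ⟶ X)
    (hk : DiagCat.lin k = (TensorProduct.lid ℚ X.carrier).toLinearMap) (x : Fib T X) :
    map hL k (mulMap _ X (oneVec T T₁ ⊗ₜ x)) = x := by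
  let K : Finset D := level hL k ∪
    (mulF (mulF {unit} {unit}) X.supp ∪ mulF {unit} (mulF {unit} X.supp))
  have g : level hL k ⊆ K := Finset.subset_union_left
  have h1 := (source_level hL k).trans g
  have h2 := (target_level hL k).trans g
  exact ext_res hL h2 fun b => (map_res hL k g h1 h2 _ b).trans <|
    (LinearMap.congr_fun hk _).trans (EquivMaps.map_lid x.1 h2 h1
      (Finset.subset_union_left.trans Finset.subset_union_right)
      (Finset.subset_union_right.trans Finset.subset_union_right) b)

lemma map_rid (k : DiagCat.tensor X (DiagCat.tensorOne T₁) ⟶ X)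
    (hk : DiagCat.lin k = (TensorProduct.rid ℚ X.carrier).toLinearMap) (x : Fib T X) :
    map hL k (mulMap X _ (x ⊗ₜ oneVec T T₁)) = x := by
  let c : DiagCat.tensor X (DiagCat.tensorOne T₁) ⟶ DiagCat.tensor (DiagCat.tensorOne T₁) X :=
    DiagCat.homMk _ (DiagCat.comm_mem_homs X _)
  let l : DiagCat.tensor (DiagCat.tensorOne T₁) X ⟶ X := DiagCat.homMk _ (DiagCat.lid_mem_homs X)
  -- The right unitor is the left unitor after the exchange of factors, so the right unit law
  -- follows from the left one and from symmetry.
  have hkl : k = c ≫ l := by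
    apply Subtype.ext
    refine hk.trans ?_
    apply TensorProduct.ext'
    intro x y
    change _ = TensorProduct.lid ℚ _ (TensorProduct.comm ℚ _ _ (x ⊗ₜ y))
    simp
  rw [hkl, map_comp, LinearMap.comp_apply, map_comm hL c rfl, map_lid hL l rfl]

end Fib

variable {D : Type} [ProductDiagram.{v} D]

lemma bijective_of_finrank_eq {V W : Type} [AddCommGroup V] [Module ℚ V] [AddCommGroup W]
    [Module ℚ W] [Module.Finite ℚ V] [Module.Finite ℚ W] (f : V →ₗ[ℚ] W)
    (h : Module.finrank ℚ V = Module.finrank ℚ W) (hf : Function.Injective f) :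
    Function.Bijective f :=
  ⟨hf, (LinearMap.injective_iff_surjective_of_finrank_eq_finrank h).mp hf⟩

section HomT

variable {A B V V' W W' U U' : Type}
  [AddCommGroup A] [Module ℚ A] [AddCommGroup B] [Module ℚ B]
  [AddCommGroup V] [Module ℚ V] [AddCommGroup V'] [Module ℚ V'] [AddCommGroup W] [Module ℚ W]
  [AddCommGroup W'] [Module ℚ W'] [AddCommGroup U] [Module ℚ U] [AddCommGroup U'] [Module ℚ U']

lemma homT_map_apply (α : A →ₗ[ℚ] (V →ₗ[ℚ] V')) (β : B →ₗ[ℚ] (W →ₗ[ℚ] W'))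
    (α' : A →ₗ[ℚ] (U →ₗ[ℚ] V')) (β' : B →ₗ[ℚ] (U' →ₗ[ℚ] W')) (i : U →ₗ[ℚ] V) (j : U' →ₗ[ℚ] W)
    (hα : ∀ a x, α a (i x) = α' a x) (hβ : ∀ b x, β b (j x) = β' b x) (s : A ⊗[ℚ] B)
    (w : U ⊗[ℚ] U') : homT α β s (TensorProduct.map i j w) = homT α' β' s w := by
  induction s with
  | zero => simp
  | add x y hx hy => simp only [map_add, LinearMap.add_apply, hx, hy]
  | tmul a b =>
    induction w with
    | zero => simp
    | add x y hx hy => simp only [map_add, hx, hy]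
    | tmul x y => simp [hα, hβ]

variable {T T' : GradedRep D} {F G : Finset D}

/-- Since $\mu^*$ is multiplicative, $\mu^*(c)\mu^*(b)=\mu^*(cb)=1\otimes1$, and unitality of
$\alpha''$ and $\beta''$ makes the right-hand side the identity. This inverts the tensor structure
in one direction. -/
lemma homT_comul_comul (α : GHom T T' F →ₗ[ℚ] (V →ₗ[ℚ] V')) (β : GHom T T' G →ₗ[ℚ] (W →ₗ[ℚ] W'))
    (α' : GHom T' T F →ₗ[ℚ] (V' →ₗ[ℚ] V)) (β' : GHom T' T G →ₗ[ℚ] (W' →ₗ[ℚ] W))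
    (α'' : GHom T' T' F →ₗ[ℚ] (V' →ₗ[ℚ] V')) (β'' : GHom T' T' G →ₗ[ℚ] (W' →ₗ[ℚ] W'))
    (hα : ∀ k h, α'' (HomOn.compH k h) = α k ∘ₗ α' h)
    (hβ : ∀ k h, β'' (HomOn.compH k h) = β k ∘ₗ β' h)
    (hα₁ : α'' (HomOn.idH _ F) = LinearMap.id) (hβ₁ : β'' (HomOn.idH _ G) = LinearMap.id)
    {c : GHom T T' (mulF F G)} {b : GHom T' T (mulF F G)}
    (hcb : HomOn.compH c b = HomOn.idH T'.toRepresentation _) (t : V' ⊗[ℚ] W') :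
    homT α β (HomOn.comul T T' F G c) (homT α' β' (HomOn.comul T' T F G b) t) = t := by
  have e := LinearMap.congr_fun (homT_map₂ α β α' β' α'' β'' HomOn.compH HomOn.compH hα hβ
    (HomOn.comul T T' F G c) (HomOn.comul T' T F G b)) t
  rw [← HomOn.comul_compH, hcb, HomOn.comul_idH, homT_tmul, hα₁, hβ₁, TensorProduct.map_id] at e
  exact e.symm

end HomT

namespace Fib

variable {T T₁ : GradedRep D} {X Y Z X' Y' : DiagCat T₁}

/-- The action of `End(T|_F)` on `T X`. -/
def ract (X : DiagCat T₁) : GHom T T X.supp →ₗ[ℚ] (Fib T X →ₗ[ℚ] Fib T X) :=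
  LinearMap.mk₂ ℚ (fun e z => ⟨z.1 ∘ₗ HomOn.compH.flip e, fun a h => z.2 a (HomOn.compH h e)⟩)
    (fun _ _ z => Subtype.ext (LinearMap.ext fun h => by simp))
    (fun _ _ z => Subtype.ext (LinearMap.ext fun h => by simp))
    (fun _ _ _ => Subtype.ext (LinearMap.ext fun h => by simp))
    (fun _ _ _ => Subtype.ext (LinearMap.ext fun h => by simp))

lemma ract_idH (X : DiagCat T₁) : ract X (HomOn.idH T.toRepresentation X.supp) = LinearMap.id :=
  rfl

/-- Equivariance gives $z(gkh)=(gk)\cdot z(h)$, so right multiplication by an endomorphism that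
factors through $T_1$ depends on the one value $z(h)$ only. -/
lemma ract_compH (X : DiagCat T₁) (k : GHom T₁ T X.supp) (h : GHom T T₁ X.supp) :
    ract X (HomOn.compH k h) = into X k ∘ₗ out X h :=
  LinearMap.ext fun z => Subtype.ext (LinearMap.ext fun g => z.2 (HomOn.compH g k) h)

lemma out_into (k : GHom T₁ T X.supp) (h : GHom T T₁ X.supp) :
    out X h ∘ₗ into X k = X.act (HomOn.compH h k) := rfl

variable (hL : LocIso T₁.toRepresentation T.toRepresentation)

-- An equivariant map is determined by its value on the generator $b$ of a free module of rank one,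
-- and that value is arbitrary. The identification depends on $b$; only the equality of dimensions
-- is retained from it.
include hL in
lemma exists_equiv (X : DiagCat T₁) : Nonempty (Fib T X ≃ₗ[ℚ] X.carrier) := by
  obtain ⟨c, b, hbc, hcb⟩ := hL X.supp
  refine ⟨LinearEquiv.ofLinearMap (out X b) (into X c) ?_ ?_⟩
  · rw [out_into, hbc]
    exact X.act_one
  · rw [← ract_compH, hcb, ract_idH]

include hL in
lemma finrank_eq (X : DiagCat T₁) : Module.finrank ℚ (Fib T X) = Module.finrank ℚ X.carrier :=
  (exists_equiv hL X).some.finrank_eq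

lemma mulMap_leftInverse {c : GHom T₁ T (mulF X.supp Y.supp)} {b : GHom T T₁ (mulF X.supp Y.supp)}
    (hcb : HomOn.compH c b = HomOn.idH T.toRepresentation _) (t : Fib T X ⊗[ℚ] Fib T Y) :
    homT (into X) (into Y) (HomOn.comul T₁ T X.supp Y.supp c)
      (out (DiagCat.tensor X Y) b (mulMap X Y t)) = t :=
  (congrArg (homT (into X) (into Y) (HomOn.comul T₁ T X.supp Y.supp c)) (out_mulMap b t)).trans
    (homT_comul_comul (into X) (into Y) (out X) (out Y) (ract X) (ract Y) (ract_compH X)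
      (ract_compH Y) rfl rfl hcb t)

include hL in
lemma mulMap_injective (X Y : DiagCat T₁) : Function.Injective (mulMap (T := T) X Y) :=
  let ⟨c, b, _, hcb⟩ := hL (mulF X.supp Y.supp)
  Function.LeftInverse.injective (g := fun t => homT (into X) (into Y)
    (HomOn.comul T₁ T X.supp Y.supp c) (out (DiagCat.tensor X Y) b t)) (mulMap_leftInverse hcb)

include hL in
lemma finrank_tensor (X Y : DiagCat T₁) : Module.finrank ℚ (Fib T X ⊗[ℚ] Fib T Y) =
    Module.finrank ℚ (Fib T (DiagCat.tensor X Y)) := by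
  rw [Module.finrank_tensorProduct, finrank_eq hL, finrank_eq hL, finrank_eq hL]
  exact (Module.finrank_tensorProduct (R := ℚ) (S := ℚ) (M := X.carrier) (M' := Y.carrier)).symm

include hL in
lemma mulMap_bijective (X Y : DiagCat T₁) : Function.Bijective (mulMap (T := T) X Y) := by
  have h := bijective_of_finrank_eq (V := Fib T X ⊗[ℚ] Fib T Y) (W := Fib T (DiagCat.tensor X Y))
    (mulMap X Y) (finrank_tensor hL X Y) (mulMap_injective hL X Y)
  exact h

lemma oneMap_apply (c : ℚ) : oneMap T T₁ c = c • oneVec T T₁ := rfl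

include hL in
lemma oneMap_bijective : Function.Bijective (oneMap T T₁) := by
  have hinj : Function.Injective (oneMap T T₁) := by
    obtain ⟨c, b, hbc, hcb⟩ := hL {unit}
    -- The scalars of $b$ and of its inverse $c$ multiply to $1$, so evaluation at $b$ separates
    -- multiples of `oneVec`.
    have hb : HomOn.scal T T₁ b ≠ 0 := by
      intro h0
      have e := HomOn.scal_compH c b
      rw [hcb, h0, mul_zero, HomOn.scal_apply, HomOn.ev_idH, LinearMap.id_apply,
        unitCo_unitVec] at e
      exact one_ne_zero e
    intro x y hxy
    have h2 : x * HomOn.scal T T₁ b = y * HomOn.scal T T₁ b :=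
      congrArg (fun z => out (DiagCat.tensorOne T₁) b z) hxy
    exact mul_right_cancel₀ hb h2
  have hfr : Module.finrank ℚ ℚ = Module.finrank ℚ (Fib T (DiagCat.tensorOne T₁)) :=
    (finrank_eq hL (DiagCat.tensorOne T₁)).symm
  exact bijective_of_finrank_eq _ hfr hinj

lemma map_lid_oneMap (k : DiagCat.tensor (DiagCat.tensorOne T₁) X ⟶ X)
    (hk : DiagCat.lin k = (TensorProduct.lid ℚ X.carrier).toLinearMap) (c : ℚ) (x : Fib T X) :
    map hL k (mulMap _ X (oneMap T T₁ c ⊗ₜ x)) = c • x := by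
  rw [oneMap_apply, ← TensorProduct.smul_tmul', map_smul, map_smul, map_lid hL k hk]

lemma map_rid_oneMap (k : DiagCat.tensor X (DiagCat.tensorOne T₁) ⟶ X)
    (hk : DiagCat.lin k = (TensorProduct.rid ℚ X.carrier).toLinearMap) (c : ℚ) (x : Fib T X) :
    map hL k (mulMap X _ (x ⊗ₜ oneMap T T₁ c)) = c • x := by
  rw [oneMap_apply, TensorProduct.tmul_smul, map_smul, map_smul, map_rid hL k hk]

instance laxMonoidal : (functor hL).LaxMonoidal where
  ε := FGModuleCat.ofHom (oneMap T T₁)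
  μ X Y := FGModuleCat.ofHom (mulMap X Y)
  μ_natural_left f Y := by
    apply FGModuleCat.hom_ext
    apply TensorProduct.ext'
    intro x y
    refine Eq.trans ?_ (map_mulMap hL f (𝟙 Y) (f ▷ Y) rfl x y).symm
    rw [map_id]
    rfl
  μ_natural_right X f := by
    apply FGModuleCat.hom_ext
    apply TensorProduct.ext'
    intro x y
    refine Eq.trans ?_ (map_mulMap hL (𝟙 X) f (X ◁ f) rfl x y).symm
    rw [map_id]
    rfl
  associativity X Y Z := by
    apply FGModuleCat.hom_ext
    apply TensorProduct.ext_threefold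
    intro x y z
    exact map_assoc hL (α_ X Y Z).hom rfl x y z
  left_unitality X := by
    apply FGModuleCat.hom_ext
    apply TensorProduct.ext'
    intro c x
    exact (map_lid_oneMap hL (λ_ X).hom rfl c x).symm
  right_unitality X := by
    apply FGModuleCat.hom_ext
    apply TensorProduct.ext'
    intro x c
    exact (map_rid_oneMap hL (ρ_ X).hom rfl c x).symm

lemma isIso_ofHom {V W : Type} [AddCommGroup V] [Module ℚ V] [Module.Finite ℚ V] [AddCommGroup W]
    [Module ℚ W] [Module.Finite ℚ W] (f : V →ₗ[ℚ] W) (hf : Function.Bijective f) :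
    IsIso (FGModuleCat.ofHom f) :=
  (LinearEquiv.toFGModuleCatIso (LinearEquiv.ofBijective f hf)).isIso_hom

instance : IsIso (Functor.LaxMonoidal.ε (functor hL)) := isIso_ofHom _ (oneMap_bijective hL)

instance (X Y : DiagCat T₁) : IsIso (Functor.LaxMonoidal.μ (functor hL) X Y) :=
  isIso_ofHom _ (mulMap_bijective hL X Y)

instance monoidal : (functor hL).Monoidal := .ofLaxMonoidal _

instance braided : (functor hL).Braided where
  braided X Y := by
    apply FGModuleCat.hom_ext
    apply TensorProduct.ext'
    intro x y
    exact map_comm hL (β_ X Y).hom rfl x y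

/-- The map `T p → T (T̃₁ p)`. -/
def isoMap (p : D) : T.obj p →ₗ[ℚ] Fib T (DiagCat.tilde T₁ p) :=
  LinearMap.codRestrict (Fib T (DiagCat.tilde T₁ p))
    (LinearMap.flip (HomOn.ev p (Finset.mem_singleton_self p))) (fun _ _ _ => rfl)

-- The component of $b$ at $p$ is invertible and factors through `isoMap`, which is therefore
-- injective; dimensions agree by the same local isomorphism.
include hL in
lemma isoMap_bijective (p : D) : Function.Bijective (isoMap (T := T) (T₁ := T₁) p) := by
  obtain ⟨c, b, hbc, hcb⟩ := hL {p}
  have hp := Finset.mem_singleton_self p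
  have e1 : HomOn.ev p hp b ∘ₗ HomOn.ev p hp c = LinearMap.id := by
    rw [← HomOn.ev_compH, hbc]; rfl
  have e2 : HomOn.ev p hp c ∘ₗ HomOn.ev p hp b = LinearMap.id := by
    rw [← HomOn.ev_compH, hcb]; rfl
  have hinj : Function.Injective (isoMap (T := T) (T₁ := T₁) p) := by
    intro x y hxy
    have h2 : HomOn.ev p hp b x = HomOn.ev p hp b y :=
      congrArg (fun z => out (DiagCat.tilde T₁ p) b z) hxy
    have h3 := congrArg (HomOn.ev p hp c) h2
    rwa [← LinearMap.comp_apply, ← LinearMap.comp_apply, e2] at h3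
  have hfr : Module.finrank ℚ (T.obj p) = Module.finrank ℚ (Fib T (DiagCat.tilde T₁ p)) :=
    (LinearEquiv.ofLinearMap _ _ e1 e2).finrank_eq.trans (finrank_eq hL (DiagCat.tilde T₁ p)).symm
  exact bijective_of_finrank_eq _ hfr hinj

/-- Evaluated at a morphism of representations $b$, the claim is the naturality of $b$ along the
edge `m`. -/
lemma isoMap_map {p q : D} (m : p ⟶ q) (x : T.obj p) :
    isoMap (T₁ := T₁) q (T.map m x) = map hL (DiagCat.tildeMap m) (isoMap p x) := by
  refine ext_res hL (target_level hL (DiagCat.tildeMap m)) fun b => ?_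
  refine Eq.trans ?_ (map_res hL (DiagCat.tildeMap m) subset_rfl (source_level hL _)
    (target_level hL _) (isoMap p x) b).symm
  exact LinearMap.congr_fun (HomOn.ev_naturality b
    (source_level hL (DiagCat.tildeMap m) (Finset.mem_singleton_self p))
    (target_level hL (DiagCat.tildeMap m) (Finset.mem_singleton_self q)) m) x

lemma homT_out_isoMap (f g : D) (s : GHom T T₁ {f} ⊗[ℚ] GHom T T₁ {g})
    (w : T.obj f ⊗[ℚ] T.obj g) :
    homT (out (DiagCat.tilde T₁ f)) (out (DiagCat.tilde T₁ g)) s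
      (TensorProduct.map (isoMap f) (isoMap g) w) =
    HomOn.ev₂ f g (Finset.mem_singleton_self f) (Finset.mem_singleton_self g) s w :=
  homT_map_apply _ _ (HomOn.ev f (Finset.mem_singleton_self f))
    (HomOn.ev g (Finset.mem_singleton_self g)) _ _ (fun _ _ => rfl) (fun _ _ => rfl) s w

/-- Evaluated at $b$, this is the defining property of $\mu^*$: its $(f,g)$-component is $b_{f\times
g}$ conjugated by the two maps $\tau$. -/
lemma isoMap_τ (f g : D) (x : T.obj (mul f g)) :
    map hL (DiagCat.tildeτ T₁ f g).hom (isoMap (mul f g) x) =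
      mulMap _ _ (TensorProduct.map (isoMap f) (isoMap g) (T.τ f g x)) := by
  let k := (DiagCat.tildeτ T₁ f g).hom
  refine ext_res hL (target_level hL k) fun b => ?_
  refine (map_res hL k subset_rfl (source_level hL k) (target_level hL k) _ b).trans ?_
  refine Eq.trans ?_ (out_mulMap _ _).symm
  refine Eq.trans ?_ (homT_out_isoMap f g _ _).symm
  have e := HomOn.ev₂_comul (T := T) (T' := T₁)
    (HomOn.res (target_level hL k : mulF {f} {g} ⊆ level hL k) b) f g
    (Finset.mem_singleton_self f) (Finset.mem_singleton_self g)
  refine Eq.trans ?_ (LinearMap.congr_fun e _).symm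
  rw [conjτ_apply, LinearMap.comp_apply, LinearMap.comp_apply, LinearEquiv.coe_coe,
    LinearEquiv.coe_coe, LinearEquiv.symm_apply_apply]
  rfl

/-- The extension of `T` along `T̃₁`. -/
def extension : TensorExtension T₁ T where
  functor := functor hL
  braided := braided hL
  iso p := LinearEquiv.ofBijective (isoMap p) (isoMap_bijective hL p)
  iso_map m := LinearMap.ext fun x => isoMap_map hL m x
  iso_τ f g := LinearMap.ext fun x => isoMap_τ hL f g x

end Fib

/-! ### Common axioms for the forgetful functor and the extension, and the action of local morphisms
on fibres. -/

variable {D : Type} [ProductDiagram.{v} D]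

/-- An extension of `T` to `C(T₁)` together with compatible pairings of its values with
`Hom(T|_F, T₁|_F)` and `Hom(T₁|_F, T|_F)`. -/
structure FibreData {T₁ T : GradedRep D} (E : TensorExtension T₁ T) where
  locIso : LocIso T₁.toRepresentation T.toRepresentation
  out : ∀ X : DiagCat T₁, GHom T T₁ X.supp →ₗ[ℚ] (E.functor.obj X →ₗ[ℚ] X.carrier)
  into : ∀ X : DiagCat T₁, GHom T₁ T X.supp →ₗ[ℚ] (X.carrier →ₗ[ℚ] E.functor.obj X)
  out_compH : ∀ (X : DiagCat T₁) (a : GHom T₁ T₁ X.supp) (h : GHom T T₁ X.supp)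
    (z : E.functor.obj X), out X (HomOn.compH a h) z = X.act a (out X h z)
  out_into : ∀ (X : DiagCat T₁) (h : GHom T T₁ X.supp) (k : GHom T₁ T X.supp) (x : X.carrier),
    out X h (into X k x) = X.act (HomOn.compH h k) x
  ext : ∀ (X : DiagCat T₁) (z : E.functor.obj X), (∀ h, out X h z = 0) → z = 0
  level : ∀ {X Y : DiagCat T₁}, (X ⟶ Y) → Finset D
  source_level : ∀ {X Y : DiagCat T₁} (f : X ⟶ Y), X.supp ⊆ level f
  target_level : ∀ {X Y : DiagCat T₁} (f : X ⟶ Y), Y.supp ⊆ level f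
  out_map : ∀ {X Y : DiagCat T₁} (f : X ⟶ Y) {G : Finset D} (_ : level f ⊆ G)
    (hX : X.supp ⊆ G) (hY : Y.supp ⊆ G) (z : E.functor.obj X) (h : GHom T T₁ G),
    out Y (HomOn.res hY h) (mapLin E.functor f z) = DiagCat.lin f (out X (HomOn.res hX h) z)
  out_tensor : ∀ (X Y : DiagCat T₁) (h : GHom T T₁ (mulF X.supp Y.supp))
    (t : E.functor.obj X ⊗[ℚ] E.functor.obj Y),
    out (DiagCat.tensor X Y) h (tensorLin E.functor X Y t) =
      homT (out X) (out Y) (HomOn.comul T T₁ X.supp Y.supp h) t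
  out_unit : ∀ h : GHom T T₁ {unit},
    out (DiagCat.tensorOne T₁) h (unitLin E.functor 1) = HomOn.scal T T₁ h
  out_iso : ∀ (p : D) (h : GHom T T₁ {p}) (x : T.obj p),
    out (DiagCat.tilde T₁ p) h (E.iso p x) = HomOn.ev p (Finset.mem_singleton_self p) h x

/-- The pairings of the extension constructed from local isomorphisms. -/
def Fib.fibreData {T T₁ : GradedRep D} (hL : LocIso T₁.toRepresentation T.toRepresentation) :
    FibreData (Fib.extension hL) where
  locIso := hL
  out X := Fib.out X
  into X := Fib.into X
  out_compH _ a h z := z.2 a h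
  out_into _ _ _ _ := rfl
  ext _ _ h := Subtype.ext (LinearMap.ext h)
  level f := Fib.level hL f
  source_level f := Fib.source_level hL f
  target_level f := Fib.target_level hL f
  out_map f _ hG hX hY z h := Fib.map_res hL f hG hX hY z h
  out_tensor _ _ h t := Fib.out_mulMap h t
  out_unit h := one_smul ℚ (HomOn.scal T T₁ h)
  out_iso _ _ _ := rfl

/-- The pairings of the forgetful functor of `C(T₁)`. -/
def selfFibreData (T₁ : GradedRep D) : FibreData (TensorExtension.self T₁) where
  locIso := LocIso.refl _
  out X := X.act
  into X := X.act
  out_compH X a h z := LinearMap.congr_fun (X.act_comp a h) z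
  out_into X h k x := (LinearMap.congr_fun (X.act_comp h k) x).symm
  ext X z h := (LinearMap.congr_fun X.act_one z).symm.trans (h _)
  level f := f.2.choose
  source_level f := f.2.choose_spec.choose
  target_level f := f.2.choose_spec.choose_spec.choose
  out_map f G hG hX hY z h :=
    (LinearMap.congr_fun (f.2.choose_spec.choose_spec.choose_spec (HomOn.res hG h)) z).symm
  out_tensor _ _ _ _ := rfl
  out_unit h := by
    change HomOn.scal T₁ T₁ h * 1 = _
    exact mul_one _
  out_iso _ _ _ := rfl

namespace FibreData

variable {T₁ T T' : GradedRep D} {E : TensorExtension T₁ T} {E' : TensorExtension T₁ T'}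
  (A : FibreData E) (A' : FibreData E')

include A in
lemma ext_res {X : DiagCat T₁} {G : Finset D} (h : X.supp ⊆ G) {z w : E.functor.obj X}
    (hzw : ∀ b : GHom T T₁ G, A.out X (HomOn.res h b) z = A.out X (HomOn.res h b) w) : z = w := by
  obtain ⟨c, b, hbc, hcb⟩ := A.locIso G
  refine sub_eq_zero.mp (A.ext X _ fun k => ?_)
  have hk : k = HomOn.compH (HomOn.compH k (HomOn.res h c)) (HomOn.res h b) := by
    rw [HomOn.compH_assoc, ← HomOn.res_compH, hcb, HomOn.res_idH, HomOn.compH_idH]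
  rw [hk, map_sub, A.out_compH, A.out_compH, hzw, sub_self]

lemma ext_out {X : DiagCat T₁} {z w : E.functor.obj X}
    (hzw : ∀ b : GHom T T₁ X.supp, A.out X b z = A.out X b w) : z = w :=
  A.ext_res subset_rfl hzw

lemma into_out {X : DiagCat T₁} {c : GHom T₁ T X.supp} {b : GHom T T₁ X.supp}
    (hcb : HomOn.compH c b = HomOn.idH T.toRepresentation X.supp) (z : E.functor.obj X) :
    A.into X c (A.out X b z) = z :=
  A.ext_out fun h => by
    rw [A.out_into, ← A.out_compH, HomOn.compH_assoc, hcb, HomOn.compH_idH]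

lemma out_into_self {X : DiagCat T₁} {c : GHom T₁ T X.supp} {b : GHom T T₁ X.supp}
    (hbc : HomOn.compH b c = HomOn.idH T₁.toRepresentation X.supp) (x : X.carrier) :
    A.out X b (A.into X c x) = x := by
  rw [A.out_into, hbc]
  exact LinearMap.congr_fun X.act_one x

include A in
lemma finrank_eq (X : DiagCat T₁) :
    Module.finrank ℚ (E.functor.obj X) = Module.finrank ℚ X.carrier := by
  obtain ⟨c, b, hbc, hcb⟩ := A.locIso X.supp
  exact (LinearEquiv.ofLinearMap (A.out X b) (A.into X c)
    (LinearMap.ext (A.out_into_self hbc)) (LinearMap.ext (A.into_out hcb))).finrank_eq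

-- The chosen level of `f` may be larger than a given $G$ on which `f` is already equivariant. Each
-- $h$ on $G$ is a left multiple of the restriction of a local isomorphism from the union of both
-- sets. The formula holds for that generator, and both sides are equivariant over
-- $\mathrm{End}(T_1|_G)$.
open scoped Classical in
lemma out_map_of {X Y : DiagCat T₁} (f : X ⟶ Y) {G : Finset D} (hX : X.supp ⊆ G)
    (hY : Y.supp ⊆ G) (hf : ∀ a : GHom T₁ T₁ G, DiagCat.lin f ∘ₗ X.act (HomOn.res hX a) =
      Y.act (HomOn.res hY a) ∘ₗ DiagCat.lin f) (z : E.functor.obj X) (h : GHom T T₁ G) :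
    A.out Y (HomOn.res hY h) (mapLin E.functor f z) =
      DiagCat.lin f (A.out X (HomOn.res hX h) z) := by
  have g : G ⊆ G ∪ A.level f := Finset.subset_union_left
  obtain ⟨c, b, -, hcb⟩ := A.locIso (G ∪ A.level f)
  obtain ⟨a, ha⟩ : ∃ a : GHom T₁ T₁ G, h = HomOn.compH a (HomOn.res g b) :=
    ⟨HomOn.compH h (HomOn.res g c), by
      rw [HomOn.compH_assoc, ← HomOn.res_compH, hcb, HomOn.res_idH, HomOn.compH_idH]⟩
  have e := A.out_map f Finset.subset_union_right (hX.trans g) (hY.trans g) z b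
  rw [ha, HomOn.res_compH, HomOn.res_compH, A.out_compH, A.out_compH, HomOn.res_res,
    HomOn.res_res, e]
  exact (LinearMap.congr_fun (hf _) _).symm

lemma map_into {X Y : DiagCat T₁} (f : X ⟶ Y) {G : Finset D} (hX : X.supp ⊆ G)
    (hY : Y.supp ⊆ G) (hf : ∀ a : GHom T₁ T₁ G, DiagCat.lin f ∘ₗ X.act (HomOn.res hX a) =
      Y.act (HomOn.res hY a) ∘ₗ DiagCat.lin f) (k : GHom T₁ T G) (x : X.carrier) :
    mapLin E.functor f (A.into X (HomOn.res hX k) x) =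
      A.into Y (HomOn.res hY k) (DiagCat.lin f x) :=
  A.ext_res hY fun b => by
    rw [A.out_map_of f hX hY hf, A.out_into, A.out_into, ← HomOn.res_compH, ← HomOn.res_compH]
    exact LinearMap.congr_fun (hf _) x

/-- The action `Hom(T|_F, T'|_F) → Hom(E X, E' X)`, where `F` is the support of `X`. -/
def act (X : DiagCat T₁) : GHom T T' X.supp →ₗ[ℚ] (E.functor.obj X →ₗ[ℚ] E'.functor.obj X) :=
  LinearMap.lcomp ℚ _ (A.out X (A.locIso X.supp).choose_spec.choose) ∘ₗ A'.into X ∘ₗ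
    HomOn.compH.flip (A.locIso X.supp).choose

/-- The choice of local isomorphism in `act` cancels: $kh=(khc)b$, and equivariance moves $khc$ out.
As the pairings `A'.out` separate elements, this formula characterises `act`, and its other
properties are derived from it. -/
lemma out_act (X : DiagCat T₁) (k : GHom T' T₁ X.supp) (h : GHom T T' X.supp)
    (z : E.functor.obj X) : A'.out X k (A.act A' X h z) = A.out X (HomOn.compH k h) z := by
  have hcb := (A.locIso X.supp).choose_spec.choose_spec.2
  change A'.out X k (A'.into X (HomOn.compH h (A.locIso X.supp).choose)
    (A.out X (A.locIso X.supp).choose_spec.choose z)) = _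
  rw [A'.out_into, ← A.out_compH, HomOn.compH_assoc, HomOn.compH_assoc, hcb, HomOn.compH_idH]

-- On a set containing the levels of `f` for both functors, pairing with any $b$ turns both sides
-- into `f` applied to the pairing of $z$ with $bh$.
open scoped Classical in
lemma exists_act_map {X Y : DiagCat T₁} (f : X ⟶ Y) :
    ∃ (G : Finset D) (hX : X.supp ⊆ G) (hY : Y.supp ⊆ G), ∀ (h : GHom T T' G) z,
      mapLin E'.functor f (A.act A' X (HomOn.res hX h) z) =
        A.act A' Y (HomOn.res hY h) (mapLin E.functor f z) := by
  have g := Finset.subset_union_left (s₁ := A.level f) (s₂ := A'.level f)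
  have g' := Finset.subset_union_right (s₁ := A.level f) (s₂ := A'.level f)
  have hX := (A.source_level f).trans g
  have hY := (A.target_level f).trans g
  refine ⟨A.level f ∪ A'.level f, hX, hY, fun h z => A'.ext_res hY fun b => ?_⟩
  rw [A'.out_map f g' hX hY, out_act, out_act, ← HomOn.res_compH, ← HomOn.res_compH,
    A.out_map f g hX hY]

/-- Paired with $b$, the two sides are $\mu^*(bh)$ and $\mu^*(b)\mu^*(h)$ applied to $t$. -/
lemma act_tensor (X Y : DiagCat T₁) (h : GHom T T' (mulF X.supp Y.supp))
    (t : E.functor.obj X ⊗[ℚ] E.functor.obj Y) :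
    A.act A' (DiagCat.tensor X Y) h (tensorLin E.functor X Y t) =
      tensorLin E'.functor X Y
        (homT (A.act A' X) (A.act A' Y) (HomOn.comul T T' X.supp Y.supp h) t) := by
  refine A'.ext_out (X := DiagCat.tensor X Y) fun b => ?_
  refine (A.out_act A' (DiagCat.tensor X Y) b h _).trans ?_
  refine (A.out_tensor X Y _ t).trans ?_
  refine Eq.trans ?_ (A'.out_tensor X Y b _).symm
  have e := HomOn.comul_compH (F := X.supp) (G := Y.supp) b h
  have e2 := homT_map₂ (A'.out X) (A'.out Y) (A.act A' X) (A.act A' Y) (A.out X) (A.out Y)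
    HomOn.compH HomOn.compH (fun k h => LinearMap.ext fun z => (A.out_act A' X k h z).symm)
    (fun k h => LinearMap.ext fun z => (A.out_act A' Y k h z).symm)
    (HomOn.comul T' T₁ X.supp Y.supp b) (HomOn.comul T T' X.supp Y.supp h)
  refine Eq.trans ?_ (LinearMap.congr_fun e2 t)
  exact congrArg (fun s => homT (A.out X) (A.out Y) s t) e

lemma act_unit (h : GHom T T' {unit}) :
    A.act A' (DiagCat.tensorOne T₁) h (unitLin E.functor 1) =
      HomOn.scal T T' h • unitLin E'.functor 1 := by
  refine A'.ext_out (X := DiagCat.tensorOne T₁) fun b => ?_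
  refine (A.out_act A' (DiagCat.tensorOne T₁) b h _).trans ?_
  refine (A.out_unit _).trans ?_
  refine Eq.trans ?_ (map_smul (A'.out (DiagCat.tensorOne T₁) b) _ _).symm
  refine (HomOn.scal_compH b h).trans ?_
  rw [mul_comm]
  exact congrArg (HomOn.scal T T' h * ·) (A'.out_unit b).symm

lemma act_iso (p : D) (h : GHom T T' {p}) (x : T.obj p) :
    A.act A' (DiagCat.tilde T₁ p) h (E.iso p x) =
      E'.iso p (HomOn.ev p (Finset.mem_singleton_self p) h x) := by
  refine A'.ext_out (X := DiagCat.tilde T₁ p) fun b => ?_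
  refine (A.out_act A' (DiagCat.tilde T₁ p) b h _).trans ?_
  refine (A.out_iso p _ x).trans ?_
  exact (A'.out_iso p b _).symm

end FibreData

/-! ### Linearity, exactness and faithfulness. -/

section Exact

/-- An additive functor from an abelian category to finite-dimensional vector spaces is exact as
soon as it preserves exactness in the middle, where exactness in the source is expressed by
refinements. -/
lemma preservesFinite_of_exact {C : Type u} [Category.{w} C] [P : Preadditive C]
    (hC : ∃ A : Abelian C, A.toPreadditive = P) (ω : C ⥤ FGModuleCat.{0} ℚ) (hω : ω.Additive)
    (h : ∀ {X Y Z : C} (f : X ⟶ Y) (g : Y ⟶ Z),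
      (∀ {K : C} (k : K ⟶ Y), k ≫ g = 0 → ∃ (L : C) (π : L ⟶ K) (_ : Epi π) (x : L ⟶ X),
        π ≫ k = x ≫ f) → ∀ z, mapLin ω g z = 0 → ∃ y, mapLin ω f y = z) :
    Limits.PreservesFiniteLimits ω ∧ Limits.PreservesFiniteColimits ω := by
  -- Only the existence of an abelian structure over the given additive one is known; its kernels
  -- and cokernels have no explicit description. Refinements express exactness without them.
  obtain ⟨A, rfl⟩ := hC
  refine ((Functor.exact_tfae ω).out 1 3).mp fun S hS => ?_
  -- In the target, exactness is tested on elements after passing to all vector spaces.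
  rw [← ShortComplex.exact_map_iff_of_faithful _ (forget₂ (FGModuleCat ℚ) (ModuleCat ℚ)),
    ShortComplex.moduleCat_exact_iff]
  intro z hz
  refine h S.f S.g (fun k hk => ?_) z hz
  obtain ⟨L, π, hπ, x, hx⟩ := hS.exact_up_to_refinements k hk
  exact ⟨L, π, hπ, x, hx⟩

end Exact

variable {D : Type} [ProductDiagram.{v} D]

namespace DiagCat

variable {T : GradedRep D}

/-- The subobject of `X` on a subspace that is stable under `End(T|_G)`. -/
def sub (X : DiagCat T) {G : Finset D} (hX : X.supp ⊆ G) (U : Submodule ℚ X.carrier)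
    (hU : ∀ (a : GHom T T G), ∀ x ∈ U, X.act (HomOn.res hX a) x ∈ U) : DiagCat T where
  supp := G
  carrier := U
  act :=
    { toFun := fun a => (X.act (HomOn.res hX a)).restrict (hU a)
      map_add' := fun a b => LinearMap.ext fun x => Subtype.ext (by simp)
      map_smul' := fun a b => LinearMap.ext fun x => Subtype.ext (by simp) }
  act_one := LinearMap.ext fun x => Subtype.ext (LinearMap.congr_fun X.act_one x.1)
  act_comp a b := LinearMap.ext fun x => Subtype.ext
    (LinearMap.congr_fun (X.act_comp (HomOn.res hX a) (HomOn.res hX b)) x.1)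

/-- The quotient of `X` by a subspace that is stable under `End(T|_G)`. -/
def quot (X : DiagCat T) {G : Finset D} (hX : X.supp ⊆ G) (U : Submodule ℚ X.carrier)
    (hU : ∀ (a : GHom T T G), U ≤ U.comap (X.act (HomOn.res hX a))) : DiagCat T where
  supp := G
  carrier := X.carrier ⧸ U
  act :=
    { toFun := fun a => U.mapQ U (X.act (HomOn.res hX a)) (hU a)
      map_add' := fun a b => Submodule.linearMap_qext _ (LinearMap.ext fun x => by simp)
      map_smul' := fun a b => Submodule.linearMap_qext _ (LinearMap.ext fun x => by simp) }
  act_one := Submodule.linearMap_qext _ (LinearMap.ext fun x =>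
    congrArg U.mkQ (LinearMap.congr_fun X.act_one x))
  act_comp a b := Submodule.linearMap_qext _ (LinearMap.ext fun x =>
    congrArg U.mkQ (LinearMap.congr_fun (X.act_comp (HomOn.res hX a) (HomOn.res hX b)) x))

/-- The image is stable under $\mathrm{End}(T|_G)$ for a level $G$ of `f`, so the quotient by it is
an object. The projection to this quotient kills an epimorphism and hence is zero. -/
lemma surjective_of_epi {X Y : DiagCat T} (f : X ⟶ Y) [Epi f] :
    Function.Surjective (lin f) := by
  obtain ⟨G, hX, hY, hf⟩ := f.2
  let Q := quot Y hY (LinearMap.range (lin f)) (by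
    rintro a _ ⟨x, rfl⟩
    exact ⟨X.act (HomOn.res hX a) x, LinearMap.congr_fun (hf a) x⟩)
  let q : Y ⟶ Q := homMk (Y := Q) (LinearMap.range (lin f)).mkQ ⟨G, hY, subset_rfl, fun _ => rfl⟩
  have h : q = 0 := by
    rw [← cancel_epi f, Limits.comp_zero]
    exact Subtype.ext (LinearMap.range_mkQ_comp (lin f))
  have h' : (LinearMap.range (lin f)).mkQ = 0 := congrArg Subtype.val h
  rw [← LinearMap.range_eq_top, ← Submodule.ker_mkQ (LinearMap.range (lin f)), h',
    LinearMap.ker_zero]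

/-- The linear form of exactness up to refinements. -/
lemma exists_of_refinements {X Y Z : DiagCat T} (f : X ⟶ Y) (g : Y ⟶ Z)
    (h : ∀ {K : DiagCat T} (k : K ⟶ Y), k ≫ g = 0 → ∃ (L : DiagCat T) (π : L ⟶ K) (_ : Epi π)
      (x : L ⟶ X), π ≫ k = x ≫ f) (y : Y.carrier) (hy : lin g y = 0) : ∃ x, lin f x = y := by
  obtain ⟨G, hY, hZ, hg⟩ := g.2
  -- The linear kernel is an object once its support is enlarged to a level $G$ at which `g` is
  -- equivariant. The refinement of its inclusion, lifted along the surjection under `π`, gives the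
  -- preimage of `y`.
  let K := sub Y hY (LinearMap.ker (lin g)) (fun a x hx => by
    refine (LinearMap.congr_fun (hg a) x).trans ?_
    exact (congrArg (Z.act (HomOn.res hZ a)) hx).trans (map_zero _))
  let k : K ⟶ Y := homMk (X := K) (LinearMap.ker (lin g)).subtype ⟨G, subset_rfl, hY, fun _ => rfl⟩
  obtain ⟨L, π, _, x, hx⟩ := h k (Subtype.ext (LinearMap.ext fun x => x.2))
  obtain ⟨l, hl⟩ := surjective_of_epi π ⟨y, hy⟩
  refine ⟨lin x l, ?_⟩
  have e := LinearMap.congr_fun (congrArg Subtype.val hx) l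
  exact e.symm.trans (congrArg (lin k) hl)

end DiagCat

namespace FibreData

variable {T₁ T : GradedRep D} {E : TensorExtension T₁ T} (A : FibreData E)

include A

lemma additive : E.functor.Additive where
  map_add {X Y f g} := by
    classical
    refine FGModuleCat.hom_ext (LinearMap.ext fun z => ?_)
    let G := A.level (f + g) ∪ (A.level f ∪ A.level g)
    have h0 : A.level (f + g) ⊆ G := Finset.subset_union_left
    have h1 : A.level f ⊆ G := Finset.subset_union_left.trans Finset.subset_union_right
    have h2 : A.level g ⊆ G := Finset.subset_union_right.trans Finset.subset_union_right
    have hX := (A.source_level f).trans h1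
    have hY := (A.target_level f).trans h1
    refine A.ext_res hY fun b => ?_
    refine (A.out_map (f + g) h0 hX hY z b).trans (Eq.trans ?_ (map_add _ _ _).symm)
    exact (congrArg₂ (· + ·) (A.out_map f h1 hX hY z b) (A.out_map g h2 hX hY z b)).symm

lemma linear {X Y : DiagCat T₁} (c : ℚ) (f : X ⟶ Y) :
    E.functor.map (c • f) = c • E.functor.map f := by
  classical
  refine FGModuleCat.hom_ext (LinearMap.ext fun z => ?_)
  let G := A.level (c • f) ∪ A.level f
  have h0 : A.level (c • f) ⊆ G := Finset.subset_union_left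
  have h1 : A.level f ⊆ G := Finset.subset_union_right
  have hX := (A.source_level f).trans h1
  have hY := (A.target_level f).trans h1
  refine A.ext_res hY fun b => ?_
  refine (A.out_map (c • f) h0 hX hY z b).trans (Eq.trans ?_ (map_smul _ _ _).symm)
  exact (congrArg (c • ·) (A.out_map f h1 hX hY z b)).symm

/-- Every $x\in X$ is the pairing with $b$ of an element of $E(X)$, where $b$ is a local isomorphism
on a common level of $f$ and $g$. So $E(f)$ determines $f$. -/
lemma faithful : E.functor.Faithful where
  map_injective {X Y f g} hfg := by
    classical
    have g1 := Finset.subset_union_left (s₁ := A.level f) (s₂ := A.level g)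
    have g2 := Finset.subset_union_right (s₁ := A.level f) (s₂ := A.level g)
    have hX := (A.source_level f).trans g1
    have hY := (A.target_level f).trans g1
    obtain ⟨c, b, hbc, -⟩ := A.locIso (A.level f ∪ A.level g)
    refine Subtype.ext (LinearMap.ext fun x => ?_)
    have hx := A.out_into_self (c := HomOn.res hX c) (b := HomOn.res hX b)
      (by rw [← HomOn.res_compH, hbc, HomOn.res_idH]) x
    have e1 := A.out_map f g1 hX hY (A.into X (HomOn.res hX c) x) b
    have e2 := A.out_map g g2 hX hY (A.into X (HomOn.res hX c) x) b
    rw [hx] at e1 e2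
    refine e1.symm.trans (Eq.trans ?_ e2)
    exact congrArg (fun k : E.functor.obj X ⟶ E.functor.obj Y => A.out Y (HomOn.res hY b)
      (k.hom.hom (A.into X (HomOn.res hX c) x))) hfg

-- Pairing with a local isomorphism $b$ on a common level of $f$ and $g$ identifies $E(Y)$ with $Y$
-- and carries $E(g)$ to $g$; the inverse `A.into` carries $f$ to $E(f)$. A preimage can therefore
-- be found in $X$ and moved back.
open scoped Classical in
lemma exact {X Y Z : DiagCat T₁} (f : X ⟶ Y) (g : Y ⟶ Z)
    (h : ∀ y, DiagCat.lin g y = 0 → ∃ x, DiagCat.lin f x = y) (z : E.functor.obj Y)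
    (hz : mapLin E.functor g z = 0) : ∃ y, mapLin E.functor f y = z := by
  obtain ⟨F, fX, fY, hf⟩ := f.2
  have hF : F ⊆ F ∪ A.level g := Finset.subset_union_left
  have h2 : A.level g ⊆ F ∪ A.level g := Finset.subset_union_right
  have hY := fY.trans hF
  obtain ⟨c, b, -, hcb⟩ := A.locIso (F ∪ A.level g)
  obtain ⟨x, hx⟩ := h (A.out Y (HomOn.res hY b) z) (by
    rw [← A.out_map g h2 hY ((A.target_level g).trans h2), hz, map_zero])
  refine ⟨A.into X (HomOn.res (fX.trans hF) c) x, ?_⟩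
  rw [A.map_into f (fX.trans hF) hY (fun a => hf (HomOn.res hF a)), hx]
  exact A.into_out (by rw [← HomOn.res_compH, hcb, HomOn.res_idH]) z

lemma isLinearExactFaithful (hT : IsNeutralTannakian (DiagCat T₁)) :
    IsLinearExactFaithful E.functor := by
  have h := preservesFinite_of_exact hT.abelian E.functor A.additive
    fun f g h z hz => A.exact f g (DiagCat.exists_of_refinements f g h) z hz
  exact ⟨A.additive, A.linear, A.faithful, h.1, h.2⟩

end FibreData

/-! ### Matrix coefficients over a base ring. -/

section Pairing

variable {V V' W W' : Type} [AddCommGroup V] [Module ℚ V] [AddCommGroup V'] [Module ℚ V']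
  [AddCommGroup W] [Module ℚ W] [AddCommGroup W'] [Module ℚ W']
  {S : Type} [CommRing S] [Algebra ℚ S]

/-- A functional on `V` extended to an `S`-linear functional on `S ⊗ V`. -/
def evS (S : Type) [CommRing S] [Algebra ℚ S] (γ : Module.Dual ℚ V) : S ⊗[ℚ] V →ₗ[S] S :=
  (AlgebraTensorModule.rid ℚ S S).toLinearMap ∘ₗ LinearMap.baseChange S γ

@[simp] lemma evS_tmul (γ : Module.Dual ℚ V) (s : S) (v : V) : evS S γ (s ⊗ₜ v) = γ v • s := by
  simp [evS]

lemma evS_eq_rid (γ : Module.Dual ℚ V) (w : S ⊗[ℚ] V) :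
    evS S γ w = TensorProduct.rid ℚ S (γ.lTensor S w) := rfl

lemma evS_baseChange (γ : Module.Dual ℚ V') (f : V →ₗ[ℚ] V') (w : S ⊗[ℚ] V) :
    evS S γ (f.baseChange S w) = evS S (γ ∘ₗ f) w := by
  induction w with
  | zero => simp
  | tmul s v => simp
  | add x y hx hy => simp only [map_add, hx, hy]

lemma evS_add (γ δ : Module.Dual ℚ V) (w : S ⊗[ℚ] V) :
    evS S (γ + δ) w = evS S γ w + evS S δ w := by
  simp only [evS_eq_rid, LinearMap.lTensor_add, LinearMap.add_apply, map_add]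

lemma evS_smul (c : ℚ) (γ : Module.Dual ℚ V) (w : S ⊗[ℚ] V) :
    evS S (c • γ) w = c • evS S γ w := by
  simp only [evS_eq_rid, LinearMap.lTensor_smul, LinearMap.smul_apply, map_smul]

lemma evS_rTensor {S' : Type} [CommRing S'] [Algebra ℚ S'] (a : S →ₐ[ℚ] S')
    (γ : Module.Dual ℚ V) (w : S ⊗[ℚ] V) :
    evS S' γ (a.toLinearMap.rTensor V w) = a (evS S γ w) := by
  induction w with
  | zero => simp
  | tmul s v => simp
  | add x y hx hy => simp only [map_add, hx, hy]

lemma evS_distribBaseChange (γ : Module.Dual ℚ V) (δ : Module.Dual ℚ W) (z : S ⊗[ℚ] V)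
    (w : S ⊗[ℚ] W) :
    evS S (TensorProduct.dualDistrib ℚ V W (γ ⊗ₜ δ))
      ((AlgebraTensorModule.distribBaseChange ℚ S V W).symm (z ⊗ₜ w)) =
      evS S γ z * evS S δ w := by
  induction z with
  | zero => simp
  | add x y hx hy => simp only [TensorProduct.add_tmul, map_add, hx, hy, add_mul]
  | tmul s v =>
    induction w with
    | zero => simp
    | add x y hx hy => simp only [TensorProduct.tmul_add, map_add, hx, hy, mul_add]
    | tmul t w =>
      rw [AlgebraTensorModule.distribBaseChange_symm_tmul]
      simp [mul_smul, smul_comm (γ v) (δ w)]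

/-- Functionals separate the points of $V$, and tensoring with $S$ preserves this because all
$\mathbb{Q}$-modules are flat. -/
lemma evS_ext {w w' : S ⊗[ℚ] V} (h : ∀ γ : Module.Dual ℚ V, evS S γ w = evS S γ w') : w = w' := by
  refine lTensor_joint_ext (fun γ : Module.Dual ℚ V => γ)
    (fun x hx => (Module.forall_dual_apply_eq_zero_iff ℚ x).mp hx) fun γ => ?_
  exact (TensorProduct.rid ℚ S).injective (h γ)

lemma baseChange_ext {f g : S ⊗[ℚ] V →ₗ[S] S ⊗[ℚ] V'}
    (h : ∀ v γ, evS S γ (f (1 ⊗ₜ v)) = evS S γ (g (1 ⊗ₜ v))) : f = g :=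
  AlgebraTensorModule.curry_injective (LinearMap.ext_ring (LinearMap.ext fun v =>
    evS_ext fun γ => h v γ))

/-- The `S`-linear map `S ⊗ V → S ⊗ V'` with prescribed matrix coefficients. -/
def ofPair [Module.Finite ℚ V'] (B : V →ₗ[ℚ] Module.Dual ℚ V' →ₗ[ℚ] S) :
    S ⊗[ℚ] V →ₗ[S] S ⊗[ℚ] V' :=
  LinearMap.liftBaseChange S (∑ i, (TensorProduct.mk ℚ S V').flip (Module.finBasis ℚ V' i) ∘ₗ
    B.flip ((Module.finBasis ℚ V').coord i))

@[simp] lemma evS_ofPair [Module.Finite ℚ V'] (B : V →ₗ[ℚ] Module.Dual ℚ V' →ₗ[ℚ] S) (v : V)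
    (γ : Module.Dual ℚ V') : evS S γ (ofPair B (1 ⊗ₜ v)) = B v γ := by
  -- `ofPair` prescribes the coefficients for one coordinate basis only; expanding $\gamma$ in that
  -- basis gives all the others.
  have hγ : γ = ∑ i, γ (Module.finBasis ℚ V' i) • (Module.finBasis ℚ V').coord i :=
    (Module.finBasis ℚ V').ext fun i => by simp
  conv_rhs => rw [hγ]
  rw [map_sum]
  simp [ofPair, -Module.Basis.sum_dual_apply_smul_coord]

end Pairing

/-! ### Tensor transformations on a rigid category are invertible. -/

section TensorTrans

variable {C : Type u} [Category.{w} C] [MonoidalCategory C]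

/-- A natural `S`-linear tensor transformation `S ⊗ ω → S ⊗ η`. -/
@[ext]
structure TensorTrans (ω η : C ⥤ FGModuleCat.{0} ℚ) [ω.Monoidal] [η.Monoidal]
    (S : Type) [CommRing S] [Algebra ℚ S] where
  app : ∀ X : C, (S ⊗[ℚ] ω.obj X) →ₗ[S] (S ⊗[ℚ] η.obj X)
  naturality : ∀ {X Y : C} (f : X ⟶ Y),
    app Y ∘ₗ (mapLin ω f).baseChange S = (mapLin η f).baseChange S ∘ₗ app X
  unit : app (𝟙_ C) ∘ₗ (unitLin ω).baseChange S = (unitLin η).baseChange S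
  tensor : ∀ X Y : C, app (X ⊗ Y) ∘ₗ (tensorLin ω X Y).baseChange S ∘ₗ
      (AlgebraTensorModule.distribBaseChange ℚ S (ω.obj X) (ω.obj Y)).symm.toLinearMap =
    (tensorLin η X Y).baseChange S ∘ₗ
      (AlgebraTensorModule.distribBaseChange ℚ S (η.obj X) (η.obj Y)).symm.toLinearMap ∘ₗ
      TensorProduct.map (app X) (app Y)

section MonoidalElements

variable (ω : C ⥤ FGModuleCat.{0} ℚ) [ω.Monoidal]

omit [MonoidalCategory C] [ω.Monoidal] in
lemma mapLin_comp {X Y Z : C} (f : X ⟶ Y) (g : Y ⟶ Z) (x : ω.obj X) :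
    mapLin ω (f ≫ g) x = mapLin ω g (mapLin ω f x) := by
  rw [mapLin, ω.map_comp]; rfl

lemma mapLin_whiskerRight {X Y : C} (f : X ⟶ Y) (Z : C) (x : ω.obj X) (z : ω.obj Z) :
    mapLin ω (f ▷ Z) (tensorLin ω X Z (x ⊗ₜ z)) = tensorLin ω Y Z (mapLin ω f x ⊗ₜ z) :=
  (LinearMap.congr_fun (congrArg (fun k => k.hom.hom)
    (Functor.LaxMonoidal.μ_natural_left (F := ω) f Z)) (x ⊗ₜ z)).symm

lemma mapLin_whiskerLeft {X Y : C} (f : X ⟶ Y) (Z : C) (x : ω.obj X) (z : ω.obj Z) :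
    mapLin ω (Z ◁ f) (tensorLin ω Z X (z ⊗ₜ x)) = tensorLin ω Z Y (z ⊗ₜ mapLin ω f x) :=
  (LinearMap.congr_fun (congrArg (fun k => k.hom.hom)
    (Functor.LaxMonoidal.μ_natural_right (F := ω) Z f)) (z ⊗ₜ x)).symm

lemma mapLin_associator (X Y Z : C) (x : ω.obj X) (y : ω.obj Y) (z : ω.obj Z) :
    mapLin ω (α_ X Y Z).hom (tensorLin ω (X ⊗ Y) Z (tensorLin ω X Y (x ⊗ₜ y) ⊗ₜ z)) =
      tensorLin ω X (Y ⊗ Z) (x ⊗ₜ tensorLin ω Y Z (y ⊗ₜ z)) :=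
  LinearMap.congr_fun (congrArg (fun k => k.hom.hom)
    (Functor.LaxMonoidal.associativity (F := ω) X Y Z)) ((x ⊗ₜ y) ⊗ₜ z)

lemma mapLin_leftUnitor (X : C) (x : ω.obj X) :
    mapLin ω (λ_ X).hom (tensorLin ω (𝟙_ C) X (unitLin ω 1 ⊗ₜ x)) = x :=
  (LinearMap.congr_fun (congrArg (fun k => k.hom.hom)
    (Functor.LaxMonoidal.left_unitality (F := ω) X)) ((1 : ℚ) ⊗ₜ x)).symm.trans (one_smul ℚ x)

lemma mapLin_rightUnitor (X : C) (x : ω.obj X) :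
    mapLin ω (ρ_ X).hom (tensorLin ω X (𝟙_ C) (x ⊗ₜ unitLin ω 1)) = x :=
  (LinearMap.congr_fun (congrArg (fun k => k.hom.hom)
    (Functor.LaxMonoidal.right_unitality (F := ω) X)) (x ⊗ₜ (1 : ℚ))).symm.trans (one_smul ℚ x)

/-- The inverse of `tensorLin`. -/
def tensorInv (X Y : C) : ω.obj (X ⊗ Y) →ₗ[ℚ] ω.obj X ⊗[ℚ] ω.obj Y :=
  (Functor.OplaxMonoidal.δ ω X Y).hom.hom

lemma tensorInv_tensorLin (X Y : C) (t : ω.obj X ⊗[ℚ] ω.obj Y) :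
    tensorInv ω X Y (tensorLin ω X Y t) = t :=
  LinearMap.congr_fun (congrArg (fun k => k.hom.hom) (Functor.Monoidal.μ_δ ω X Y)) t

lemma tensorLin_tensorInv (X Y : C) (t : ω.obj (X ⊗ Y)) :
    tensorLin ω X Y (tensorInv ω X Y t) = t :=
  LinearMap.congr_fun (congrArg (fun k => k.hom.hom) (Functor.Monoidal.δ_μ ω X Y)) t

/-- The inverse of `unitLin`. -/
def unitInv : ω.obj (𝟙_ C) →ₗ[ℚ] ℚ := (Functor.OplaxMonoidal.η ω).hom.hom

lemma unitInv_unitLin (c : ℚ) : unitInv ω (unitLin ω c) = c :=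
  LinearMap.congr_fun (congrArg (fun k => k.hom.hom) (Functor.Monoidal.ε_η ω)) c

lemma unitLin_unitInv (x : ω.obj (𝟙_ C)) : unitLin ω (unitInv ω x) = x :=
  LinearMap.congr_fun (congrArg (fun k => k.hom.hom) (Functor.Monoidal.η_ε ω)) x

variable (X Y : C) [ExactPairing X Y]

/-- The pairing `ω(Y) ⊗ ω(X) → ℚ` of a dual pair. -/
def evLin : Module.Dual ℚ (ω.obj Y ⊗[ℚ] ω.obj X) :=
  unitInv ω ∘ₗ mapLin ω (ε_ X Y) ∘ₗ tensorLin ω Y X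

lemma unitLin_evLin (t : ω.obj Y ⊗[ℚ] ω.obj X) :
    unitLin ω (evLin ω X Y t) = mapLin ω (ε_ X Y) (tensorLin ω Y X t) :=
  unitLin_unitInv ω _

/-- The copairing in `ω(X) ⊗ ω(Y)` of a dual pair. -/
def coevLin : ω.obj X ⊗[ℚ] ω.obj Y := tensorInv ω X Y (mapLin ω (η_ X Y) (unitLin ω 1))

/-- Contraction of `t ∈ ω(X) ⊗ ω(Y)` with `x ∈ ω(X)` along the pairing. -/
lemma contract_eq (t : ω.obj X ⊗[ℚ] ω.obj Y) (x : ω.obj X) :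
    mapLin ω (X ◁ ε_ X Y) (mapLin ω (α_ X Y X).hom
      (tensorLin ω (X ⊗ Y) X (tensorLin ω X Y t ⊗ₜ x))) =
    tensorLin ω X (𝟙_ C) ((TensorProduct.rid ℚ (ω.obj X)
      ((evLin ω X Y ∘ₗ (TensorProduct.mk ℚ (ω.obj Y) (ω.obj X)).flip x).lTensor (ω.obj X) t)) ⊗ₜ
        unitLin ω 1) := by
  induction t with
  | zero => simp
  | add a b ha hb => simp only [map_add, TensorProduct.add_tmul, ha, hb]
  | tmul m n =>
    rw [mapLin_associator, mapLin_whiskerLeft, ← unitLin_evLin]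
    simp only [LinearMap.lTensor_tmul, LinearMap.comp_apply, LinearMap.flip_apply,
      TensorProduct.mk_apply, TensorProduct.rid_tmul]
    rw [← TensorProduct.smul_tmul']
    have : unitLin ω (evLin ω X Y (n ⊗ₜ x)) = evLin ω X Y (n ⊗ₜ x) • unitLin ω 1 := by
      rw [← map_smul, smul_eq_mul, mul_one]
    rw [this, TensorProduct.tmul_smul]

/-- This is the image under the tensor functor of one triangle identity of the dual pair, with the
unit factor removed by the right unitor. -/
lemma contract_coev (x : ω.obj X) : TensorProduct.rid ℚ (ω.obj X)
      ((evLin ω X Y ∘ₗ (TensorProduct.mk ℚ (ω.obj Y) (ω.obj X)).flip x).lTensor (ω.obj X)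
        (coevLin ω X Y)) = x := by
  have h := contract_eq ω X Y (coevLin ω X Y) x
  rw [coevLin, tensorLin_tensorInv, ← mapLin_whiskerRight, ← mapLin_comp, ← mapLin_comp,
    ExactPairing.evaluation_coevaluation] at h
  have h' := congrArg (mapLin ω (ρ_ X).hom) h
  rw [mapLin_rightUnitor, ← mapLin_comp, Category.assoc, Iso.inv_hom_id, Category.comp_id,
    mapLin_leftUnitor] at h'
  exact h'.symm

end MonoidalElements

namespace TensorTrans

variable {ω η : C ⥤ FGModuleCat.{0} ℚ} [ω.Monoidal] [η.Monoidal]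
  {S : Type} [CommRing S] [Algebra ℚ S] (f : TensorTrans ω η S)

/-- Compatibility with tensor products and with the unit, and naturality along the evaluation, make
a tensor transformation preserve the duality pairing. -/
lemma evS_evLin (X Y : C) [ExactPairing X Y] (n : S ⊗[ℚ] ω.obj Y) (m : S ⊗[ℚ] ω.obj X) :
    evS S (evLin η X Y) ((AlgebraTensorModule.distribBaseChange ℚ S _ _).symm
      (f.app Y n ⊗ₜ f.app X m)) =
    evS S (evLin ω X Y) ((AlgebraTensorModule.distribBaseChange ℚ S _ _).symm (n ⊗ₜ m)) := by
  have key : ∀ (θ : C ⥤ FGModuleCat.{0} ℚ) [θ.Monoidal] (t : S ⊗[ℚ] (θ.obj Y ⊗[ℚ] θ.obj X)),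
      (mapLin θ (ε_ X Y)).baseChange S ((tensorLin θ Y X).baseChange S t) =
        (unitLin θ).baseChange S (LinearMap.baseChange S (evLin θ X Y) t) := by
    intro θ _ t
    rw [← LinearMap.comp_apply, ← LinearMap.comp_apply, ← LinearMap.baseChange_comp,
      ← LinearMap.baseChange_comp]
    congr 2
    exact LinearMap.ext fun t => (unitLin_evLin θ X Y t).symm
  have e := LinearMap.congr_fun (f.tensor Y X) (n ⊗ₜ m)
  simp only [LinearMap.comp_apply, LinearEquiv.coe_coe, TensorProduct.map_tmul] at e
  have e2 := congrArg ((mapLin η (ε_ X Y)).baseChange S) e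
  rw [key η, ← LinearMap.comp_apply, ← f.naturality, LinearMap.comp_apply, key ω,
    ← LinearMap.comp_apply, f.unit] at e2
  refine congrArg (AlgebraTensorModule.rid ℚ S S) ?_
  -- The equality is known only in $S\otimes\eta(\mathbf 1)$; the unit isomorphism has a retraction,
  -- which survives base change and brings it back to $S$.
  have inj : Function.LeftInverse ((unitInv η).baseChange S) ((unitLin η).baseChange S) := by
    intro x
    rw [← LinearMap.comp_apply, ← LinearMap.baseChange_comp]
    have : unitInv η ∘ₗ unitLin η = LinearMap.id := LinearMap.ext (unitInv_unitLin η)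
    rw [this, LinearMap.baseChange_id, LinearMap.id_apply]
  exact inj.injective e2.symm

/-- For $t=m\otimes n$ the map $y\mapsto\langle f_Y(n),y\rangle\,m$ works, because $\langle
f_Y(n),f_X(x)\rangle=\langle n,x\rangle$; sums are formed termwise. For $t$ the coevaluation this
yields a left inverse of $f_X$. -/
lemma exists_contract (X Y : C) [ExactPairing X Y] (t : ω.obj X ⊗[ℚ] ω.obj Y) :
    ∃ g : S ⊗[ℚ] η.obj X →ₗ[S] S ⊗[ℚ] ω.obj X, ∀ x : ω.obj X, g (f.app X (1 ⊗ₜ x)) =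
      1 ⊗ₜ (TensorProduct.rid ℚ (ω.obj X) ((evLin ω X Y ∘ₗ
        (TensorProduct.mk ℚ (ω.obj Y) (ω.obj X)).flip x).lTensor (ω.obj X) t)) := by
  induction t with
  | zero => exact ⟨0, fun x => by simp⟩
  | add a b ha hb =>
    obtain ⟨g, hg⟩ := ha
    obtain ⟨h, hh⟩ := hb
    exact ⟨g + h, fun x => by
      simp only [LinearMap.add_apply, hg, hh, map_add, TensorProduct.tmul_add]⟩
  | tmul m n =>
    refine ⟨LinearMap.toSpanSingleton S (S ⊗[ℚ] ω.obj X) (1 ⊗ₜ m) ∘ₗ evS S (evLin η X Y) ∘ₗ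
      (AlgebraTensorModule.distribBaseChange ℚ S _ _).symm.toLinearMap ∘ₗ
      TensorProduct.mk S (S ⊗[ℚ] η.obj Y) (S ⊗[ℚ] η.obj X) (f.app Y (1 ⊗ₜ n)), fun x => ?_⟩
    simp only [LinearMap.comp_apply, TensorProduct.mk_apply, LinearEquiv.coe_coe, evS_evLin,
      AlgebraTensorModule.distribBaseChange_symm_tmul, mul_one, evS_tmul,
      LinearMap.toSpanSingleton_apply, LinearMap.lTensor_tmul, LinearMap.flip_apply,
      TensorProduct.rid_tmul, TensorProduct.tmul_smul, smul_assoc, one_smul]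

/-- The dual object supplies a left inverse $g$. Equality of ranks replaces a second duality
argument: after identifying the two free modules, $g$ is a surjective endomorphism of a finitely
generated module over a commutative ring, hence injective, and then $g$ is also a right inverse. -/
lemma bijective (X Y : C) [ExactPairing X Y]
    (h : Module.finrank ℚ (ω.obj X) = Module.finrank ℚ (η.obj X)) :
    Function.Bijective (f.app X) := by
  obtain ⟨g, hg⟩ := f.exists_contract X Y (coevLin ω X Y)
  have hgf : g ∘ₗ f.app X = LinearMap.id :=
    AlgebraTensorModule.curry_injective (LinearMap.ext_ring (LinearMap.ext fun x =>
      (hg x).trans (by rw [contract_coev]; rfl)))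
  have hl : Function.LeftInverse g (f.app X) := fun z => LinearMap.congr_fun hgf z
  let e : S ⊗[ℚ] ω.obj X ≃ₗ[S] S ⊗[ℚ] η.obj X :=
    (LinearEquiv.ofFinrankEq (ω.obj X) (η.obj X) h).baseChange ℚ S _ _
  have hs : Function.Surjective (e.toLinearMap ∘ₗ g) := e.surjective.comp hl.surjective
  have hi : Function.Injective g :=
    Function.Injective.of_comp (f := e) (OrzechProperty.injective_of_surjective_endomorphism _ hs)
  exact ⟨hl.injective, fun z => ⟨g z, hi (hl (g z))⟩⟩

/-- A tensor transformation of functors of the same rank on a rigid category is invertible. -/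
def toIso [RigidCategory C]
    (h : ∀ X, Module.finrank ℚ (ω.obj X) = Module.finrank ℚ (η.obj X)) : TensorIso ω η S where
  app X := LinearEquiv.ofBijective (f.app X) (f.bijective X Xᘁ (h X))
  naturality := f.naturality
  unit := f.unit
  tensor := f.tensor

/-- The tensor transformation underlying a tensor isomorphism. -/
def ofIso (f : TensorIso ω η S) : TensorTrans ω η S where
  app X := (f.app X).toLinearMap
  naturality := f.naturality
  unit := f.unit
  tensor := f.tensor

/-- On a rigid category every tensor transformation of functors of the same rank is an
isomorphism. -/
def equivIso [RigidCategory C]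
    (h : ∀ X, Module.finrank ℚ (ω.obj X) = Module.finrank ℚ (η.obj X)) :
    TensorTrans ω η S ≃ TensorIso ω η S where
  toFun f := f.toIso h
  invFun f := ofIso f
  left_inv _ := TensorTrans.ext rfl
  right_inv _ := TensorIso.ext (funext fun _ => LinearEquiv.ext fun _ => rfl)

end TensorTrans
end TensorTrans

/-! ### Linear forms on the algebra of matrix coefficients. -/

section Colimit

variable {D : Type} [ReflQuiver.{v} D] {T T' : Representation D}

namespace CompAlg

lemma of_coeff {F : Finset D} (p : D) (hp : p ∈ F) (v : T.obj p) (γ : Module.Dual ℚ (T'.obj p)) :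
    of T T' F (γ ∘ₗ LinearMap.applyₗ v ∘ₗ HomOn.ev p hp) = coeff T T' p v γ :=
  of_res (Finset.singleton_subset_iff.mpr hp)
    (γ ∘ₗ LinearMap.applyₗ v ∘ₗ HomOn.ev p (Finset.mem_singleton_self p))

/-- The algebra of matrix coefficients is spanned by the matrix coefficients. -/
lemma coeff_induction {P : CompAlg T T' → Prop} (h0 : P 0) (hadd : ∀ x y, P x → P y → P (x + y))
    (hsmul : ∀ (c : ℚ) x, P x → P (c • x)) (hcoeff : ∀ p v γ, P (coeff T T' p v γ)) (x) : P x := by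
  obtain ⟨F, ξ, rfl⟩ := exists_of x
  let s : Set (Module.Dual ℚ (HomOn T T' F)) :=
    {ξ | ∃ (p : D) (hp : p ∈ F) (v : T.obj p) (γ : Module.Dual ℚ (T'.obj p)),
      ξ = γ ∘ₗ LinearMap.applyₗ v ∘ₗ HomOn.ev p hp}
  -- The matrix coefficients separate the points of the finite-dimensional space
  -- $\mathrm{Hom}(T|_F,T'|_F)$ and therefore span its dual.
  have hs : Submodule.span ℚ s = ⊤ := by
    refine Submodule.span_eq_top_of_ne_zero fun a ha => ?_
    by_contra! hc
    refine ha (HomOn.ext_ev fun p hp => LinearMap.ext fun v => ?_)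
    exact (Module.forall_dual_apply_eq_zero_iff ℚ _).mp fun γ => hc _ ⟨p, hp, v, γ, rfl⟩
  have hξ : ξ ∈ Submodule.span ℚ s := hs ▸ Submodule.mem_top
  induction hξ using Submodule.span_induction with
  | mem y hy =>
    obtain ⟨p, hp, v, γ, rfl⟩ := hy
    rw [of_coeff]
    exact hcoeff p v γ
  | zero => rwa [map_zero]
  | add y z _ _ hy hz => rw [map_add]; exact hadd _ _ hy hz
  | smul c y _ hy => rw [map_smul]; exact hsmul _ _ hy

lemma linear_ext {P : Type} [AddCommGroup P] [Module ℚ P] {x y : CompAlg T T' →ₗ[ℚ] P}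
    (h : ∀ p v γ, x (coeff T T' p v γ) = y (coeff T T' p v γ)) : x = y :=
  LinearMap.ext fun a => coeff_induction (P := fun a => x a = y a) (by simp)
    (fun a b ha hb => by rw [map_add, map_add, ha, hb]) (fun c a ha => by
      rw [map_smul, map_smul, ha]) h a

end CompAlg

section Family

variable {S : Type} [CommRing S] [Algebra ℚ S]

lemma lTensorHomEquiv_apply_apply {V V' : Type} [AddCommGroup V] [Module ℚ V] [AddCommGroup V']
    [Module ℚ V'] [Module.Finite ℚ V] (u : S ⊗[ℚ] (V →ₗ[ℚ] V')) (v : V) :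
    lTensorHomEquivHomLTensor ℚ V S V' u v =
      (LinearMap.applyₗ v : (V →ₗ[ℚ] V') →ₗ[ℚ] V').lTensor S u := by
  induction u with
  | zero => simp
  | tmul s f => simp
  | add x y hx hy => simp only [map_add, LinearMap.add_apply, hx, hy]

/-- $\mathrm{Hom}(T|_F,T'|_F)$ is cut out of a finite product by linear relations. By flatness,
$S\otimes\mathrm{Hom}(T|_F,T'|_F)$ is cut out by the same relations over $S$, and these express the
naturality of $g$. -/
lemma exists_homOn (g : ∀ p, T.obj p →ₗ[ℚ] S ⊗[ℚ] T'.obj p)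
    (hg : ∀ {p q : D} (m : p ⟶ q) v, g q (T.map m v) = (T'.map m).lTensor S (g p v))
    (F : Finset D) : ∃ y : S ⊗[ℚ] HomOn T T' F, ∀ p hp v,
      (LinearMap.applyₗ v ∘ₗ HomOn.ev p hp).lTensor S y = g p v := by
  classical
  let u : ∀ p : F, S ⊗[ℚ] (T.obj p →ₗ[ℚ] T'.obj p) := fun p =>
    (lTensorHomEquivHomLTensor ℚ _ S _).symm (g p)
  have hu : ∀ p v, (LinearMap.applyₗ v : (T.obj p.1 →ₗ[ℚ] T'.obj p.1) →ₗ[ℚ] _).lTensor S (u p) =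
      g p v := fun p v => by
    rw [← lTensorHomEquiv_apply_apply, LinearEquiv.apply_symm_apply]
  let U : S ⊗[ℚ] (∀ p : F, T.obj p →ₗ[ℚ] T'.obj p) := (TensorProduct.piRight ℚ ℚ S _).symm u
  have hU : ∀ p, (LinearMap.proj p : (∀ p : F, T.obj p →ₗ[ℚ] T'.obj p) →ₗ[ℚ] _).lTensor S U =
      u p := by
    intro p
    have key : ∀ z : S ⊗[ℚ] (∀ p : F, T.obj p →ₗ[ℚ] T'.obj p),
        (LinearMap.proj p : (∀ p : F, T.obj p →ₗ[ℚ] T'.obj p) →ₗ[ℚ] _).lTensor S z =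
          TensorProduct.piRight ℚ ℚ S _ z p := by
      intro z
      induction z with
      | zero => simp
      | tmul s f => simp
      | add x y hx hy => simp only [map_add, Pi.add_apply, hx, hy]
    rw [key, LinearEquiv.apply_symm_apply]
  obtain ⟨y, hy⟩ := mem_range_lTensor_of_forall (HomOn.rel T T' F) (HomOn T T' F)
    HomOn.mem_of_rel U (fun i => by
      obtain ⟨p, q, m⟩ := i
      apply (lTensorHomEquivHomLTensor ℚ _ S _).injective
      refine LinearMap.ext fun v => ?_
      rw [lTensorHomEquiv_apply_apply, ← LinearMap.comp_apply, ← LinearMap.lTensor_comp]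
      have e : (LinearMap.applyₗ v ∘ₗ HomOn.rel T T' F ⟨p, q, m⟩ :
          (∀ p : F, T.obj p →ₗ[ℚ] T'.obj p) →ₗ[ℚ] _) =
          LinearMap.applyₗ (T.map m v) ∘ₗ LinearMap.proj q -
            T'.map m ∘ₗ LinearMap.applyₗ v ∘ₗ LinearMap.proj p := rfl
      rw [e, LinearMap.lTensor_sub, LinearMap.sub_apply, LinearMap.lTensor_comp,
        LinearMap.lTensor_comp, LinearMap.lTensor_comp]
      simp only [LinearMap.comp_apply]
      rw [hU, hU, hu, hu, hg, sub_self, map_zero, LinearMap.zero_apply])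
  refine ⟨y, fun p hp v => ?_⟩
  rw [← hu ⟨p, hp⟩ v, ← hU, ← hy, ← LinearMap.comp_apply, ← LinearMap.comp_apply,
    ← LinearMap.lTensor_comp, ← LinearMap.lTensor_comp]
  rfl

/-- A natural family of maps `T p → S ⊗ T' p` gives an `S`-valued linear form on the algebra of
matrix coefficients. -/
lemma exists_linear_of_family (g : ∀ p, T.obj p →ₗ[ℚ] S ⊗[ℚ] T'.obj p)
    (hg : ∀ {p q : D} (m : p ⟶ q) v, g q (T.map m v) = (T'.map m).lTensor S (g p v)) :
    ∃ x : CompAlg T T' →ₗ[ℚ] S, ∀ p v γ, x (CompAlg.coeff T T' p v γ) = evS S γ (g p v) := by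
  choose y hy using exists_homOn g hg
  -- The elements `y F` are chosen separately, but evaluations at vertices and vectors determine
  -- them, so they are compatible with restriction. This is what defines a form on the colimit.
  have hev : ∀ F G (h : F ⊆ G), (HomOn.res h).lTensor S (y G) = y F := by
    intro F G h
    refine lTensor_joint_ext (κ := Σ p : F, T.obj p)
      (fun i => LinearMap.applyₗ i.2 ∘ₗ HomOn.ev i.1.1 i.1.2) (fun a ha => ?_) (fun i => ?_)
    · exact HomOn.ext_ev fun p hp => LinearMap.ext fun v => ha ⟨⟨p, hp⟩, v⟩
    · rw [hy, ← LinearMap.comp_apply, ← LinearMap.lTensor_comp]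
      exact hy G i.1.1 (h i.1.2) i.2
  have hlin : ∀ F, ∃ L : Module.Dual ℚ (HomOn T T' F) →ₗ[ℚ] S, ∀ ξ, L ξ = evS S ξ (y F) :=
    fun F => ⟨⟨⟨fun ξ => evS S ξ (y F), fun ξ η => evS_add ξ η _⟩, fun c ξ => evS_smul c ξ _⟩,
      fun _ => rfl⟩
  choose L hL using hlin
  refine ⟨CompAlg.lift L fun F G h ξ => ?_, fun p v γ => ?_⟩
  · rw [hL, hL, ← evS_baseChange, ← hev F G h]
    rfl
  · rw [CompAlg.coeff, CompAlg.lift_of, hL, ← hy {p} p (Finset.mem_singleton_self p) v]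
    exact (evS_baseChange γ _ _).symm

end Family
end Colimit

variable {D : Type} [ProductDiagram.{v} D]

namespace CompAlg

variable {T T' : GradedRep D}

/-- The multiplication is dual to $\mu^*$, whose $(p,q)$-component is conjugation by $\tau$; the
formula is this description evaluated at $v\otimes w$. -/
lemma coeff_mul_coeff (p q : D) (v : T.obj p) (w : T.obj q) (γ : Module.Dual ℚ (T'.obj p))
    (δ : Module.Dual ℚ (T'.obj q)) :
    coeff T.toRepresentation T'.toRepresentation p v γ *
      coeff T.toRepresentation T'.toRepresentation q w δ =
    coeff T.toRepresentation T'.toRepresentation (mul p q) ((T.τ p q).symm (v ⊗ₜ w))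
      (TensorProduct.dualDistrib ℚ _ _ (γ ⊗ₜ δ) ∘ₗ (T'.τ p q).toLinearMap) := by
  have hp := Finset.mem_singleton_self p
  have hq := Finset.mem_singleton_self q
  rw [coeff, coeff, of_mul_of, ← of_coeff (mul p q) (mul_mem_mulF hp hq)]
  refine congrArg _ (LinearMap.ext fun a => ?_)
  rw [mulFun_apply]
  have h := LinearMap.congr_fun (HomOn.ev₂_comul a p q hp hq) (v ⊗ₜ w)
  refine Eq.trans ?_ (congrArg (TensorProduct.dualDistrib ℚ _ _ (γ ⊗ₜ δ)) h)
  generalize HomOn.comul T T' {p} {q} a = z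
  induction z with
  | zero => simp
  | tmul a b => simp
  | add x y hx hy => simp only [map_add, LinearMap.add_apply, hx, hy]

lemma one_eq_coeff : (1 : CompAlg T.toRepresentation T'.toRepresentation) =
    coeff T.toRepresentation T'.toRepresentation unit (unitVec T) (unitCo T') := rfl

end CompAlg

section HomT

variable {A B V V' W W' : Type} [AddCommGroup A] [Module ℚ A] [AddCommGroup B] [Module ℚ B]
  [AddCommGroup V] [Module ℚ V] [AddCommGroup V'] [Module ℚ V']
  [AddCommGroup W] [Module ℚ W] [AddCommGroup W'] [Module ℚ W']

lemma dualDistrib_homT (α : A →ₗ[ℚ] (V →ₗ[ℚ] V')) (β : B →ₗ[ℚ] (W →ₗ[ℚ] W')) (c : A ⊗[ℚ] B)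
    (v : V) (w : W) (γ : Module.Dual ℚ V') (δ : Module.Dual ℚ W') :
    TensorProduct.dualDistrib ℚ V' W' (γ ⊗ₜ δ) (homT α β c (v ⊗ₜ w)) =
      TensorProduct.dualDistrib ℚ A B ((γ ∘ₗ α.flip v) ⊗ₜ (δ ∘ₗ β.flip w)) c := by
  induction c with
  | zero => simp
  | tmul a b => simp
  | add x y hx hy => simp only [map_add, LinearMap.add_apply, hx, hy]

end HomT

lemma baseChange_tensor_ext {V W U S : Type} [AddCommGroup V] [Module ℚ V] [AddCommGroup W]
    [Module ℚ W] [AddCommGroup U] [Module ℚ U] [CommRing S] [Algebra ℚ S]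
    {f g : (S ⊗[ℚ] V) ⊗[S] (S ⊗[ℚ] W) →ₗ[S] S ⊗[ℚ] U}
    (h : ∀ v w γ, evS S γ (f ((1 ⊗ₜ v) ⊗ₜ (1 ⊗ₜ w))) = evS S γ (g ((1 ⊗ₜ v) ⊗ₜ (1 ⊗ₜ w)))) :
    f = g := by
  refine TensorProduct.ext (AlgebraTensorModule.curry_injective (LinearMap.ext_ring
    (LinearMap.ext fun v => ?_)))
  exact baseChange_ext (h v)

variable {D : Type} [ProductDiagram.{v} D]

/-! ### From algebra homomorphisms to tensor transformations and back. -/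

namespace FibreData

variable {T₁ T T' : GradedRep D} {E : TensorExtension T₁ T} {E' : TensorExtension T₁ T'}
  (A : FibreData E) (A' : FibreData E')

variable (X : DiagCat T₁) in
/-- The matrix coefficient `φ ↦ γ (φ_X z)` for an object `X` of `C(T₁)`. -/
def coe : E.functor.obj X →ₗ[ℚ] Module.Dual ℚ (E'.functor.obj X) →ₗ[ℚ]
    CompAlg T.toRepresentation T'.toRepresentation :=
  LinearMap.mk₂ ℚ (fun z γ => CompAlg.of _ _ X.supp (γ ∘ₗ (A.act A' X).flip z))
    (fun z w γ => by rw [map_add, LinearMap.comp_add, map_add])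
    (fun c z γ => by rw [map_smul, LinearMap.comp_smul, map_smul])
    (fun z γ δ => by rw [LinearMap.add_comp, map_add])
    (fun c z γ => by rw [LinearMap.smul_comp, map_smul])

lemma coe_map {X Y : DiagCat T₁} (f : X ⟶ Y) (z : E.functor.obj X)
    (γ : Module.Dual ℚ (E'.functor.obj Y)) :
    A.coe A' Y (mapLin E.functor f z) γ = A.coe A' X z (γ ∘ₗ mapLin E'.functor f) := by
  obtain ⟨G, hX, hY, h⟩ := A.exists_act_map A' f
  exact CompAlg.of_eq_of hY hX fun a => congrArg γ (h a z).symm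

lemma coe_unit (γ : Module.Dual ℚ (E'.functor.obj (DiagCat.tensorOne T₁))) :
    A.coe A' (DiagCat.tensorOne T₁) (unitLin E.functor 1) γ =
      γ (unitLin E'.functor 1) • (1 : CompAlg T.toRepresentation T'.toRepresentation) := by
  rw [CompAlg.one_def, ← map_smul]
  refine congrArg (CompAlg.of T.toRepresentation T'.toRepresentation {unit})
    (LinearMap.ext fun h => ?_)
  refine (congrArg γ (A.act_unit A' h)).trans ?_
  refine (map_smul γ _ _).trans ?_
  exact mul_comm _ _

/-- The matrix coefficients `φ ↦ δ (φ_X ⊗ φ_Y) t`. -/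
def coeTensor (X Y : DiagCat T₁) (t : E.functor.obj X ⊗[ℚ] E.functor.obj Y) :
    Module.Dual ℚ (E'.functor.obj X ⊗[ℚ] E'.functor.obj Y) →ₗ[ℚ]
      CompAlg T.toRepresentation T'.toRepresentation :=
  CompAlg.of T.toRepresentation T'.toRepresentation (mulF X.supp Y.supp) ∘ₗ
    LinearMap.lcomp ℚ ℚ (LinearMap.applyₗ t ∘ₗ homT (A.act A' X) (A.act A' Y) ∘ₗ
      HomOn.comul T T' X.supp Y.supp)

/-- The action on a tensor product runs through $\mu^*$, to which the product of the algebra is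
dual. Thus the product of coefficients at $X$ and $Y$ is a coefficient at $X\otimes Y$. -/
lemma coeTensor_dualDistrib (X Y : DiagCat T₁) (z : E.functor.obj X) (w : E.functor.obj Y)
    (γ : Module.Dual ℚ (E'.functor.obj X)) (δ : Module.Dual ℚ (E'.functor.obj Y)) :
    A.coeTensor A' X Y (z ⊗ₜ w) (TensorProduct.dualDistrib ℚ _ _ (γ ⊗ₜ δ)) =
      A.coe A' X z γ * A.coe A' Y w δ := by
  refine Eq.trans ?_ (CompAlg.of_mul_of _ _).symm
  refine congrArg (CompAlg.of T.toRepresentation T'.toRepresentation _)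
    (LinearMap.ext fun h => ?_)
  exact dualDistrib_homT (A.act A' X) (A.act A' Y) _ z w γ δ

lemma coe_tensor (X Y : DiagCat T₁) (t : E.functor.obj X ⊗[ℚ] E.functor.obj Y)
    (γ : Module.Dual ℚ (E'.functor.obj (DiagCat.tensor X Y))) :
    A.coe A' (DiagCat.tensor X Y) (tensorLin E.functor X Y t) γ =
      A.coeTensor A' X Y t (γ ∘ₗ tensorLin E'.functor X Y) :=
  congrArg (CompAlg.of T.toRepresentation T'.toRepresentation (mulF X.supp Y.supp))
    (LinearMap.ext fun h => congrArg γ (A.act_tensor A' X Y h t))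

lemma coe_iso (p : D) (v : T.obj p) (γ : Module.Dual ℚ (E'.functor.obj (DiagCat.tilde T₁ p))) :
    A.coe A' (DiagCat.tilde T₁ p) (E.iso p v) γ =
      CompAlg.coeff T.toRepresentation T'.toRepresentation p v (γ ∘ₗ (E'.iso p).toLinearMap) :=
  congrArg (CompAlg.of T.toRepresentation T'.toRepresentation {p})
    (LinearMap.ext fun h => congrArg γ (A.act_iso A' p h v))

variable {S : Type} [CommRing S] [Algebra ℚ S]

/-- The transformation with matrix coefficients given by an `S`-valued point. -/
def transf (x : CompAlg T.toRepresentation T'.toRepresentation →ₐ[ℚ] S) (X : DiagCat T₁) :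
    S ⊗[ℚ] E.functor.obj X →ₗ[S] S ⊗[ℚ] E'.functor.obj X :=
  ofPair ((A.coe A' X).compr₂ x.toLinearMap)

variable (x : CompAlg T.toRepresentation T'.toRepresentation →ₐ[ℚ] S)

lemma evS_transf (X : DiagCat T₁) (z : E.functor.obj X) (γ : Module.Dual ℚ (E'.functor.obj X)) :
    evS S γ (A.transf A' x X (1 ⊗ₜ z)) = x (A.coe A' X z γ) :=
  evS_ofPair _ _ _

lemma transf_tensor (X Y : DiagCat T₁) (z : E.functor.obj X) (w : E.functor.obj Y)
    (δ : Module.Dual ℚ (E'.functor.obj X ⊗[ℚ] E'.functor.obj Y)) :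
    evS S δ ((AlgebraTensorModule.distribBaseChange ℚ S _ _).symm
      (A.transf A' x X (1 ⊗ₜ z) ⊗ₜ A.transf A' x Y (1 ⊗ₜ w))) =
      x (A.coeTensor A' X Y (z ⊗ₜ w) δ) := by
  -- In finite dimension every functional on the tensor product is a sum of products of functionals.
  -- For a product, the claim is the multiplicativity of `x`.
  obtain ⟨d, rfl⟩ := (TensorProduct.dualDistribEquiv ℚ (E'.functor.obj X)
    (E'.functor.obj Y)).surjective δ
  change evS S (TensorProduct.dualDistrib ℚ _ _ d) _ =
    x (A.coeTensor A' X Y (z ⊗ₜ w) (TensorProduct.dualDistrib ℚ _ _ d))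
  induction d with
  | zero => simp [evS_eq_rid]
  | tmul γ δ => rw [evS_distribBaseChange, coeTensor_dualDistrib, map_mul, evS_transf, evS_transf]
  | add a b ha hb => rw [map_add, map_add, map_add, evS_add, ha, hb]

/-- The tensor transformation of an `S`-valued point. -/
def trans : TensorTrans E.functor E'.functor S where
  app X := A.transf A' x X
  naturality {X Y} f := baseChange_ext fun z γ => by
    rw [LinearMap.comp_apply, LinearMap.comp_apply, evS_baseChange, LinearMap.baseChange_tmul,
      evS_transf, evS_transf, coe_map]
  unit := by
    -- By linearity only the value at $1$ matters, where the coefficient is a multiple of the unit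
    -- of the algebra and `x` preserves that unit.
    refine baseChange_ext (V := ℚ) fun c γ => ?_
    have hc : unitLin E.functor c = c • unitLin E.functor 1 := by
      rw [← map_smul, smul_eq_mul, mul_one]
    have hc' : unitLin E'.functor c = c • unitLin E'.functor 1 := by
      rw [← map_smul, smul_eq_mul, mul_one]
    rw [LinearMap.comp_apply, LinearMap.baseChange_tmul, LinearMap.baseChange_tmul]
    refine (A.evS_transf A' x _ _ γ).trans ?_
    rw [hc, hc', map_smul, LinearMap.smul_apply, map_smul, evS_tmul, map_smul, smul_eq_mul,
      mul_smul]
    refine congrArg (c • ·) ?_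
    refine (congrArg x (A.coe_unit A' γ)).trans ?_
    rw [map_smul, map_one x]
  tensor X Y := by
    refine baseChange_tensor_ext fun z w γ => ?_
    simp only [LinearMap.comp_apply, LinearEquiv.coe_coe, TensorProduct.map_tmul,
      AlgebraTensorModule.distribBaseChange_symm_tmul, mul_one, LinearMap.baseChange_tmul]
    refine (A.evS_transf A' x (DiagCat.tensor X Y) _ γ).trans ?_
    refine (congrArg x (A.coe_tensor A' X Y _ γ)).trans ?_
    exact (A.transf_tensor A' x X Y z w _).symm.trans (evS_baseChange _ _ _).symm

lemma evS_trans_iso (p : D) (v : T.obj p) (γ : Module.Dual ℚ (T'.obj p)) :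
    evS S (γ ∘ₗ (E'.iso p).symm.toLinearMap) ((A.trans A' x).app (DiagCat.tilde T₁ p)
      (1 ⊗ₜ E.iso p v)) = x (CompAlg.coeff T.toRepresentation T'.toRepresentation p v γ) := by
  refine (A.evS_transf A' x (DiagCat.tilde T₁ p) _ _).trans ?_
  rw [coe_iso]
  congr 2
  exact LinearMap.ext fun y => congrArg γ ((E'.iso p).symm_apply_apply y)

end FibreData

namespace DiagCat

variable {T : GradedRep D}

/-- The regular object `End(T|_F)`. -/
def regular (T : GradedRep D) (F : Finset D) : DiagCat T where
  supp := F
  carrier := GHom T T F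
  act := HomOn.compH
  act_one := LinearMap.ext fun a => HomOn.idH_compH a
  act_comp a b := LinearMap.ext fun c => HomOn.compH_assoc a b c

/-- The morphism `End(T|_F) → X` that maps `a` to `a x`. -/
def regularTo (X : DiagCat T) (x : X.carrier) : regular T X.supp ⟶ X :=
  homMk (X := regular T X.supp) (X.act.flip x)
    ⟨X.supp, subset_rfl, subset_rfl, fun a => LinearMap.ext fun b =>
      LinearMap.congr_fun (X.act_comp a b) x⟩

/-- The morphism `End(T|_F) → T̃ p` that maps `a` to `a_p v`. -/
def regularToTilde {F : Finset D} (p : D) (hp : p ∈ F) (v : T.obj p) :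
    regular T F ⟶ tilde T p :=
  homMk (X := regular T F) (Y := tilde T p) ((HomOn.ev p hp).flip v)
    ⟨F, subset_rfl, Finset.singleton_subset_iff.mpr hp, fun _ => rfl⟩

/-- The morphism from the unit object to `T̃ 𝟙` given by `unitVec`. -/
def oneToTilde (T : GradedRep D) : tensorOne T ⟶ tilde T unit :=
  homMk (X := tensorOne T) (Y := tilde T unit) (LinearMap.toSpanSingleton ℚ _ (unitVec T))
    ⟨{unit}, subset_rfl, subset_rfl, fun a => LinearMap.ext_ring (by
      change (HomOn.scal T T a • (1 : ℚ)) • unitVec T =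
        HomOn.ev unit _ a ((1 : ℚ) • unitVec T)
      rw [smul_eq_mul, mul_one, one_smul]
      exact unitCo_smul T _)⟩

end DiagCat

namespace FibreData

variable {T₁ T T' : GradedRep D} {E : TensorExtension T₁ T} {E' : TensorExtension T₁ T'}
  (A : FibreData E) (A' : FibreData E')

-- `oneToTilde` connects the unit object, on which tensor transformations are normalised, with the
-- vertex $\mathbf 1$, whose coefficient is the unit of the algebra.
include A in
lemma map_oneToTilde : mapLin E.functor (DiagCat.oneToTilde T₁) (unitLin E.functor 1) =
    E.iso unit (unitVec T) := by
  have hX := A.source_level (DiagCat.oneToTilde T₁)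
  have hY := A.target_level (DiagCat.oneToTilde T₁)
  refine A.ext_res hY fun b => ?_
  refine (A.out_map _ subset_rfl hX hY _ b).trans (Eq.trans ?_ (A.out_iso unit _ _).symm)
  refine (congrArg (DiagCat.lin (DiagCat.oneToTilde T₁)) (A.out_unit _)).trans ?_
  exact unitCo_smul T₁ _

include A in
/-- The morphisms from the regular object to the objects `T̃ p` are jointly injective. -/
lemma regular_ext (F : Finset D) (z : E.functor.obj (DiagCat.regular T₁ F))
    (h : ∀ p hp v, mapLin E.functor (DiagCat.regularToTilde (F := F) p hp v) z = 0) : z = 0 := by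
  refine A.ext _ z fun b => HomOn.ext_ev fun p hp => LinearMap.ext fun v => ?_
  have e := A.out_map_of (DiagCat.regularToTilde (F := F) p hp v) subset_rfl
    (Finset.singleton_subset_iff.mpr hp) (fun _ => rfl) z b
  rw [h p hp v, map_zero] at e
  exact e.symm

include A in
/-- Each element of `E X` comes from the regular object. -/
lemma exists_regularTo (X : DiagCat T₁) (z : E.functor.obj X) :
    ∃ (x : X.carrier) (w : E.functor.obj (DiagCat.regular T₁ X.supp)),
      mapLin E.functor (DiagCat.regularTo X x) w = z := by
  obtain ⟨c, b, -, hcb⟩ := A.locIso X.supp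
  -- With $x=z(b)$ the morphism $a\mapsto ax$ carries the element of the regular fibre that
  -- corresponds to the identity of $T_1|_F$ to `A.into X c x`, which is $z$.
  refine ⟨A.out X b z, A.into (DiagCat.regular T₁ X.supp) c (HomOn.idH _ _), ?_⟩
  have e := A.map_into (DiagCat.regularTo X (A.out X b z)) (G := X.supp) subset_rfl subset_rfl
    (fun a => LinearMap.ext fun d => LinearMap.congr_fun (X.act_comp a d) (A.out X b z)) c
    (HomOn.idH _ _)
  refine e.trans ?_
  refine Eq.trans ?_ (A.into_out hcb z)
  exact congrArg (A.into X c) (LinearMap.congr_fun X.act_one _)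

-- Naturality along the maps from regular objects to the $\tilde T_1p$ determines the components at
-- regular objects, because these maps are jointly injective on fibres and remain so over $S$.
-- Naturality along maps from regular objects to $X$ then determines the component at $X$, because
-- each element of $E(X)$ is hit by one of them.
include A A' in
lemma trans_ext {S : Type} [CommRing S] [Algebra ℚ S] {f g : TensorTrans E.functor E'.functor S}
    (h : ∀ p, f.app (DiagCat.tilde T₁ p) = g.app (DiagCat.tilde T₁ p)) : f = g := by
  have hR : ∀ F, f.app (DiagCat.regular T₁ F) = g.app (DiagCat.regular T₁ F) := by
    intro F
    refine LinearMap.ext fun w => ?_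
    refine lTensor_joint_ext (κ := Σ p : F, T₁.obj p)
      (fun i => mapLin E'.functor (DiagCat.regularToTilde i.1.1 i.1.2 i.2))
      (fun z hz => A'.regular_ext F z fun p hp v => hz ⟨⟨p, hp⟩, v⟩) fun i => ?_
    have hf := LinearMap.congr_fun (f.naturality (DiagCat.regularToTilde i.1.1 i.1.2 i.2)) w
    have hg := LinearMap.congr_fun (g.naturality (DiagCat.regularToTilde i.1.1 i.1.2 i.2)) w
    rw [LinearMap.comp_apply, LinearMap.comp_apply] at hf hg
    exact hf.symm.trans ((LinearMap.congr_fun (h _) _).trans hg)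
  refine TensorTrans.ext (funext fun X => baseChange_ext fun z γ => congrArg (evS S γ) ?_)
  obtain ⟨x, w, rfl⟩ := A.exists_regularTo X z
  have hf := LinearMap.congr_fun (f.naturality (DiagCat.regularTo X x)) (1 ⊗ₜ w)
  have hg := LinearMap.congr_fun (g.naturality (DiagCat.regularTo X x)) (1 ⊗ₜ w)
  rw [LinearMap.comp_apply, LinearMap.comp_apply, LinearMap.baseChange_tmul] at hf hg
  rw [hf, hg, hR]

/-- The matrix coefficients of a tensor transformation are multiplicative. -/
lemma _root_.NoriDiagram.TensorTrans.evS_mul {S : Type} [CommRing S] [Algebra ℚ S]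
    (f : TensorTrans E.functor E'.functor S) (p q : D) (v : T.obj p) (w : T.obj q)
    (γ : Module.Dual ℚ (T'.obj p)) (δ : Module.Dual ℚ (T'.obj q)) :
    evS S ((TensorProduct.dualDistrib ℚ _ _ (γ ⊗ₜ δ) ∘ₗ (T'.τ p q).toLinearMap) ∘ₗ
        (E'.iso (mul p q)).symm.toLinearMap)
      (f.app (DiagCat.tilde T₁ (mul p q)) (1 ⊗ₜ E.iso (mul p q) ((T.τ p q).symm (v ⊗ₜ w)))) =
    evS S (γ ∘ₗ (E'.iso p).symm.toLinearMap) (f.app (DiagCat.tilde T₁ p) (1 ⊗ₜ E.iso p v)) *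
      evS S (δ ∘ₗ (E'.iso q).symm.toLinearMap) (f.app (DiagCat.tilde T₁ q) (1 ⊗ₜ E.iso q w)) := by
  -- The functional $\gamma\otimes\delta$ is moved to the fibre of $\tilde T_1p\otimes\tilde T_1q$.
  -- Compatibility of both extensions with $\tau$ and naturality along `tildeτ` then replace the
  -- vertex $p\times q$ by this tensor product.
  let κ : Module.Dual ℚ (E'.functor.obj (DiagCat.tilde T₁ p ⊗ DiagCat.tilde T₁ q)) :=
    TensorProduct.dualDistrib ℚ _ _ ((γ ∘ₗ (E'.iso p).symm.toLinearMap) ⊗ₜ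
      (δ ∘ₗ (E'.iso q).symm.toLinearMap)) ∘ₗ tensorInv E'.functor _ _
  have hκ : (TensorProduct.dualDistrib ℚ _ _ (γ ⊗ₜ δ) ∘ₗ (T'.τ p q).toLinearMap) ∘ₗ
      (E'.iso (mul p q)).symm.toLinearMap =
      κ ∘ₗ mapLin E'.functor (DiagCat.tildeτ T₁ p q).hom := by
    refine LinearMap.ext fun y => ?_
    obtain ⟨y, rfl⟩ := (E'.iso (mul p q)).surjective y
    have e := LinearMap.congr_fun (E'.iso_τ p q) y
    simp only [LinearMap.comp_apply, LinearEquiv.coe_coe] at e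
    simp only [LinearMap.comp_apply, LinearEquiv.coe_coe, LinearEquiv.symm_apply_apply, κ]
    refine Eq.trans ?_ (congrArg (fun s => TensorProduct.dualDistrib ℚ _ _
      ((γ ∘ₗ (E'.iso p).symm.toLinearMap) ⊗ₜ (δ ∘ₗ (E'.iso q).symm.toLinearMap))
        (tensorInv E'.functor _ _ s)) e).symm
    rw [tensorInv_tensorLin]
    generalize T'.τ p q y = t
    induction t with
    | zero => simp
    | tmul a b => simp
    | add a b ha hb => simp only [map_add, ha, hb]
  have hκ' : κ ∘ₗ tensorLin E'.functor _ _ = TensorProduct.dualDistrib ℚ _ _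
      ((γ ∘ₗ (E'.iso p).symm.toLinearMap) ⊗ₜ (δ ∘ₗ (E'.iso q).symm.toLinearMap)) :=
    LinearMap.ext fun t => congrArg (TensorProduct.dualDistrib ℚ _ _
      ((γ ∘ₗ (E'.iso p).symm.toLinearMap) ⊗ₜ (δ ∘ₗ (E'.iso q).symm.toLinearMap)))
        (tensorInv_tensorLin E'.functor _ _ t)
  have e1 := LinearMap.congr_fun (E.iso_τ p q) ((T.τ p q).symm (v ⊗ₜ w))
  simp only [LinearMap.comp_apply, LinearEquiv.coe_coe, LinearEquiv.apply_symm_apply,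
    TensorProduct.map_tmul] at e1
  have e2 := LinearMap.congr_fun (f.naturality (DiagCat.tildeτ T₁ p q).hom)
    (1 ⊗ₜ E.iso (mul p q) ((T.τ p q).symm (v ⊗ₜ w)))
  rw [LinearMap.comp_apply, LinearMap.comp_apply, LinearMap.baseChange_tmul, e1] at e2
  have e3 := LinearMap.congr_fun (f.tensor (DiagCat.tilde T₁ p) (DiagCat.tilde T₁ q))
    ((1 ⊗ₜ E.iso p v) ⊗ₜ (1 ⊗ₜ E.iso q w))
  simp only [LinearMap.comp_apply, LinearEquiv.coe_coe, TensorProduct.map_tmul,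
    AlgebraTensorModule.distribBaseChange_symm_tmul, mul_one, LinearMap.baseChange_tmul] at e3
  rw [hκ, ← evS_baseChange, ← e2, e3, evS_baseChange, hκ', evS_distribBaseChange]

-- The components at the $\tilde T_1p$ form a natural family on the diagram, which gives a linear
-- form on $A_{T,T'}$ with the required coefficients. Unit and tensor compatibility of $f$ make it
-- an algebra homomorphism.
include A A' in
lemma exists_point {S : Type} [CommRing S] [Algebra ℚ S] (f : TensorTrans E.functor E'.functor S) :
    ∃ x : CompAlg T.toRepresentation T'.toRepresentation →ₐ[ℚ] S, ∀ p v γ,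
      x (CompAlg.coeff T.toRepresentation T'.toRepresentation p v γ) =
        evS S (γ ∘ₗ (E'.iso p).symm.toLinearMap) (f.app (DiagCat.tilde T₁ p)
          (1 ⊗ₜ E.iso p v)) := by
  let g : ∀ p, T.obj p →ₗ[ℚ] S ⊗[ℚ] T'.obj p := fun p =>
    (E'.iso p).symm.toLinearMap.lTensor S ∘ₗ (f.app (DiagCat.tilde T₁ p)).restrictScalars ℚ ∘ₗ
      TensorProduct.mk ℚ S _ 1 ∘ₗ (E.iso p).toLinearMap
  have hg : ∀ {p q : D} (m : p ⟶ q) v, g q (T.map m v) = (T'.map m).lTensor S (g p v) := by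
    intro p q m v
    have e1 := LinearMap.congr_fun (E.iso_map m) v
    have e2 := LinearMap.congr_fun (f.naturality (DiagCat.tildeMap m)) (1 ⊗ₜ E.iso p v)
    rw [LinearMap.comp_apply, LinearMap.comp_apply, LinearMap.baseChange_tmul] at e2
    have e3 : (E'.iso q).symm.toLinearMap ∘ₗ mapLin E'.functor (DiagCat.tildeMap m) =
        T'.map m ∘ₗ (E'.iso p).symm.toLinearMap := by
      refine LinearMap.ext fun y => ?_
      obtain ⟨y, rfl⟩ := (E'.iso p).surjective y
      have e := LinearMap.congr_fun (E'.iso_map m) y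
      simp only [LinearMap.comp_apply, LinearEquiv.coe_coe] at e ⊢
      rw [← e, LinearEquiv.symm_apply_apply, LinearEquiv.symm_apply_apply]
    change (E'.iso q).symm.toLinearMap.lTensor S (f.app (DiagCat.tilde T₁ q)
      (1 ⊗ₜ E.iso q (T.map m v))) = (T'.map m).lTensor S ((E'.iso p).symm.toLinearMap.lTensor S
        (f.app (DiagCat.tilde T₁ p) (1 ⊗ₜ E.iso p v)))
    have e4 : f.app (DiagCat.tilde T₁ q) (1 ⊗ₜ E.iso q (T.map m v)) =
        (mapLin E'.functor (DiagCat.tildeMap m)).lTensor S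
          (f.app (DiagCat.tilde T₁ p) (1 ⊗ₜ E.iso p v)) :=
      (congrArg (fun y => f.app (DiagCat.tilde T₁ q) (1 ⊗ₜ y)) e1).trans e2
    rw [e4, ← LinearMap.comp_apply, ← LinearMap.comp_apply, ← LinearMap.lTensor_comp,
      ← LinearMap.lTensor_comp, e3]
  obtain ⟨x, hx⟩ := exists_linear_of_family g hg
  have hx' : ∀ p v γ, x (CompAlg.coeff T.toRepresentation T'.toRepresentation p v γ) =
      evS S (γ ∘ₗ (E'.iso p).symm.toLinearMap) (f.app (DiagCat.tilde T₁ p)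
        (1 ⊗ₜ E.iso p v)) := fun p v γ => (hx p v γ).trans (evS_baseChange _ _ _)
  refine ⟨AlgHom.ofLinearMap x ?_ fun a b => ?_, hx'⟩
  -- The unit of the algebra is the coefficient at the vertex $\mathbf 1$; naturality along
  -- `oneToTilde` and unit compatibility of $f$ show that its value is $1$.
  · have e := LinearMap.congr_fun (f.naturality (DiagCat.oneToTilde T₁))
      (1 ⊗ₜ unitLin E.functor 1)
    have e1 := LinearMap.congr_fun f.unit (1 ⊗ₜ 1)
    rw [LinearMap.comp_apply, LinearMap.baseChange_tmul, LinearMap.baseChange_tmul] at e1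
    rw [LinearMap.comp_apply, LinearMap.comp_apply, LinearMap.baseChange_tmul,
      A.map_oneToTilde] at e
    have e2 := e.trans (congrArg ((mapLin E'.functor (DiagCat.oneToTilde T₁)).baseChange S) e1)
    rw [LinearMap.baseChange_tmul] at e2
    have e3 := e2.trans (congrArg (fun y => (1 : S) ⊗ₜ[ℚ] y) A'.map_oneToTilde)
    rw [CompAlg.one_eq_coeff, hx', e3, evS_tmul, LinearMap.comp_apply, LinearEquiv.coe_coe,
      LinearEquiv.symm_apply_apply, unitCo_unitVec, one_smul]
  -- Matrix coefficients span, so multiplicativity needs checking only on two of them.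
  · induction a using CompAlg.coeff_induction with
    | h0 => rw [zero_mul, map_zero, zero_mul]
    | hadd a a' ha ha' => rw [add_mul, map_add, map_add, ha, ha', add_mul]
    | hsmul c a ha => rw [smul_mul_assoc, map_smul, map_smul, ha, smul_mul_assoc]
    | hcoeff p v γ =>
    induction b using CompAlg.coeff_induction with
    | h0 => rw [mul_zero, map_zero, mul_zero]
    | hadd a a' ha ha' => rw [mul_add, map_add, map_add, ha, ha', mul_add]
    | hsmul c a ha => rw [mul_smul_comm, map_smul, map_smul, ha, mul_smul_comm]
    | hcoeff q w δ =>
    rw [CompAlg.coeff_mul_coeff, hx', hx', hx']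
    exact f.evS_mul p q v w γ δ

/-- The `S`-valued points of `Spec A_{T,T'}` are the tensor transformations over `S`. -/
def pointEquiv (S : Type) [CommRing S] [Algebra ℚ S] :
    (CompAlg T.toRepresentation T'.toRepresentation →ₐ[ℚ] S) ≃
      TensorTrans E.functor E'.functor S where
  toFun x := A.trans A' x
  invFun f := (A.exists_point A' f).choose
  left_inv x := AlgHom.toLinearMap_injective (CompAlg.linear_ext fun p v γ =>
    ((A.exists_point A' (A.trans A' x)).choose_spec p v γ).trans (A.evS_trans_iso A' x p v γ))
  -- A transformation is determined at the objects $\tilde T_1p$, where the matrix coefficients of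
  -- both sides agree by the choice of the point.
  right_inv f := A.trans_ext A' fun p => baseChange_ext fun z γ => by
    obtain ⟨v, rfl⟩ := (E.iso p).surjective z
    have hγ : γ = (γ ∘ₗ (E'.iso p).toLinearMap) ∘ₗ (E'.iso p).symm.toLinearMap :=
      LinearMap.ext fun y => congrArg γ ((E'.iso p).apply_symm_apply y).symm
    rw [hγ, evS_trans_iso, (A.exists_point A' f).choose_spec]

lemma trans_rTensor {S S' : Type} [CommRing S] [Algebra ℚ S] [CommRing S'] [Algebra ℚ S']
    (a : S →ₐ[ℚ] S') (x : CompAlg T.toRepresentation T'.toRepresentation →ₐ[ℚ] S)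
    (X : DiagCat T₁) (z : S ⊗[ℚ] E.functor.obj X) :
    (A.trans A' (a.comp x)).app X (a.toLinearMap.rTensor (E.functor.obj X) z) =
      a.toLinearMap.rTensor (E'.functor.obj X) ((A.trans A' x).app X z) := by
  induction z with
  | zero => simp
  | add y z hy hz => simp only [map_add, hy, hz]
  | tmul s z =>
    refine evS_ext fun γ => ?_
    rw [evS_rTensor, LinearMap.rTensor_tmul, tmul_eq_smul_one_tmul s z,
      tmul_eq_smul_one_tmul _ z, map_smul, map_smul, map_smul, map_smul, smul_eq_mul, smul_eq_mul,
      map_mul]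
    exact congrArg (a s * ·) ((A.evS_transf A' _ X z γ).trans
      (congrArg a (A.evS_transf A' x X z γ).symm))

end FibreData

/-! ### Affine schemes over the rationals and their points. -/

section Affine

open CartesianMonoidalCategory

lemma algSpec_map_bijective (R : CommRingCat.{0}) (X Y : (CommAlgCat R)ᵒᵖ) :
    Function.Bijective (fun f : X ⟶ Y => (AlgebraicGeometry.algSpec R).map f) :=
  ⟨(AlgebraicGeometry.algSpec R).map_injective, (AlgebraicGeometry.algSpec R).map_surjective⟩

lemma nonempty_algSpec_tensor (R : CommRingCat.{0}) (X Y : (CommAlgCat R)ᵒᵖ) :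
    Nonempty ((AlgebraicGeometry.algSpec R).obj X ⊗ (AlgebraicGeometry.algSpec R).obj Y ≅
      (AlgebraicGeometry.algSpec R).obj (X ⊗ Y)) :=
  ⟨Functor.Monoidal.μIso (AlgebraicGeometry.algSpec R) X Y⟩

lemma nonempty_algSpec_unit (R : CommRingCat.{0}) :
    Nonempty (𝟙_ (Over (AlgebraicGeometry.Spec R)) ≅
      (AlgebraicGeometry.algSpec R).obj (𝟙_ (CommAlgCat R)ᵒᵖ)) :=
  ⟨Functor.Monoidal.εIso (AlgebraicGeometry.algSpec R)⟩

lemma specQMap_bijective (S B : Type) [CommRing S] [Algebra ℚ S] [CommRing B] [Algebra ℚ B] :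
    Function.Bijective (specQMap : (B →ₐ[ℚ] S) → (specQ S ⟶ specQ B)) := by
  have h := algSpec_map_bijective (.of ℚ) (.op (CommAlgCat.of ℚ S)) (.op (CommAlgCat.of ℚ B))
  refine ⟨fun a b hab => ?_, fun x => ?_⟩
  · exact congrArg (fun k => k.unop.hom) (h.1 hab)
  · obtain ⟨k, hk⟩ := h.2 x
    exact ⟨k.unop.hom, hk⟩

/-- Morphisms of affine schemes over `ℚ` are homomorphisms of algebras. -/
def specQEquiv (S B : Type) [CommRing S] [Algebra ℚ S] [CommRing B] [Algebra ℚ B] :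
    (specQ S ⟶ specQ B) ≃ (B →ₐ[ℚ] S) :=
  (Equiv.ofBijective specQMap (specQMap_bijective S B)).symm

lemma specQMap_comp {S S' B : Type} [CommRing S] [Algebra ℚ S] [CommRing S'] [Algebra ℚ S']
    [CommRing B] [Algebra ℚ B] (a : S →ₐ[ℚ] S') (b : B →ₐ[ℚ] S) :
    specQMap (a.comp b) = specQMap a ≫ specQMap b :=
  (AlgebraicGeometry.algSpec (.of ℚ)).map_comp (CommAlgCat.ofHom a).op (CommAlgCat.ofHom b).op

/-- A scheme over `ℚ` is the spectrum of a `ℚ`-algebra. -/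
def IsAffineQ (P : Over (AlgebraicGeometry.Spec (.of ℚ))) : Prop :=
  ∃ (B : Type) (_ : CommRing B) (_ : Algebra ℚ B), Nonempty (P ≅ specQ B)

namespace IsAffineQ

variable {P Q : Over (AlgebraicGeometry.Spec (.of ℚ))}

lemma specQ (B : Type) [CommRing B] [Algebra ℚ B] : IsAffineQ (specQ B) :=
  ⟨B, inferInstance, inferInstance, ⟨Iso.refl _⟩⟩

lemma tensor (hP : IsAffineQ P) (hQ : IsAffineQ Q) : IsAffineQ (P ⊗ Q) := by
  obtain ⟨A, _, _, ⟨e⟩⟩ := hP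
  obtain ⟨B, _, _, ⟨e'⟩⟩ := hQ
  obtain ⟨μ⟩ := nonempty_algSpec_tensor (.of ℚ) (.op (CommAlgCat.of ℚ A))
    (.op (CommAlgCat.of ℚ B))
  exact ⟨A ⊗[ℚ] B, inferInstance, inferInstance, ⟨(e ⊗ᵢ e') ≪≫ μ⟩⟩

lemma unit : IsAffineQ (𝟙_ (Over (AlgebraicGeometry.Spec (.of ℚ)))) :=
  ⟨ℚ, inferInstance, inferInstance, nonempty_algSpec_unit (.of ℚ)⟩

/-- Morphisms from an affine scheme are determined by their effect on points. -/
lemma hom_ext (hP : IsAffineQ P) {m m' : P ⟶ Q}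
    (h : ∀ (S : Type) [CommRing S] [Algebra ℚ S] (y : NoriDiagram.specQ S ⟶ P), y ≫ m = y ≫ m') :
    m = m' := by
  obtain ⟨B, _, _, ⟨e⟩⟩ := hP
  -- The inverse of the chart is itself a point with values in $B$, the universal one, so testing at
  -- this point suffices.
  exact (cancel_epi e.inv).mp (h B e.inv)

end IsAffineQ

end Affine

/-! ### The groupoid of tensor isomorphisms and its base change. -/

namespace TensorIso

variable {C : Type u} [Category.{w} C] [MonoidalCategory C]
  {ω η θ κ : C ⥤ FGModuleCat.{0} ℚ} [ω.Monoidal] [η.Monoidal] [θ.Monoidal] [κ.Monoidal]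
  {S : Type} [CommRing S] [Algebra ℚ S]

/-- The identity. -/
def refl (ω : C ⥤ FGModuleCat.{0} ℚ) [ω.Monoidal] (S : Type) [CommRing S] [Algebra ℚ S] :
    TensorIso ω ω S where
  app X := LinearEquiv.refl S _
  naturality _ := rfl
  unit := rfl
  tensor X Y := by
    rw [LinearEquiv.refl_toLinearMap, LinearEquiv.refl_toLinearMap, LinearEquiv.refl_toLinearMap,
      TensorProduct.map_id]
    rfl

lemma refl_trans (f : TensorIso ω η S) : (refl ω S).trans f = f := rfl

lemma trans_refl (f : TensorIso ω η S) : f.trans (refl η S) = f := rfl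

lemma trans_assoc (f : TensorIso ω η S) (g : TensorIso η θ S) (h : TensorIso θ κ S) :
    (f.trans g).trans h = f.trans (g.trans h) := rfl

lemma symm_symm (f : TensorIso ω η S) : f.symm.symm = f := rfl

lemma symm_trans (f : TensorIso ω η S) (g : TensorIso η θ S) :
    (f.trans g).symm = g.symm.trans f.symm := rfl

lemma self_trans_symm (f : TensorIso ω η S) : f.trans f.symm = refl ω S :=
  TensorIso.ext (funext fun X => (f.app X).self_trans_symm)

lemma symm_trans_self (f : TensorIso ω η S) : f.symm.trans f = refl η S :=
  TensorIso.ext (funext fun X => (f.app X).symm_trans_self)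

/-- Two tensor isomorphisms that agree on the image of a base change are equal. -/
lemma ext_rTensor {B : Type} [CommRing B] [Algebra ℚ B] (b : B →ₐ[ℚ] S) {f g : TensorIso ω η S}
    (h : ∀ X (z : B ⊗[ℚ] ω.obj X), f.app X (b.toLinearMap.rTensor _ z) =
      g.app X (b.toLinearMap.rTensor _ z)) : f = g := by
  refine TensorIso.ext (funext fun X => LinearEquiv.toLinearMap_injective
    (AlgebraTensorModule.curry_injective (LinearMap.ext_ring (LinearMap.ext fun z => ?_))))
  -- Elements $1\otimes z$ come from $B$ and generate $S\otimes\omega(X)$ over $S$.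
  have := h X (1 ⊗ₜ z)
  rw [LinearMap.rTensor_tmul, AlgHom.toLinearMap_apply, map_one] at this
  exact this

/-- `f'` is the base change of `f` along `a`. -/
def IsBaseChange {S' : Type} [CommRing S'] [Algebra ℚ S'] (a : S →ₐ[ℚ] S')
    (f : TensorIso ω η S) (f' : TensorIso ω η S') : Prop :=
  ∀ X (z : S ⊗[ℚ] ω.obj X), f'.app X (a.toLinearMap.rTensor _ z) =
    a.toLinearMap.rTensor _ (f.app X z)

namespace IsBaseChange

variable {S' : Type} [CommRing S'] [Algebra ℚ S'] {a : S →ₐ[ℚ] S'}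

lemma refl : IsBaseChange a (refl ω S) (TensorIso.refl ω S') := fun _ _ => rfl

lemma trans {f : TensorIso ω η S} {f' : TensorIso ω η S'} {g : TensorIso η θ S}
    {g' : TensorIso η θ S'} (hf : IsBaseChange a f f') (hg : IsBaseChange a g g') :
    IsBaseChange a (f.trans g) (f'.trans g') := fun X z =>
  (congrArg (g'.app X) (hf X z)).trans (hg X _)

lemma symm {f : TensorIso ω η S} {f' : TensorIso ω η S'} (hf : IsBaseChange a f f') :
    IsBaseChange a f.symm f'.symm := fun X z => by
  refine (f'.app X).injective (((f'.app X).apply_symm_apply _).trans ?_)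
  refine Eq.trans ?_ (hf X _).symm
  exact congrArg _ ((f.app X).apply_symm_apply z).symm

end IsBaseChange

end TensorIso

/-! ### Representability and the morphisms given by composition and inversion. -/

section Represent

variable {D : Type} [ProductDiagram.{v} D]
  {T₁ T T' T'' : GradedRep D} {E'' : TensorExtension T₁ T''} {E' : TensorExtension T₁ T'}
  {E : TensorExtension T₁ T}

/-- The `S`-valued points of `Spec A_{T,T'}` are the tensor isomorphisms over `S`. -/
def FibreData.ptEquiv [RigidCategory (DiagCat T₁)] (A : FibreData E) (A' : FibreData E')
    (S : Type) [CommRing S] [Algebra ℚ S] :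
    (specQ S ⟶ compScheme T T') ≃ TensorIso E.functor E'.functor S :=
  (specQEquiv S (CompAlg T.toRepresentation T'.toRepresentation)).trans
    ((A.pointEquiv A' S).trans
      (TensorTrans.equivIso fun X => (A.finrank_eq X).trans (A'.finrank_eq X).symm))

lemma FibreData.ptEquiv_specQMap [RigidCategory (DiagCat T₁)] (A : FibreData E)
    (A' : FibreData E') {S : Type} [CommRing S] [Algebra ℚ S]
    (x : CompAlg T.toRepresentation T'.toRepresentation →ₐ[ℚ] S) (X : DiagCat T₁)
    (z : S ⊗[ℚ] E.functor.obj X) :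
    (A.ptEquiv A' S (specQMap x)).app X z = (A.trans A' x).app X z := by
  have h : specQEquiv S _ (specQMap x) = x :=
    (specQEquiv S (CompAlg T.toRepresentation T'.toRepresentation)).apply_symm_apply x
  exact congrArg (fun y => (A.trans A' y).app X z) h

/-- `Spec A_{T,T'}` represents the tensor isomorphisms if `C(T₁)` is rigid. -/
def FibreData.representsIso [RigidCategory (DiagCat T₁)] (A : FibreData E) (A' : FibreData E') :
    RepresentsIso E E' where
  pt S _ _ := A.ptEquiv A' S
  natural {S S'} _ _ _ _ a x X z := by
    obtain ⟨y, rfl⟩ := (specQMap_bijective S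
      (CompAlg T.toRepresentation T'.toRepresentation)).2 x
    refine (congrArg (fun k => (A.ptEquiv A' S' k).app X (a.toLinearMap.rTensor _ z))
      (specQMap_comp a y).symm).trans ?_
    refine (A.ptEquiv_specQMap A' _ X _).trans ((A.trans_rTensor A' a y X z).trans ?_)
    exact congrArg _ (A.ptEquiv_specQMap A' y X z).symm
  coeff {S} _ _ x p v γ := by
    refine (A.evS_trans_iso A' x p v γ).symm.trans ?_
    exact congrArg (evS S (γ ∘ₗ (E'.iso p).symm.toLinearMap))
      (A.ptEquiv_specQMap A' x _ _).symm

lemma isAffineQ_compScheme (T T' : GradedRep D) : IsAffineQ (compScheme T T') := IsAffineQ.specQ _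

namespace RepresentsIso

lemma isBaseChange (r : RepresentsIso E E') {S S' : Type} [CommRing S] [Algebra ℚ S] [CommRing S']
    [Algebra ℚ S'] (a : S →ₐ[ℚ] S') (x : specQ S ⟶ compScheme T T') :
    (r.pt S x).IsBaseChange a (r.pt S' (specQMap a ≫ x)) := fun X z => r.natural a x X z

/-- A functorial family of tensor isomorphisms on an affine scheme is given by a morphism. -/
lemma exists_hom (r : RepresentsIso E E') {P : Over (AlgebraicGeometry.Spec (.of ℚ))}
    (hP : IsAffineQ P) (F : ∀ (S : Type) [CommRing S] [Algebra ℚ S], (specQ S ⟶ P) →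
      TensorIso E.functor E'.functor S)
    (hF : ∀ {S S' : Type} [CommRing S] [Algebra ℚ S] [CommRing S'] [Algebra ℚ S']
      (a : S →ₐ[ℚ] S') (y : specQ S ⟶ P), (F S y).IsBaseChange a (F S' (specQMap a ≫ y))) :
    ∃ m : P ⟶ compScheme T T', ∀ (S : Type) [CommRing S] [Algebra ℚ S] (y : specQ S ⟶ P),
      r.pt S (y ≫ m) = F S y := by
  obtain ⟨B, _, _, ⟨e⟩⟩ := hP
  -- The morphism classifies the value of the family at the universal point `e.inv`. Any other point
  -- is the pullback of this one along some $b:B\to S$, and compatibility with base change fixes the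
  -- value there.
  refine ⟨e.hom ≫ (r.pt B).symm (F B e.inv), fun S _ _ y => ?_⟩
  obtain ⟨b, hb⟩ := (specQEquiv S B).symm.surjective (y ≫ e.hom)
  have hb' : specQMap b = y ≫ e.hom := hb
  refine TensorIso.ext_rTensor b fun X z => ?_
  have h1 := r.isBaseChange b ((r.pt B).symm (F B e.inv)) X z
  have h2 := hF b e.inv X z
  rw [hb', Category.assoc, Equiv.apply_symm_apply] at h1
  rw [hb', Category.assoc, e.hom_inv_id, Category.comp_id] at h2
  exact h1.trans h2.symm

/-- Morphisms from an affine scheme are determined by tensor isomorphisms. -/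
lemma hom_ext (r : RepresentsIso E E') {P : Over (AlgebraicGeometry.Spec (.of ℚ))}
    (hP : IsAffineQ P) {m m' : P ⟶ compScheme T T'}
    (h : ∀ (S : Type) [CommRing S] [Algebra ℚ S] (y : specQ S ⟶ P),
      r.pt S (y ≫ m) = r.pt S (y ≫ m')) : m = m' :=
  hP.hom_ext fun S _ _ y => (r.pt S).injective (h S y)

open CartesianMonoidalCategory

/-- The product of two affine schemes is affine, and composing the isomorphisms given by the two
projections is a functorial family on it. -/
lemma exists_isComposition (r : RepresentsIso E E') (r' : RepresentsIso E' E'')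
    (r'' : RepresentsIso E E'') :
    ∃ m : compScheme T T' ⊗ compScheme T' T'' ⟶ compScheme T T'', IsComposition r r' r'' m := by
  obtain ⟨m, hm⟩ := r''.exists_hom
    ((isAffineQ_compScheme T T').tensor (isAffineQ_compScheme T' T''))
    (fun S _ _ y => (r.pt S (y ≫ fst _ _)).trans (r'.pt S (y ≫ snd _ _)))
    (fun a y => by
      simp only [Category.assoc]
      exact (r.isBaseChange a _).trans (r'.isBaseChange a _))
  refine ⟨m, fun S _ _ x y => ?_⟩
  rw [hm, lift_fst, lift_snd]

lemma exists_inversion (r : RepresentsIso E E') (r' : RepresentsIso E' E) :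
    ∃ ι : compScheme T T' ≅ compScheme T' T,
      (∀ (S : Type) [CommRing S] [Algebra ℚ S] (x : specQ S ⟶ compScheme T T'),
        r'.pt S (x ≫ ι.hom) = (r.pt S x).symm) ∧
      ∀ (S : Type) [CommRing S] [Algebra ℚ S] (x : specQ S ⟶ compScheme T' T),
        r.pt S (x ≫ ι.inv) = (r'.pt S x).symm := by
  obtain ⟨m, hm⟩ := r'.exists_hom (isAffineQ_compScheme T T')
    (fun S _ _ y => (r.pt S y).symm) (fun a y => (r.isBaseChange a _).symm)
  obtain ⟨n, hn⟩ := r.exists_hom (isAffineQ_compScheme T' T)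
    (fun S _ _ y => (r'.pt S y).symm) (fun a y => (r'.isBaseChange a _).symm)
  -- On points both composites invert twice.
  refine ⟨⟨m, n, ?_, ?_⟩, hm, hn⟩
  · refine r.hom_ext (isAffineQ_compScheme T T') fun S _ _ y => ?_
    rw [← Category.assoc, hn, hm, Category.comp_id, TensorIso.symm_symm]
  · refine r'.hom_ext (isAffineQ_compScheme T' T) fun S _ _ y => ?_
    rw [← Category.assoc, hm, hn, Category.comp_id, TensorIso.symm_symm]

/-- The group scheme structure given by composition. -/
lemma exists_grpObj (r : RepresentsIso E E) :
    ∃ g : GrpObj (compScheme T T), IsComposition r r r g.toMonObj.mul := by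
  have hX := isAffineQ_compScheme T T
  obtain ⟨m, hm⟩ := r.exists_isComposition r r
  -- The neutral element classifies the constant family of identities on the affine terminal object.
  obtain ⟨e, he⟩ := r.exists_hom IsAffineQ.unit (fun S _ _ _ => TensorIso.refl E.functor S)
    (fun _ _ => TensorIso.IsBaseChange.refl)
  obtain ⟨i, hi⟩ := r.exists_hom hX (fun S _ _ y => (r.pt S y).symm)
    (fun a y => (r.isBaseChange a _).symm)
  -- Source schemes in the group axioms are products of affine schemes, so each axiom can be tested
  -- on points, where it becomes a law for composing and inverting isomorphisms.
  refine ⟨{ one := e, mul := m, inv := i, one_mul := ?_, mul_one := ?_, mul_assoc := ?_,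
            left_inv := ?_, right_inv := ?_ }, hm⟩
  · refine r.hom_ext (IsAffineQ.unit.tensor hX) fun S _ _ y => ?_
    have h : y ≫ e ▷ compScheme T T = lift (y ≫ fst _ _ ≫ e) (y ≫ snd _ _) := by
      ext1 <;> simp
    rw [← Category.assoc, h, hm, ← Category.assoc, he, TensorIso.refl_trans, leftUnitor_hom]
  · refine r.hom_ext (hX.tensor IsAffineQ.unit) fun S _ _ y => ?_
    have h : y ≫ compScheme T T ◁ e = lift (y ≫ fst _ _) (y ≫ snd _ _ ≫ e) := by
      ext1 <;> simp
    rw [← Category.assoc, h, hm, ← Category.assoc, he, TensorIso.trans_refl, rightUnitor_hom]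
  · refine r.hom_ext ((hX.tensor hX).tensor hX) fun S _ _ y => ?_
    have h1 : y ≫ m ▷ compScheme T T =
        lift (lift (y ≫ fst _ _ ≫ fst _ _) (y ≫ fst _ _ ≫ snd _ _) ≫ m) (y ≫ snd _ _) := by
      have : lift (y ≫ fst _ _ ≫ fst _ _) (y ≫ fst _ _ ≫ snd _ _) = y ≫ fst _ _ := by
        ext1 <;> simp
      rw [this]
      ext1 <;> simp
    have h2 : y ≫ (α_ _ _ _).hom ≫ compScheme T T ◁ m =
        lift (y ≫ fst _ _ ≫ fst _ _) (lift (y ≫ fst _ _ ≫ snd _ _) (y ≫ snd _ _) ≫ m) := by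
      ext1
      · simp
      · simp only [Category.assoc, lift_snd, whiskerLeft_snd]
        rw [← Category.assoc, ← Category.assoc]
        congr 1
        ext1 <;> simp
    rw [← Category.assoc, h1, hm, hm]
    simp only [← Category.assoc] at h2 ⊢
    rw [h2, hm, hm, TensorIso.trans_assoc]
  · refine r.hom_ext hX fun S _ _ y => ?_
    have h : y ≫ lift i (𝟙 _) = lift (y ≫ i) y := by ext1 <;> simp
    rw [← Category.assoc, h, hm, hi, TensorIso.symm_trans_self, ← Category.assoc, he]
  · refine r.hom_ext hX fun S _ _ y => ?_
    have h : y ≫ lift (𝟙 _) i = lift y (y ≫ i) := by ext1 <;> simp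
    rw [← Category.assoc, h, hm, hi, TensorIso.self_trans_symm, ← Category.assoc, he]

end RepresentsIso
end Represent

/-! ### Torsor structures and their factorisations. -/

section Torsor

open CartesianMonoidalCategory

lemma comp_ternary {C : Type u} [Category.{w} C] [CartesianMonoidalCategory C] {X : C}
    (t : X ⊗ X ⊗ X ⟶ X) {Y Z : C} (g : Z ⟶ Y) (x y z : Y ⟶ X) :
    g ≫ ternary t x y z = ternary t (g ≫ x) (g ≫ y) (g ≫ z) := by
  simp only [ternary, ← Category.assoc, comp_lift]

/-- Any five points with values in an arbitrary scheme are pulled back from the five projections of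
$X^5$. Identities in five variables thus reduce to this one source, which is affine for affine $X$
even when the test scheme is not. -/
lemma exists_generic_points {C : Type u} [Category.{w} C] [CartesianMonoidalCategory C] (X : C) :
    ∃ q₁ q₂ q₃ q₄ q₅ : X ⊗ X ⊗ X ⊗ X ⊗ X ⟶ X, ∀ {Y : C} (x y z u v : Y ⟶ X),
      ∃ g, g ≫ q₁ = x ∧ g ≫ q₂ = y ∧ g ≫ q₃ = z ∧ g ≫ q₄ = u ∧ g ≫ q₅ = v :=
  ⟨fst _ _, snd _ _ ≫ fst _ _, snd _ _ ≫ snd _ _ ≫ fst _ _,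
    snd _ _ ≫ snd _ _ ≫ snd _ _ ≫ fst _ _, snd _ _ ≫ snd _ _ ≫ snd _ _ ≫ snd _ _,
    fun x y z u v => ⟨lift x (lift y (lift z (lift u v))), by simp⟩⟩

variable {D : Type} [ProductDiagram.{v} D]
  {T₁ T T' T'' : GradedRep D} {E : TensorExtension T₁ T} {E' : TensorExtension T₁ T'}

namespace RepresentsIso

/-- A morphism given on points by `f g⁻¹ h` is a torsor structure. -/
lemma isTorsor (r : RepresentsIso E E')
    {t : compScheme T T' ⊗ compScheme T T' ⊗ compScheme T T' ⟶ compScheme T T'}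
    (ht : ∀ (S : Type) [CommRing S] [Algebra ℚ S] (x y z : specQ S ⟶ compScheme T T'),
      r.pt S (ternary t x y z) = ((r.pt S x).trans (r.pt S y).symm).trans (r.pt S z)) :
    IsTorsor t := by
  have hX := isAffineQ_compScheme T T'
  obtain ⟨q₁, q₂, q₃, q₄, q₅, hq⟩ := exists_generic_points (compScheme T T')
  have h5 := @hom_ext _ _ _ _ _ _ _ r _ (hX.tensor (hX.tensor (hX.tensor (hX.tensor hX))))
  refine ⟨fun {Y} x y => ?_, fun {Y} x y => ?_, fun {Y} x y z u v => ?_,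
    fun {Y} x y z u v => ?_⟩
  -- The identity is proved for the two projections of $X\times X$, which is affine, and pulled back
  -- to arbitrary points.
  · have h : ternary t (fst _ _) (snd _ _) (snd _ _) = fst _ _ := by
      refine r.hom_ext (hX.tensor hX) fun S _ _ p => ?_
      rw [comp_ternary, ht, TensorIso.trans_assoc, TensorIso.symm_trans_self,
        TensorIso.trans_refl]
    have := congrArg (lift x y ≫ ·) h
    simpa only [comp_ternary, lift_fst, lift_snd] using this
  · have h : ternary t (snd _ _) (snd _ _) (fst _ _) = fst _ _ := by
      refine r.hom_ext (hX.tensor hX) fun S _ _ p => ?_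
      rw [comp_ternary, ht, TensorIso.self_trans_symm, TensorIso.refl_trans]
    have := congrArg (lift x y ≫ ·) h
    simpa only [comp_ternary, lift_fst, lift_snd] using this
  -- Both sides are $q_1q_2^{-1}q_3q_4^{-1}q_5$, because
  -- $(q_4q_3^{-1}q_2)^{-1}=q_2^{-1}q_3q_4^{-1}$.
  · have h : ternary t (ternary t q₁ q₂ q₃) q₄ q₅ = ternary t q₁ (ternary t q₄ q₃ q₂) q₅ :=
      h5 fun S _ _ p => by
        simp only [comp_ternary, ht, TensorIso.symm_trans, TensorIso.symm_symm,
          TensorIso.trans_assoc]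
    obtain ⟨g, rfl, rfl, rfl, rfl, rfl⟩ := hq x y z u v
    rw [← comp_ternary, ← comp_ternary, ← comp_ternary, ← comp_ternary, h]
  · have h : ternary t q₁ (ternary t q₄ q₃ q₂) q₅ = ternary t q₁ q₂ (ternary t q₃ q₄ q₅) :=
      h5 fun S _ _ p => by
        simp only [comp_ternary, ht, TensorIso.symm_trans, TensorIso.symm_symm,
          TensorIso.trans_assoc]
    obtain ⟨g, rfl, rfl, rfl, rfl, rfl⟩ := hq x y z u v
    rw [← comp_ternary, ← comp_ternary, ← comp_ternary, ← comp_ternary, h]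

end RepresentsIso

section Composites

variable {C : Type u} [Category.{w} C] [CartesianMonoidalCategory C] {X Y G H : C}

lemma ternary_left (i : X ⟶ Y) (c : X ⊗ Y ⟶ G) (l : G ⊗ X ⟶ X) {P : C} (x y z : P ⟶ X) :
    ternary (X ◁ i ▷ X ≫ (α_ _ _ _).inv ≫ c ▷ X ≫ l) x y z =
      lift (lift x (y ≫ i) ≫ c) z ≫ l := by
  simp [ternary]

lemma ternary_right (i : X ⟶ Y) (c : Y ⊗ X ⟶ H) (l : X ⊗ H ⟶ X) {P : C} (x y z : P ⟶ X) :
    ternary (X ◁ i ▷ X ≫ X ◁ c ≫ l) x y z = lift x (lift (y ≫ i) z ≫ c) ≫ l := by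
  simp [ternary]

end Composites

variable {r : RepresentsIso E E'} {r' : RepresentsIso E' E} {s : RepresentsIso E E}
  {s' : RepresentsIso E' E'} {i : compScheme T T' ⟶ compScheme T' T}
  {c : compScheme T T' ⊗ compScheme T' T ⟶ compScheme T T}
  {c' : compScheme T' T ⊗ compScheme T T' ⟶ compScheme T' T'}
  {l : compScheme T T ⊗ compScheme T T' ⟶ compScheme T T'}
  {ρ : compScheme T T' ⊗ compScheme T' T' ⟶ compScheme T T'}

lemma pt_ternary_left (hi : ∀ (S : Type) [CommRing S] [Algebra ℚ S]
      (x : specQ S ⟶ compScheme T T'), r'.pt S (x ≫ i) = (r.pt S x).symm)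
    (hc : IsComposition r r' s c) (hl : IsComposition s r r l)
    (S : Type) [CommRing S] [Algebra ℚ S] (x y z : specQ S ⟶ compScheme T T') :
    r.pt S (ternary (compScheme T T' ◁ i ▷ compScheme T T' ≫ (α_ _ _ _).inv ≫
      c ▷ compScheme T T' ≫ l) x y z) =
      ((r.pt S x).trans (r.pt S y).symm).trans (r.pt S z) := by
  rw [ternary_left, hl, hc, hi]

/-- The two composites bracket the same product, as $f(g^{-1}h)$ and $(fg^{-1})h$; they agree on
points of the affine scheme $X^3$. -/
lemma ternary_right_eq_left (hi : ∀ (S : Type) [CommRing S] [Algebra ℚ S]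
      (x : specQ S ⟶ compScheme T T'), r'.pt S (x ≫ i) = (r.pt S x).symm)
    (hc : IsComposition r r' s c) (hl : IsComposition s r r l)
    (hc' : IsComposition r' r s' c') (hρ : IsComposition r s' r ρ) :
    compScheme T T' ◁ i ▷ compScheme T T' ≫ compScheme T T' ◁ c' ≫ ρ =
      compScheme T T' ◁ i ▷ compScheme T T' ≫ (α_ _ _ _).inv ≫ c ▷ compScheme T T' ≫ l := by
  have hX := isAffineQ_compScheme T T'
  refine r.hom_ext (hX.tensor (hX.tensor hX)) fun S _ _ p => ?_
  have hp : p = lift (p ≫ fst _ _) (lift (p ≫ snd _ _ ≫ fst _ _) (p ≫ snd _ _ ≫ snd _ _)) := by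
    ext1
    · simp
    · ext1 <;> simp
  rw [hp]
  refine Eq.trans ?_ (pt_ternary_left hi hc hl S _ _ _).symm
  refine (congrArg (r.pt S) (ternary_right i c' ρ _ _ _)).trans ?_
  rw [hρ, hc', hi, TensorIso.trans_assoc]

end Torsor

end NoriDiagram
end

theorem mainTheorem6 {D : Type} [ProductDiagram.{v} D] (T₁ T₂ : GradedRep D)
    {K : Type w} [Field K] [Algebra ℚ K]
    (φ : BaseChangeIso T₁.toRepresentation T₂.toRepresentation K)
    (hT : IsNeutralTannakian (DiagCat T₁)) :
    -- `T₂` extends to a fiber functor on `C(T₁)`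
    ∃ E : TensorExtension T₁ T₂, IsLinearExactFaithful E.functor ∧
    -- the schemes `G₁`, `G₂`, `X₁₂`, `X₂₁`
    ∃ (r₁ : RepresentsIso (.self T₁) (.self T₁)) (r₂ : RepresentsIso E E)
      (r₁₂ : RepresentsIso (.self T₁) E) (r₂₁ : RepresentsIso E (.self T₁))
      (g₁ : GrpObj (compScheme T₁ T₁)) (g₂ : GrpObj (compScheme T₂ T₂))
      -- the natural morphisms between them
      (c₁ : compScheme T₁ T₂ ⊗ compScheme T₂ T₁ ⟶ compScheme T₁ T₁)
      (c₂ : compScheme T₂ T₁ ⊗ compScheme T₁ T₂ ⟶ compScheme T₂ T₂)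
      (l₁₂ : compScheme T₁ T₁ ⊗ compScheme T₁ T₂ ⟶ compScheme T₁ T₂)
      (ρ₁₂ : compScheme T₁ T₂ ⊗ compScheme T₂ T₂ ⟶ compScheme T₁ T₂)
      (l₂₁ : compScheme T₂ T₂ ⊗ compScheme T₂ T₁ ⟶ compScheme T₂ T₁)
      (ρ₂₁ : compScheme T₂ T₁ ⊗ compScheme T₁ T₁ ⟶ compScheme T₂ T₁)
      -- the inversion and the torsor structures
      (ι : compScheme T₁ T₂ ≅ compScheme T₂ T₁)
      (t₁₂ : compScheme T₁ T₂ ⊗ compScheme T₁ T₂ ⊗ compScheme T₁ T₂ ⟶ compScheme T₁ T₂)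
      (t₂₁ : compScheme T₂ T₁ ⊗ compScheme T₂ T₁ ⊗ compScheme T₂ T₁ ⟶ compScheme T₂ T₁),
      IsComposition r₁ r₁ r₁ g₁.toMonObj.mul ∧ IsComposition r₂ r₂ r₂ g₂.toMonObj.mul ∧
      IsComposition r₁₂ r₂₁ r₁ c₁ ∧ IsComposition r₂₁ r₁₂ r₂ c₂ ∧
      IsComposition r₁ r₁₂ r₁₂ l₁₂ ∧ IsComposition r₁₂ r₂ r₁₂ ρ₁₂ ∧
      IsComposition r₂ r₂₁ r₂₁ l₂₁ ∧ IsComposition r₂₁ r₁ r₂₁ ρ₂₁ ∧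
      (∀ (S : Type) [CommRing S] [Algebra ℚ S] (x : specQ S ⟶ compScheme T₁ T₂),
        r₂₁.pt S (x ≫ ι.hom) = (r₁₂.pt S x).symm) ∧
      IsTorsor t₁₂ ∧ IsTorsor t₂₁ ∧
      (∀ (S : Type) [CommRing S] [Algebra ℚ S] (x y z : specQ S ⟶ compScheme T₁ T₂),
        r₁₂.pt S (ternary t₁₂ x y z) =
          ((r₁₂.pt S x).trans (r₁₂.pt S y).symm).trans (r₁₂.pt S z)) ∧
      (∀ (S : Type) [CommRing S] [Algebra ℚ S] (x y z : specQ S ⟶ compScheme T₂ T₁),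
        r₂₁.pt S (ternary t₂₁ x y z) =
          ((r₂₁.pt S x).trans (r₂₁.pt S y).symm).trans (r₂₁.pt S z)) ∧
      -- both factor through the actions of `G₁` and `G₂`
      compScheme T₁ T₂ ◁ ι.hom ▷ compScheme T₁ T₂ ≫ (α_ _ _ _).inv ≫
        c₁ ▷ compScheme T₁ T₂ ≫ l₁₂ = t₁₂ ∧
      compScheme T₁ T₂ ◁ ι.hom ▷ compScheme T₁ T₂ ≫
        compScheme T₁ T₂ ◁ c₂ ≫ ρ₁₂ = t₁₂ ∧
      compScheme T₂ T₁ ◁ ι.inv ▷ compScheme T₂ T₁ ≫ (α_ _ _ _).inv ≫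
        c₂ ▷ compScheme T₂ T₁ ≫ l₂₁ = t₂₁ ∧
      compScheme T₂ T₁ ◁ ι.inv ▷ compScheme T₂ T₁ ≫
        compScheme T₂ T₁ ◁ c₁ ≫ ρ₂₁ = t₂₁ := by
  -- Rigidity is what lets $\mathrm{Spec}\,A_{T,T'}$ represent isomorphisms and not merely tensor
  -- transformations.
  obtain ⟨hR⟩ := hT.rigid
  let A₁ := selfFibreData T₁
  let A₂ := Fib.fibreData φ.locIso
  let r₁ := A₁.representsIso A₁
  let r₂ := A₂.representsIso A₂
  let r₁₂ := A₁.representsIso A₂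
  let r₂₁ := A₂.representsIso A₁
  obtain ⟨g₁, hg₁⟩ := r₁.exists_grpObj
  obtain ⟨g₂, hg₂⟩ := r₂.exists_grpObj
  obtain ⟨c₁, hc₁⟩ := r₁₂.exists_isComposition r₂₁ r₁
  obtain ⟨c₂, hc₂⟩ := r₂₁.exists_isComposition r₁₂ r₂
  obtain ⟨l₁₂, hl₁₂⟩ := r₁.exists_isComposition r₁₂ r₁₂
  obtain ⟨ρ₁₂, hρ₁₂⟩ := r₁₂.exists_isComposition r₂ r₁₂
  obtain ⟨l₂₁, hl₂₁⟩ := r₂.exists_isComposition r₂₁ r₂₁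
  obtain ⟨ρ₂₁, hρ₂₁⟩ := r₂₁.exists_isComposition r₁ r₂₁
  obtain ⟨ι, hι, hι'⟩ := r₁₂.exists_inversion r₂₁
  -- The torsor morphisms are taken to be the composites through the left actions, so these
  -- factorisations hold by definition. The case of $X_{2,1}$ exchanges the two functors and uses
  -- the inverse of $\iota$.
  have t₁₂ := pt_ternary_left hι hc₁ hl₁₂
  have t₂₁ := pt_ternary_left hι' hc₂ hl₂₁
  exact ⟨_, A₂.isLinearExactFaithful hT, r₁, r₂, r₁₂, r₂₁, g₁, g₂, c₁, c₂, l₁₂, ρ₁₂, l₂₁, ρ₂₁, ι,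
    _, _, hg₁, hg₂, hc₁, hc₂, hl₁₂, hρ₁₂, hl₂₁, hρ₂₁, hι, r₁₂.isTorsor t₁₂, r₂₁.isTorsor t₂₁,
    t₁₂, t₂₁, rfl, ternary_right_eq_left hι hc₁ hl₁₂ hc₂ hρ₁₂, rfl,
    ternary_right_eq_left hι' hc₂ hl₂₁ hc₁ hρ₂₁⟩
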